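/- Let $d\in\{2,3\}$, let $\Omega\subset\mathbb R^d$ be a polygonal/polyhedral domain, let $j\ge 0$, and let $(l,G_j)$ be one of the two pairs: RT, where $l=j$ and $G_j=[P_j]^d+\widehat P_j\,\mathbf x$ ($\widehat P_j$ the homogeneous polynomials of degree $j$); or BDM, where $l=j+1$ and $G_j=[P_{j+1}]^d$. Fix constants $0<\alpha\le\beta$, $\sigma,\tau>0$, $0<c_1\le c_2$, $0<c_3\le c_4$ and $\omega<2$. **Discretization.** Let $\mathcal T_h$ be a conforming simplicial mesh of $\Omega$ (with $\partial\Omega$ a union of mesh edges/faces) of mesh size $h=\max_K\operatorname{diam}K$, which is shape-regular (every $K\in\mathcal T_h$ contains a ball of radius $r_K>0$ with $\operatorname{diam}K\le\sigma r_K$) and quasi-uniform ($h\le\tau\operatorname{diam}K$ for all $K$). Let $\mathbb A$ be a measurable symmetric matrix function with $\alpha|\xi|^2\le\xi^T\mathbb A(x)\xi\le\beta|\xi|^2$ for all $x\in\Omega$, $\xi\in\mathbb R^d$ (for example, a piecewise constant one). Let $V_h$ be the space of pairs $v=\{v_0,v_b\}$ with $v_0|_K\in P_j(K)$ on each element, $v_b|_e\in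 P_l(e)$ on each edge/face, and $v_b|_e=0$ if $e\subset\partial\Omega$. The weak gradient $\nabla_w v|_K\in G_j$ is defined by $$(\nabla_w v,q)_K=-(v_0,\nabla\cdot q)_K+\langle v_b,q\cdot n\rangle_{\partial K}\qquad\text{for all }q\in G_j .$$ Put $a_h(u,v)=\sum_K(\mathbb A\nabla_w u,\nabla_w v)_K$ and $$((v,\varphi))=\sum_K\big[(v_0,\varphi_0)_K+h\,(v_0-v_b,\varphi_0-\varphi_b)_{\partial K}\big].$$ **Reduced system.** Let $V_0=\{\{v_0,0\}\in V_h\}$ and $V_b=\{\{0,v_b\}\in V_h\}$, let $P_0:V_b\to V_0$ be given by $a_h(P_0v_b,\zeta_0)=a_h(v_b,\zeta_0)$ for all $\zeta_0\in V_0$, and let $V_r=(I-P_0)V_b$ with the inner product $((\cdot,\cdot))$. Let $A_r:V_r\to V_r$ be given by $((A_ru,v))=a_h(u,v)$, and let $\rho_{A_r}=\lambda_{\max}(A_r)$. Let $\mathcal V_h\subset H^1_0(\Omega)$ be the continuous piecewise linear finite element space on $\mathcal T_h$ with the $L^2(\Omega)$ inner product, and let $\mathcal A:\mathcal V_h\to\mathcal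 V_h$ be given by $(\mathcal Aw,z)=(\mathbb A\nabla w,\nabla z)$. Let $Q_b:\mathcal V_h\to V_b$ be the $L^2(e)$-projection onto $P_l(e)$ on each edge/face $e$, let $\Pi_r=(I-P_0)Q_b:\mathcal V_h\to V_r$, and let $\Pi_r^t:V_r\to\mathcal V_h$ be given by $(\Pi_r^tv,w)=((v,\Pi_rw))$. **Theorem.** There is a constant $C$, depending only on $d,\Omega,j$, the choice of pair, $\alpha,\beta,\sigma,\tau,c_1,c_2,c_3,c_4$ and $\omega$ (in particular not on $h$, the mesh or $\mathbb A$), such that the following holds for all $\mathcal T_h$ and $\mathbb A$ as above. Let $R:V_r\to V_r$ and $\mathcal B:\mathcal V_h\to\mathcal V_h$ be linear operators, symmetric with respect to $((\cdot,\cdot))$ and $(\cdot,\cdot)$ respectively, with $$c_1\rho_{A_r}^{-1}((v,v))\le((Rv,v))\le c_2\rho_{A_r}^{-1}((v,v)),\qquad c_3(\mathcal Aw,w)\le(\mathcal B\mathcal Aw,\mathcal Aw)\le c_4(\mathcal Aw,w)$$ for all $v\in V_r$ and $w\in\mathcal V_h$. 1. (Additive.) $B=R+\Pi_r\mathcal B\Pi_r^t$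 is symmetric and positive definite with respect to $((\cdot,\cdot))$, and $\kappa(BA_r)=\lambda_{\max}(BA_r)/\lambda_{\min}(BA_r)\le C$. 2. (Multiplicative.) Suppose in addition that $((RA_rv,A_rv))\le\omega\,((A_rv,v))$ for all $v\in V_r$, that is, $\lambda_{\max}(RA_r)\le\omega<2$. Then the relation $I-BA_r=(I-RA_r)(I-\Pi_r\mathcal B\Pi_r^tA_r)(I-RA_r)$ determines a unique linear operator $B$ on $V_r$. This $B$ is symmetric and positive definite with respect to $((\cdot,\cdot))$, and $\kappa(BA_r)\le C$. (When $V_r=\{0\}$ the bounds on $\kappa$ are void.) -/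

import Mathlib

noncomputable section

namespace WG

open MeasureTheory MvPolynomial
open scoped Matrix

/-- Euclidean space `ℝᵈ`. -/
abbrev E (d : ℕ) := EuclideanSpace ℝ (Fin d)

/-! ### Operators given by bilinear forms, eigenvalues, condition numbers -/

section Abstract

variable {V W : Type*} [AddCommGroup V] [Module ℝ V] [AddCommGroup W] [Module ℝ W]

/-- The linear operator `T : V → W` determined by `m (T u) v = a u v` for all `u ∈ V`, `v ∈ W`.
For finite-dimensional `W` with `m` an inner product on `W` and `a` bilinear, there is exactly one
such `T`. -/
def formOperator (m : W → W → ℝ) (a : V → W → ℝ) : V →ₗ[ℝ] W :=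
  Classical.epsilon fun T : V →ₗ[ℝ] W => ∀ u v, m (T u) v = a u v

/-- Symmetry of an operator with respect to the inner product `m`. -/
def IsSymm (m : V → V → ℝ) (B : V →ₗ[ℝ] V) : Prop := ∀ u v, m (B u) v = m u (B v)

/-- Symmetric and positive definite with respect to the inner product `m`. -/
def IsSPD (m : V → V → ℝ) (B : V →ₗ[ℝ] V) : Prop :=
  IsSymm m B ∧ ∀ v, v ≠ 0 → 0 < m (B v) v

/-- The largest eigenvalue. -/
def lambdaMax (T : V →ₗ[ℝ] V) : ℝ := sSup {μ : ℝ | Module.End.HasEigenvalue T μ}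

/-- The smallest eigenvalue. -/
def lambdaMin (T : V →ₗ[ℝ] V) : ℝ := sInf {μ : ℝ | Module.End.HasEigenvalue T μ}

/-- The condition number `κ(T) = λ_max(T) / λ_min(T)`. -/
def condNumber (T : V →ₗ[ℝ] V) : ℝ := lambdaMax T / lambdaMin T

end Abstract

/-! ### Polynomials -/

/-- The value at a point of Euclidean space of a polynomial in the coordinates. -/
def pval {d : ℕ} (p : MvPolynomial (Fin d) ℝ) (x : E d) : ℝ := eval x.ofLp p

/-- `P_k(S)`: the restrictions to `S` of polynomials of total degree at most `k`. A function on `S`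
is stored as a function on `ℝᵈ` that vanishes outside `S`. -/
def polyOn {d : ℕ} (S : Set (E d)) (k : ℕ) : Submodule ℝ (E d → ℝ) where
  carrier := {f | ∃ p ∈ restrictTotalDegree (Fin d) ℝ k, f = S.indicator (pval p)}
  add_mem' := by
    rintro _ _ ⟨p, hp, rfl⟩ ⟨q, hq, rfl⟩
    refine ⟨p + q, Submodule.add_mem _ hp hq, ?_⟩
    ext x
    by_cases hx : x ∈ S <;> simp [pval, hx]
  zero_mem' := ⟨0, Submodule.zero_mem _, by
    ext x
    simp [pval, Set.indicator]⟩
  smul_mem' := by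
    rintro c _ ⟨p, hp, rfl⟩
    refine ⟨c • p, Submodule.smul_mem _ c hp, ?_⟩
    ext x
    by_cases hx : x ∈ S <;> simp [pval, hx, smul_eval]

/-- The two element pairs: `W_{j,j}` with the Raviart–Thomas element, and `W_{j,j+1}` with the
Brezzi–Douglas–Marini element. -/
inductive Pair where
  | RT
  | BDM

/-- The polynomial degree `l` on edges/faces. -/
def Pair.faceDegree : Pair → ℕ → ℕ
  | .RT, j => j
  | .BDM, j => j + 1

/-- Multiplication of a polynomial by the vector field `x ↦ x`. -/
def mulX (d : ℕ) : MvPolynomial (Fin d) ℝ →ₗ[ℝ] (Fin d → MvPolynomial (Fin d) ℝ) where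
  toFun p := fun i => p * X i
  map_add' p q := by
    funext i
    simp [add_mul]
  map_smul' c p := by
    funext i
    simp

/-- The local vector polynomial space `G_j`: `[P_{j+1}]ᵈ` for BDM, and `[P_j]ᵈ + P̂_j x` for RT,
where `P̂_j` is the space of homogeneous polynomials of degree `j`. -/
def Pair.G (d : ℕ) : Pair → ℕ → Submodule ℝ (Fin d → MvPolynomial (Fin d) ℝ)
  | .RT, j => Submodule.pi Set.univ (fun _ => restrictTotalDegree (Fin d) ℝ j) ⊔
      (homogeneousSubmodule (Fin d) ℝ j).map (mulX d)
  | .BDM, j => Submodule.pi Set.univ (fun _ => restrictTotalDegree (Fin d) ℝ (j + 1))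

/-- The vector field on `ℝᵈ` given by a vector of polynomials. -/
def vval {d : ℕ} (q : Fin d → MvPolynomial (Fin d) ℝ) (x : E d) : Fin d → ℝ := fun i => pval (q i) x

/-- The divergence of a polynomial vector field. -/
def divergence {d : ℕ} (q : Fin d → MvPolynomial (Fin d) ℝ) : MvPolynomial (Fin d) ℝ :=
  ∑ i, pderiv i (q i)

/-! ### Meshes -/

/-- The closed simplex with the given vertices. -/
abbrev hull {d : ℕ} (s : Finset (E d)) : Set (E d) := convexHull ℝ (s : Set (E d))

/-- A conforming triangular/tetrahedral mesh of `Ω ⊆ ℝᵈ`: a finite geometric simplicial complex, all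
of whose simplices are faces of `d`-dimensional ones, which covers the closure of `Ω`, and such that
the boundary of `Ω` is made up of edges/faces of the mesh. -/
structure Mesh (d : ℕ) (Ω : Set (E d)) extends Geometry.SimplicialComplex ℝ (E d) where
  finite_faces : faces.Finite
  pure : ∀ s ∈ faces, ∃ K ∈ faces, s ⊆ K ∧ K.card = d + 1
  cover : ⋃ s ∈ faces, hull s = closure Ω
  boundary : frontier Ω = ⋃ e ∈ {e ∈ faces | e.card = d ∧ hull e ⊆ frontier Ω}, hull e

/-- A diffusion coefficient: symmetric, measurable, with `α |ξ|² ≤ ξᵀ 𝔸(x) ξ ≤ β |ξ|²`, `x ∈ Ω`. -/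
structure IsDiffusion {d : ℕ} (Ω : Set (E d)) (α β : ℝ) (𝔸 : E d → Matrix (Fin d) (Fin d) ℝ) :
    Prop where
  symm : ∀ x ∈ Ω, (𝔸 x).IsSymm
  measurable : ∀ i k, AEMeasurable (fun x => 𝔸 x i k) (volume.restrict Ω)
  lower : ∀ x ∈ Ω, ∀ ξ : Fin d → ℝ, α * (ξ ⬝ᵥ ξ) ≤ ξ ⬝ᵥ (𝔸 x *ᵥ ξ)
  upper : ∀ x ∈ Ω, ∀ ξ : Fin d → ℝ, ξ ⬝ᵥ (𝔸 x *ᵥ ξ) ≤ β * (ξ ⬝ᵥ ξ)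

/-- The unit outward normal of the simplex `hull K` on its edge/face `hull e`. -/
def normal {d : ℕ} (K e : Finset (E d)) : E d :=
  Classical.epsilon fun n : E d => ‖n‖ = 1 ∧ ∀ x ∈ e,
    (∀ y ∈ e, inner ℝ n (y - x) = 0) ∧ ∀ y ∈ K, inner ℝ n (y - x) ≤ 0

namespace Mesh

variable {d : ℕ} {Ω : Set (E d)} (T : Mesh d Ω)

/-- The triangles/tetrahedra of the mesh. -/
def elements : Finset (Finset (E d)) := T.finite_faces.toFinset.filter fun s => s.card = d + 1

/-- The edges (`d = 2`) or faces (`d = 3`) of the mesh. -/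
def sides : Finset (Finset (E d)) := T.finite_faces.toFinset.filter fun s => s.card = d

open Classical in
/-- The edges/faces that make up the boundary of the element `K`. -/
def sidesOf (K : T.elements) : Finset T.sides := Finset.univ.filter fun e => e.1 ⊆ K.1

/-- The mesh size `h`. -/
def meshSize : ℝ := ⨆ K : T.elements, Metric.diam (hull K.1)

/-- Every element `K` contains a ball of radius `r` with `diam K ≤ σ r`. -/
def IsShapeRegular (σ : ℝ) : Prop :=
  ∀ K ∈ T.elements, ∃ c r, 0 < r ∧ Metric.ball c r ⊆ hull K ∧ Metric.diam (hull K) ≤ σ * r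

/-- Every element has diameter at least `h / τ`. -/
def IsQuasiUniform (τ : ℝ) : Prop := ∀ K ∈ T.elements, T.meshSize ≤ τ * Metric.diam (hull K)

/-! ### The weak Galerkin space -/

/-- Pairs `{v_0, v_b}`: a function for each element and a function for each edge/face. -/
abbrev Weak := (T.elements → E d → ℝ) × (T.sides → E d → ℝ)

/-- The weak Galerkin space `V_h`. -/
def Vh (P : Pair) (j : ℕ) : Submodule ℝ T.Weak where
  carrier := {v | (∀ K, v.1 K ∈ polyOn (hull K.1) j) ∧
    (∀ e, v.2 e ∈ polyOn (hull e.1) (P.faceDegree j)) ∧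
    ∀ e, hull e.1 ⊆ frontier Ω → v.2 e = 0}
  add_mem' := by
    rintro u v ⟨hu, hu', hu''⟩ ⟨hv, hv', hv''⟩
    refine ⟨fun K => Submodule.add_mem _ (hu K) (hv K),
      fun e => Submodule.add_mem _ (hu' e) (hv' e), fun e he => ?_⟩
    simp [hu'' e he, hv'' e he]
  zero_mem' := ⟨fun K => Submodule.zero_mem _, fun e => Submodule.zero_mem _, fun _ _ => rfl⟩
  smul_mem' := by
    rintro c v ⟨hv, hv', hv''⟩
    refine ⟨fun K => Submodule.smul_mem _ c (hv K),
      fun e => Submodule.smul_mem _ c (hv' e), fun e he => ?_⟩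
    simp [hv'' e he]

/-- The discrete `L²` inner product
`∑_K [(v_0, φ_0)_K + h (v_0 - v_b, φ_0 - φ_b)_{∂K}]`; `μHE[d - 1]` is surface measure. -/
def ip (v φ : T.Weak) : ℝ :=
  ∑ K : T.elements, ((∫ x in hull K.1, v.1 K x * φ.1 K x) +
    T.meshSize * ∑ e ∈ T.sidesOf K,
      ∫ x in hull e.1, (v.1 K x - v.2 e x) * (φ.1 K x - φ.2 e x) ∂μHE[d - 1])

/-- The discrete weak gradient on `K`: the unique `g ∈ G_j` with
`(g, q)_K = -(v_0, ∇·q)_K + ⟨v_b, q·n⟩_{∂K}` for all `q ∈ G_j`. -/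
def weakGrad (P : Pair) (j : ℕ) (v : T.Weak) (K : T.elements) : Fin d → MvPolynomial (Fin d) ℝ :=
  Classical.epsilon fun g => g ∈ P.G d j ∧ ∀ q ∈ P.G d j,
    ∫ x in hull K.1, vval g x ⬝ᵥ vval q x =
      -(∫ x in hull K.1, v.1 K x * pval (divergence q) x) +
      ∑ e ∈ T.sidesOf K, ∫ x in hull e.1, v.2 e x * (vval q x ⬝ᵥ (normal K.1 e.1).ofLp) ∂μHE[d - 1]

/-- The bilinear form `a_h(u, v) = (𝔸 ∇_w u, ∇_w v)`. -/
def ah (P : Pair) (j : ℕ) (𝔸 : E d → Matrix (Fin d) (Fin d) ℝ) (u v : T.Weak) : ℝ :=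
  ∑ K : T.elements,
    ∫ x in hull K.1, (𝔸 x *ᵥ vval (T.weakGrad P j u K) x) ⬝ᵥ vval (T.weakGrad P j v K) x

/-- `V_0 = {v ∈ V_h | v = {v_0, 0}}`. -/
def V0 (P : Pair) (j : ℕ) : Submodule ℝ T.Weak := T.Vh P j ⊓ LinearMap.ker (LinearMap.snd ℝ _ _)

/-- `V_b = {v ∈ V_h | v = {0, v_b}}`. -/
def Vb (P : Pair) (j : ℕ) : Submodule ℝ T.Weak := T.Vh P j ⊓ LinearMap.ker (LinearMap.fst ℝ _ _)

/-! ### The reduced system -/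

variable (P : Pair) (j : ℕ) (𝔸 : E d → Matrix (Fin d) (Fin d) ℝ)

/-- The `a_h`-orthogonal projector `P_0 : V_b → V_0`, `a_h(P_0 v_b, ζ_0) = a_h(v_b, ζ_0)`. -/
def P0 : T.Vb P j →ₗ[ℝ] T.V0 P j :=
  formOperator (fun u ζ => T.ah P j 𝔸 u ζ) (fun v ζ => T.ah P j 𝔸 v ζ)

/-- `I - P_0 : V_b → V_h`, `v_b ↦ {-P_0 v_b, v_b}`. -/
def graphMap : T.Vb P j →ₗ[ℝ] T.Weak :=
  (T.Vb P j).subtype - (T.V0 P j).subtype ∘ₗ T.P0 P j 𝔸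

/-- The graph space `V_r = (I - P_0) V_b`. -/
def Vr : Submodule ℝ T.Weak := LinearMap.range (T.graphMap P j 𝔸)

/-- The discrete `L²` inner product on `V_r`. -/
def ipr (u v : T.Vr P j 𝔸) : ℝ := T.ip u v

/-- The operator `A_r : V_r → V_r`, `((A_r u, v)) = a_h(u, v)`. -/
def Ar : T.Vr P j 𝔸 →ₗ[ℝ] T.Vr P j 𝔸 :=
  formOperator (T.ipr P j 𝔸) (fun u v => T.ah P j 𝔸 u v)

/-! ### The conforming piecewise linear space -/

/-- The `P_1` conforming finite element space in `H_0^1(Ω)`: continuous functions, affine on each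
element, and zero on `∂Ω` (stored with the value zero outside `Ω`). -/
def P1 : Submodule ℝ (E d → ℝ) where
  carrier := {w | Continuous w ∧
    (∀ K ∈ T.elements, ∃ p ∈ restrictTotalDegree (Fin d) ℝ 1, ∀ x ∈ hull K, w x = pval p x) ∧
    ∀ x, x ∉ Ω → w x = 0}
  add_mem' := by
    rintro u v ⟨hu, hu', hu''⟩ ⟨hv, hv', hv''⟩
    refine ⟨hu.add hv, fun K hK => ?_, fun x hx => by simp [hu'' x hx, hv'' x hx]⟩
    obtain ⟨p, hp, hp'⟩ := hu' K hK
    obtain ⟨q, hq, hq'⟩ := hv' K hK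
    exact ⟨p + q, Submodule.add_mem _ hp hq, fun x hx => by simp [hp' x hx, hq' x hx, pval]⟩
  zero_mem' := ⟨continuous_const, fun K _ => ⟨0, Submodule.zero_mem _, fun x _ => by simp [pval]⟩,
    fun _ _ => rfl⟩
  smul_mem' := by
    rintro c v ⟨hv, hv', hv''⟩
    refine ⟨hv.const_smul c, fun K hK => ?_, fun x hx => by simp [hv'' x hx]⟩
    obtain ⟨p, hp, hp'⟩ := hv' K hK
    exact ⟨c • p, Submodule.smul_mem _ c hp, fun x hx => by simp [hp' x hx, pval, smul_eval]⟩

/-- The `L²(Ω)` inner product on the conforming space. -/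
def ipc (w z : T.P1) : ℝ := ∫ x in Ω, w.1 x * z.1 x

/-- The form `(𝔸 ∇w, ∇z)` on the conforming space. -/
def ac (w z : T.P1) : ℝ := ∫ x in Ω, (𝔸 x *ᵥ (gradient w.1 x).ofLp) ⬝ᵥ (gradient z.1 x).ofLp

/-- The operator `𝒜` on the conforming space, `(𝒜 w, z) = (𝔸 ∇w, ∇z)`. -/
def Ac : T.P1 →ₗ[ℝ] T.P1 := formOperator T.ipc (T.ac 𝔸)

/-! ### Transfer operators -/

/-- `Q_b`: on each edge/face `e`, the `L²(e)`-projection to `P_l(e)`. -/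
def Qb : T.P1 →ₗ[ℝ] T.Vb P j :=
  Classical.epsilon fun Q : T.P1 →ₗ[ℝ] T.Vb P j => ∀ (w : T.P1) (e : T.sides),
    ∀ p ∈ polyOn (hull e.1) (P.faceDegree j),
      ∫ x in hull e.1, (Q w).1.2 e x * p x ∂μHE[d - 1] = ∫ x in hull e.1, w.1 x * p x ∂μHE[d - 1]

/-- The prolongation `Π_r = (I - P_0) Q_b`. -/
def Pir : T.P1 →ₗ[ℝ] T.Vr P j 𝔸 := (T.graphMap P j 𝔸).rangeRestrict ∘ₗ T.Qb P j

/-- The restriction `Π_rᵗ`, `(Π_rᵗ v, w) = ((v, Π_r w))`. -/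
def PirT : T.Vr P j 𝔸 →ₗ[ℝ] T.P1 :=
  formOperator T.ipc (fun v w => T.ipr P j 𝔸 v (T.Pir P j 𝔸 w))

/-- The additive preconditioner `B = R + Π_r 𝓑 Π_rᵗ`. -/
def additive (R : T.Vr P j 𝔸 →ₗ[ℝ] T.Vr P j 𝔸) (𝓑 : T.P1 →ₗ[ℝ] T.P1) :
    T.Vr P j 𝔸 →ₗ[ℝ] T.Vr P j 𝔸 :=
  R + T.Pir P j 𝔸 ∘ₗ 𝓑 ∘ₗ T.PirT P j 𝔸

/-- `B` is the multiplicative preconditioner: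
`I - B A_r = (I - R A_r) (I - Π_r 𝓑 Π_rᵗ A_r) (I - R A_r)`. -/
def IsMultiplicative (R : T.Vr P j 𝔸 →ₗ[ℝ] T.Vr P j 𝔸) (𝓑 : T.P1 →ₗ[ℝ] T.P1)
    (B : T.Vr P j 𝔸 →ₗ[ℝ] T.Vr P j 𝔸) : Prop :=
  LinearMap.id - B ∘ₗ T.Ar P j 𝔸 =
    (LinearMap.id - R ∘ₗ T.Ar P j 𝔸) ∘ₗ
    (LinearMap.id - T.Pir P j 𝔸 ∘ₗ 𝓑 ∘ₗ T.PirT P j 𝔸 ∘ₗ T.Ar P j 𝔸) ∘ₗ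
    (LinearMap.id - R ∘ₗ T.Ar P j 𝔸)

/-- The smoother `R` is symmetric and
`c₁ ρ⁻¹ ((v, v)) ≤ ((R v, v)) ≤ c₂ ρ⁻¹ ((v, v))` with `ρ = λ_max(A_r)`. -/
def IsSmoother (c₁ c₂ : ℝ) (R : T.Vr P j 𝔸 →ₗ[ℝ] T.Vr P j 𝔸) : Prop :=
  IsSymm (T.ipr P j 𝔸) R ∧ ∀ v,
    c₁ * (lambdaMax (T.Ar P j 𝔸))⁻¹ * T.ipr P j 𝔸 v v ≤ T.ipr P j 𝔸 (R v) v ∧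
    T.ipr P j 𝔸 (R v) v ≤ c₂ * (lambdaMax (T.Ar P j 𝔸))⁻¹ * T.ipr P j 𝔸 v v

/-- The coarse solver `𝓑` is symmetric and
`c₃ (𝒜 w, w) ≤ (𝓑 𝒜 w, 𝒜 w) ≤ c₄ (𝒜 w, w)`. -/
def IsCoarseSolver (c₃ c₄ : ℝ) (𝓑 : T.P1 →ₗ[ℝ] T.P1) : Prop :=
  IsSymm T.ipc 𝓑 ∧ ∀ w,
    c₃ * T.ipc (T.Ac 𝔸 w) w ≤ T.ipc (𝓑 (T.Ac 𝔸 w)) (T.Ac 𝔸 w) ∧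
    T.ipc (𝓑 (T.Ac 𝔸 w)) (T.Ac 𝔸 w) ≤ c₄ * T.ipc (T.Ac 𝔸 w) w

end Mesh

end WG

end

/-! The proof is the auxiliary space method: the smoother handles what a function of `V_r` does on
the scale `h`, and the conforming piecewise linear space handles the rest. In the abstract setting
`AuxSpace` three facts are needed, with constants independent of `h`. The number `ρ` bounds the
energy by the inner product. The prolongation `Π_r` is bounded in energy. Every `v` has a `w` for
which both `ρ ((v - Π_r w, v - Π_r w))` and `(𝔸∇w, ∇w)` are at most `C a_h(v, v)`. The first two
bound the spectrum of `B A_r` from above, and the decomposition with Cauchy–Schwarz bounds it from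
below (`AuxSpace.energy_le`). For the multiplicative method `AuxSpace.mult_form` shows that, in the
energy, `B A_r` is `2T - T²` with `T = R A_r`, plus the coarse operator conjugated by `I - T`; `ω <
2` keeps `2T - T²` comparable with `T`.

The local estimates come from the reference simplex. There the weak gradient vanishes only on
constants (`const_of_pairing`), and finite dimension turns statements about kernels into inverse and
Poincaré inequalities. The contravariant (Piola) transformation maps `G_j` to itself and transports
the definition of the weak gradient exactly (`Mesh.LocalRep.rhs`). Shape regularity and
quasi-uniformity bound the affine maps by `h` and `κ = 1 / (σ τ)` alone.

Globally, functions of `V_r` minimize the energy among weak functions with the same face values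
(`Mesh.ah_Vr_le`). Hence the energy of `Π_r w` is at most that of any convenient extension of `Q_b
w`, and `((z, z))` is controlled on `V_r` by the face values of `z`. For the decomposition
(`Mesh.exists_P1_approx`), `v` is replaced by its element means. A Poincaré inequality bounds the
difference of the means on two sides of a common face, and the mean itself beside a boundary face,
where `v_b = 0`. The nodal values of `w` are means of adjacent elements, or zero on the boundary,
and they are compared with the other means along chains of face neighbours around a vertex. Such a
chain exists or runs into the boundary (`Mesh.star_connected`), and the number of elements around a
vertex is bounded by comparing volumes. The error of `Π_r w` is then of order `h²` times the energy,
which is compensated by `ρ ≤ C h⁻²` from the inverse inequality. No elliptic regularity enters. -/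

noncomputable section

namespace WG

open MeasureTheory MvPolynomial
open scoped Matrix

/-! ### Bilinear forms, operators and eigenvalues in finite dimension -/

section

section Abstract

variable {V W : Type*} [AddCommGroup V] [Module ℝ V] [AddCommGroup W] [Module ℝ W]

/-- A symmetric positive definite bilinear form. -/
structure IsInner (M : LinearMap.BilinForm ℝ V) : Prop where
  symm : ∀ u v, M u v = M v u
  pos : ∀ v, v ≠ 0 → 0 < M v v

/-- A symmetric positive semidefinite bilinear form. -/
structure IsSemiInner (M : LinearMap.BilinForm ℝ V) : Prop where
  symm : ∀ u v, M u v = M v u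
  nonneg : ∀ v, 0 ≤ M v v

lemma IsInner.semi {M : LinearMap.BilinForm ℝ V} (h : IsInner M) : IsSemiInner M :=
  ⟨h.symm, fun v => by
    by_cases hv : v = 0
    · simp [hv]
    · exact (h.pos v hv).le⟩

lemma IsSemiInner.cauchy {M : LinearMap.BilinForm ℝ V} (h : IsSemiInner M) (u v : V) :
    M u v ^ 2 ≤ M u u * M v v :=
  LinearMap.BilinForm.apply_sq_le_of_symm M h.nonneg ⟨fun u v => by simpa using h.symm u v⟩ u v

lemma IsSemiInner.apply_eq_zero {M : LinearMap.BilinForm ℝ V} (h : IsSemiInner M) {u : V}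
    (hu : M u u = 0) (v : V) : M u v = 0 := by
  have := h.cauchy u v
  rw [hu, zero_mul] at this
  exact pow_eq_zero_iff two_ne_zero |>.1 (le_antisymm this (sq_nonneg _))

lemma IsSemiInner.add_le {M : LinearMap.BilinForm ℝ V} (h : IsSemiInner M) (u v : V) :
    M (u + v) (u + v) ≤ 2 * M u u + 2 * M v v := by
  have h1 := h.nonneg (u - v)
  simp only [map_sub, map_add, LinearMap.sub_apply, LinearMap.add_apply] at h1 ⊢
  linarith [h.symm u v]

/-- The inner product space structure determined by a positive definite form. -/
@[reducible]
def IsInner.core {M : LinearMap.BilinForm ℝ V} (h : IsInner M) : InnerProductSpace.Core ℝ V where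
  inner u v := M u v
  conj_inner_symm u v := by simpa using h.symm v u
  re_inner_nonneg v := by simpa using h.semi.nonneg v
  add_left u v w := by simp
  smul_left u v r := by simp
  definite v hv := by
    by_contra hne
    exact (h.pos v hne).ne' hv

lemma IsInner.exists_operator [FiniteDimensional ℝ W] {M : LinearMap.BilinForm ℝ W}
    (h : IsInner M) (a : V →ₗ[ℝ] W →ₗ[ℝ] ℝ) : ∃ T : V →ₗ[ℝ] W, ∀ u v, M (T u) v = a u v := by
  have hinj : Function.Injective M := by
    rw [injective_iff_map_eq_zero]
    intro w hw
    by_contra hne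
    have := h.pos w hne
    simp [hw] at this
  have hfr : Module.finrank ℝ W = Module.finrank ℝ (Module.Dual ℝ W) :=
    (Subspace.dual_finrank_eq).symm
  let e : W ≃ₗ[ℝ] Module.Dual ℝ W := LinearEquiv.ofBijective M
    ⟨hinj, (LinearMap.injective_iff_surjective_of_finrank_eq_finrank hfr).1 hinj⟩
  refine ⟨e.symm.toLinearMap ∘ₗ a, fun u v => ?_⟩
  have : M (e.symm (a u)) = a u := e.apply_symm_apply (a u)
  simp [this]

/-- `formOperator` is an `epsilon` choice, so its defining property is available only after
existence is proved. `m'` and `a'` are the bare functions used in the definitions, `M` and `a` their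
bilinear versions. -/
lemma formOperator_spec [FiniteDimensional ℝ W] {M : LinearMap.BilinForm ℝ W}
    (h : IsInner M) (a : V →ₗ[ℝ] W →ₗ[ℝ] ℝ) {m' : W → W → ℝ} {a' : V → W → ℝ}
    (hm : ∀ u v, m' u v = M u v) (ha : ∀ u v, a' u v = a u v) (u : V) (v : W) :
    m' (formOperator m' a' u) v = a' u v := by
  have hex : ∃ T : V →ₗ[ℝ] W, ∀ u v, m' (T u) v = a' u v := by
    obtain ⟨T, hT⟩ := h.exists_operator a
    exact ⟨T, fun u v => by rw [hm, ha, hT]⟩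
  exact Classical.epsilon_spec hex u v

lemma exists_bilin_le_norm_sq {F : Type*} [NormedAddCommGroup F] [InnerProductSpace ℝ F]
    [FiniteDimensional ℝ F] (b : F →ₗ[ℝ] F →ₗ[ℝ] ℝ) :
    ∃ C : ℝ, 0 < C ∧ ∀ v, b v v ≤ C * inner ℝ v v := by
  let b' := LinearMap.toContinuousBilinearMap (𝕜 := ℝ) b
  refine ⟨‖b'‖ + 1, by positivity, fun v => ?_⟩
  have h1 : ‖b' v v‖ ≤ ‖b'‖ * ‖v‖ * ‖v‖ := b'.le_opNorm₂ v v
  have h3 : b v v ≤ ‖b' v v‖ := le_abs_self _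
  rw [real_inner_self_eq_norm_mul_norm]
  nlinarith [mul_self_nonneg ‖v‖]

/-- With `a` as the inner product of `V`, the form `b` is continuous because the dimension is
finite. -/
lemma exists_bound_of_isInner [FiniteDimensional ℝ V] {a : LinearMap.BilinForm ℝ V}
    (ha : IsInner a) (b : LinearMap.BilinForm ℝ V) :
    ∃ C : ℝ, 0 < C ∧ ∀ v, b v v ≤ C * a v v :=
  let i : NormedAddCommGroup V := @InnerProductSpace.Core.toNormedAddCommGroup ℝ V _ _ _ ha.core
  @exists_bilin_le_norm_sq V i (InnerProductSpace.ofCore ha.core.toCore) _ b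

/-- On a finite-dimensional space a semidefinite form is bounded by every semidefinite form whose
kernel is contained in its kernel. -/
lemma IsSemiInner.exists_bound [FiniteDimensional ℝ V] {a b : LinearMap.BilinForm ℝ V}
    (ha : IsSemiInner a) (hb : IsSemiInner b) (hab : ∀ v, a v v = 0 → b v v = 0) :
    ∃ C : ℝ, 0 < C ∧ ∀ v, b v v ≤ C * a v v := by
  -- On a complement `S` of the kernel `a` is definite: by Cauchy–Schwarz a vector with `a v v = 0`
  -- lies in the kernel. The kernel component of a vector drops out of both forms.
  obtain ⟨S, hS⟩ := Submodule.exists_isCompl (LinearMap.ker a)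
  have haS : IsInner (a.restrict S) := by
    refine ⟨fun u v => ha.symm u v, fun v hv => ?_⟩
    refine lt_of_le_of_ne (ha.nonneg v) fun h0 => hv ?_
    have hk : (v : V) ∈ LinearMap.ker a := by
      rw [LinearMap.mem_ker]
      ext w
      exact ha.apply_eq_zero h0.symm w
    have := Submodule.disjoint_def.1 hS.disjoint v hk v.2
    exact Subtype.ext this
  obtain ⟨C, hC, h⟩ := exists_bound_of_isInner haS (b.restrict S)
  refine ⟨C, hC, fun v => ?_⟩
  have hv : v ∈ LinearMap.ker a ⊔ S := by
    rw [hS.sup_eq_top]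
    exact Submodule.mem_top
  obtain ⟨k, hk, s, hs, rfl⟩ := Submodule.mem_sup.1 hv
  have hak : ∀ w, a k w = 0 := fun w => by
    rw [LinearMap.mem_ker.1 hk]
    simp
  have hbk : ∀ w, b k w = 0 := hb.apply_eq_zero (hab k (hak k))
  have h1 := h ⟨s, hs⟩
  simp only [LinearMap.BilinForm.restrict_apply, LinearMap.domRestrict_apply] at h1
  simpa [hak, hbk, ha.symm s k, hb.symm s k] using h1

/-- The supremum of the Rayleigh quotient of a symmetric operator is itself an eigenvalue.
Finiteness of the spectrum makes the `sSup` in `lambdaMax` a genuine upper bound. -/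
lemma le_lambdaMax [FiniteDimensional ℝ V] {M a : LinearMap.BilinForm ℝ V} (hM : IsInner M)
    (ha : IsSemiInner a) {A : V →ₗ[ℝ] V} (hA : ∀ u v, M (A u) v = a u v) (v : V) :
    a v v ≤ lambdaMax A * M v v := by
  by_cases hv : v = 0
  · simp [hv]
  have : Nontrivial V := ⟨v, 0, hv⟩
  let _ : NormedAddCommGroup V := @InnerProductSpace.Core.toNormedAddCommGroup ℝ V _ _ _ hM.core
  let _ : InnerProductSpace ℝ V := InnerProductSpace.ofCore hM.core.toCore
  have hin : ∀ u v : V, inner ℝ u v = M u v := fun _ _ => rfl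
  have hs : A.IsSymmetric := fun u w => by
    rw [hin, hin, hA, hM.symm, hA, ha.symm]
  have hpos := hM.pos v hv
  have hn : ∀ x : V, M x x = ‖x‖ ^ 2 := fun x => by
    rw [← hin, real_inner_self_eq_norm_sq]
  have hbdd : BddAbove (Set.range fun x : {x : V // x ≠ 0} =>
      RCLike.re (inner ℝ (A x) (x : V)) / ‖(x : V)‖ ^ 2) := by
    obtain ⟨C, -, hC⟩ := exists_bound_of_isInner hM a
    refine ⟨C, ?_⟩
    rintro _ ⟨x, rfl⟩
    have hx : 0 < ‖(x : V)‖ ^ 2 := by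
      rw [← hn]
      exact hM.pos x x.2
    simp only [RCLike.re_to_real]
    rw [div_le_iff₀ hx, hin, hA, ← hn]
    exact hC x
  have h1 := le_ciSup hbdd ⟨v, hv⟩
  have h2 := hs.hasEigenvalue_iSup_of_finiteDimensional
  have hfin : {μ : ℝ | Module.End.HasEigenvalue A μ}.Finite := by
    have := Module.End.finite_hasEigenvalue A
    exact this
  have h3 := le_csSup hfin.bddAbove h2
  have h4 := h1.trans h3
  simp only [RCLike.re_to_real] at h4
  rw [hin, hA, ← hn, div_le_iff₀ hpos] at h4
  exact h4

/-- The condition `0 ≤ C` serves the case without eigenvalues, where `sSup ∅ = 0`. -/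
lemma lambdaMax_le [FiniteDimensional ℝ V] {M a : LinearMap.BilinForm ℝ V} (hM : IsInner M)
    {A : V →ₗ[ℝ] V} (hA : ∀ u v, M (A u) v = a u v) {C : ℝ} (hC : 0 ≤ C)
    (h : ∀ v, a v v ≤ C * M v v) : lambdaMax A ≤ C := by
  refine Real.sSup_le ?_ hC
  intro μ hμ
  obtain ⟨v, hv⟩ := Module.End.HasEigenvalue.exists_hasEigenvector hμ
  have h1 := hA v v
  rw [hv.apply_eq_smul] at h1
  simp only [map_smul, LinearMap.smul_apply, smul_eq_mul] at h1
  have h2 := h v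
  rw [← h1] at h2
  exact le_of_mul_le_mul_right h2 (hM.pos v hv.2)

/-- At an eigenvector `v` of `B ∘ₗ A` with eigenvalue `μ` one has `M (B (A v)) (A v) = μ * a v v`,
so the two-sided bound confines the spectrum to `[L, U]`. -/
lemma condNumber_le {M a : LinearMap.BilinForm ℝ V} (hM : ∀ u v, M u v = M v u) (ha : IsInner a)
    {A B : V →ₗ[ℝ] V} (hA : ∀ u v, M (A u) v = a u v) {L U : ℝ} (hL : 0 < L) (hU : 0 ≤ U)
    (hlow : ∀ v, L * a v v ≤ M (B (A v)) (A v)) (hup : ∀ v, M (B (A v)) (A v) ≤ U * a v v) :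
    condNumber (B ∘ₗ A) ≤ U / L := by
  have key : ∀ μ, Module.End.HasEigenvalue (B ∘ₗ A) μ → L ≤ μ ∧ μ ≤ U := by
    intro μ hμ
    obtain ⟨v, hv⟩ := Module.End.HasEigenvalue.exists_hasEigenvector hμ
    have h1 : B (A v) = μ • v := hv.apply_eq_smul
    have h2 : M (B (A v)) (A v) = μ * a v v := by
      rw [h1, map_smul, LinearMap.smul_apply, hM v, hA, smul_eq_mul]
    have hp := ha.pos v hv.2
    exact ⟨le_of_mul_le_mul_right (h2 ▸ hlow v) hp, le_of_mul_le_mul_right (h2 ▸ hup v) hp⟩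
  unfold condNumber lambdaMax lambdaMin
  -- Without eigenvalues the quotient is `0 / 0 = 0`.
  rcases Set.eq_empty_or_nonempty {μ : ℝ | Module.End.HasEigenvalue (B ∘ₗ A) μ} with h0 | h0
  · rw [h0]
    simp only [Real.sSup_empty, Real.sInf_empty, div_zero]
    positivity
  · have h1 : sSup {μ : ℝ | Module.End.HasEigenvalue (B ∘ₗ A) μ} ≤ U :=
      csSup_le h0 fun μ hμ => (key μ hμ).2
    have h2 : L ≤ sInf {μ : ℝ | Module.End.HasEigenvalue (B ∘ₗ A) μ} :=
      le_csInf h0 fun μ hμ => (key μ hμ).1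
    exact div_le_div₀ hU h1 hL h2

end Abstract

end

/-! ### The abstract auxiliary space method, additive and multiplicative -/

section

/-- The data of the auxiliary space method: the fine space `V` with inner product `M`, energy `a`,
operator `A` and smoother `R`; the auxiliary space `W` with inner product `N`, energy `b`, operator
`Ac` and solver `S`; the prolongation `Pi` and its transpose `Pt`; stability of `Pi` and the stable
decomposition. -/
structure AuxSpace {V W : Type*} [AddCommGroup V] [Module ℝ V] [AddCommGroup W] [Module ℝ W]
    (M a : LinearMap.BilinForm ℝ V) (N b : LinearMap.BilinForm ℝ W) (A R : V →ₗ[ℝ] V)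
    (Ac S : W →ₗ[ℝ] W) (Pi : W →ₗ[ℝ] V) (Pt : V →ₗ[ℝ] W) (ρ c₁ c₂ c₃ c₄ K₁ K₂ : ℝ) : Prop where
  innerM : IsInner M
  innerA : IsInner a
  innerN : IsInner N
  innerB : IsInner b
  hA : ∀ u v, M (A u) v = a u v
  hAc : ∀ u v, N (Ac u) v = b u v
  hPt : ∀ v w, N (Pt v) w = M v (Pi w)
  symmR : ∀ u v, M (R u) v = M u (R v)
  symmS : ∀ u v, N (S u) v = N u (S v)
  rho : ∀ v, a v v ≤ ρ * M v v
  lowR : ∀ v, c₁ * ρ⁻¹ * M v v ≤ M (R v) v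
  upR : ∀ v, M (R v) v ≤ c₂ * ρ⁻¹ * M v v
  lowS : ∀ w, c₃ * b w w ≤ N (S (Ac w)) (Ac w)
  upS : ∀ w, N (S (Ac w)) (Ac w) ≤ c₄ * b w w
  stable : ∀ w, a (Pi w) (Pi w) ≤ K₁ * b w w
  decomp : ∀ v, ∃ w, ρ * M (v - Pi w) (v - Pi w) ≤ K₂ * a v v ∧ b w w ≤ K₂ * a v v
  c₁_pos : 0 < c₁
  c₃_pos : 0 < c₃
  K₁_pos : 0 < K₁
  K₂_pos : 0 < K₂

namespace AuxSpace

variable {V W : Type*} [AddCommGroup V] [Module ℝ V] [AddCommGroup W] [Module ℝ W]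
  {M a : LinearMap.BilinForm ℝ V} {N b : LinearMap.BilinForm ℝ W} {A R : V →ₗ[ℝ] V}
  {Ac S : W →ₗ[ℝ] W} {Pi : W →ₗ[ℝ] V} {Pt : V →ₗ[ℝ] W} {ρ c₁ c₂ c₃ c₄ K₁ K₂ : ℝ}

lemma rho_pos (h : AuxSpace M a N b A R Ac S Pi Pt ρ c₁ c₂ c₃ c₄ K₁ K₂) {v : V} (hv : v ≠ 0) :
    0 < ρ := by
  have h1 := h.innerA.pos v hv
  have h2 := h.innerM.pos v hv
  have h3 := h.rho v
  by_contra hn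
  nlinarith

/-- This is `A² ≤ ρ A`: `M (A v) (A v) = a v (A v)`, then Cauchy–Schwarz for `a`, the bound `rho` at
`A v`, and one factor cancels. -/
lemma norm_le (h : AuxSpace M a N b A R Ac S Pi Pt ρ c₁ c₂ c₃ c₄ K₁ K₂) (v : V) :
    M (A v) (A v) ≤ ρ * a v v := by
  by_cases hv : A v = 0
  · by_cases hv0 : v = 0
    · simp [hv0]
    · rw [hv]
      simpa using mul_nonneg (h.rho_pos hv0).le (h.innerA.semi.nonneg v)
  have h1 : M (A v) (A v) = a v (A v) := h.hA v _
  have h2 := h.innerA.semi.cauchy v (A v)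
  have h3 := h.rho (A v)
  have h4 := h.innerM.pos _ hv
  have h5 := h.innerA.semi.nonneg v
  rw [← h1] at h2
  have h6 : M (A v) (A v) * M (A v) (A v) ≤ (ρ * a v v) * M (A v) (A v) := by nlinarith
  exact le_of_mul_le_mul_right h6 h4

/-- The solver `S` is controlled only at vectors of the form `Ac u`; these turn out to be all
vectors of `W`. -/
lemma exists_coarse [FiniteDimensional ℝ W]
    (h : AuxSpace M a N b A R Ac S Pi Pt ρ c₁ c₂ c₃ c₄ K₁ K₂) (x : W) :
    ∃ u, Ac u = x := by
  have hinj : Function.Injective Ac := by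
    rw [injective_iff_map_eq_zero]
    intro u hu
    by_contra hne
    have := h.innerB.pos u hne
    rw [← h.hAc, hu] at this
    simp at this
  exact LinearMap.injective_iff_surjective.1 hinj x

lemma exists_fine [FiniteDimensional ℝ V]
    (h : AuxSpace M a N b A R Ac S Pi Pt ρ c₁ c₂ c₃ c₄ K₁ K₂) : Function.Bijective A := by
  have hinj : Function.Injective A := by
    rw [injective_iff_map_eq_zero]
    intro u hu
    by_contra hne
    have := h.innerA.pos u hne
    rw [← h.hA, hu] at this
    simp at this
  exact ⟨hinj, LinearMap.injective_iff_surjective.1 hinj⟩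

lemma coarse_nonneg [FiniteDimensional ℝ W]
    (h : AuxSpace M a N b A R Ac S Pi Pt ρ c₁ c₂ c₃ c₄ K₁ K₂) (x : W) : 0 ≤ N (S x) x := by
  obtain ⟨u, rfl⟩ := h.exists_coarse x
  exact (mul_nonneg h.c₃_pos.le (h.innerB.semi.nonneg u)).trans (h.lowS u)

lemma smoother_pos (h : AuxSpace M a N b A R Ac S Pi Pt ρ c₁ c₂ c₃ c₄ K₁ K₂) {v : V}
    (hv : v ≠ 0) : 0 < M (R v) v := by
  have := h.rho_pos hv
  have h1 := h.innerM.pos v hv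
  have := h.c₁_pos
  exact lt_of_lt_of_le (by positivity) (h.lowR v)

lemma smoother_nonneg (h : AuxSpace M a N b A R Ac S Pi Pt ρ c₁ c₂ c₃ c₄ K₁ K₂) (v : V) :
    0 ≤ M (R v) v := by
  by_cases hv : v = 0
  · simp [hv]
  · exact (h.smoother_pos hv).le

lemma smoother_le (h : AuxSpace M a N b A R Ac S Pi Pt ρ c₁ c₂ c₃ c₄ K₁ K₂) (v : V) :
    M (R (A v)) (A v) ≤ |c₂| * a v v := by
  by_cases hv : v = 0
  · simp [hv]
  have hρ := h.rho_pos hv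
  calc M (R (A v)) (A v) ≤ c₂ * ρ⁻¹ * M (A v) (A v) := h.upR _
    _ ≤ |c₂| * ρ⁻¹ * M (A v) (A v) := by
        gcongr
        · exact h.innerM.semi.nonneg _
        · exact le_abs_self _
    _ ≤ |c₂| * ρ⁻¹ * (ρ * a v v) := by
        gcongr
        exact h.norm_le v
    _ = |c₂| * a v v := by field_simp

/-- The vector `u` with `Ac u = Pt (A v)` is the energy adjoint of `Pi` applied to `v`: `b u w = a v
(Pi w)`. Since `stable` bounds the squared norm of `Pi` by `K₁`, it bounds that of the adjoint as
well. -/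
lemma coarse_le [FiniteDimensional ℝ W]
    (h : AuxSpace M a N b A R Ac S Pi Pt ρ c₁ c₂ c₃ c₄ K₁ K₂) (v : V) :
    N (S (Pt (A v))) (Pt (A v)) ≤ |c₄| * K₁ * a v v := by
  obtain ⟨u, hu⟩ := h.exists_coarse (Pt (A v))
  have h1 : b u u = a v (Pi u) := by rw [← h.hAc, hu, h.hPt, h.hA]
  have h2 := h.innerA.semi.cauchy v (Pi u)
  have h3 := h.stable u
  have h4 := h.innerB.semi.nonneg u
  have h5 := h.innerA.semi.nonneg v
  have h6 : b u u ≤ K₁ * a v v := by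
    rcases h4.eq_or_lt with h0 | h0
    · rw [← h0]
      exact mul_nonneg h.K₁_pos.le h5
    · rw [← h1] at h2
      have : b u u * b u u ≤ (K₁ * a v v) * b u u := by nlinarith
      exact le_of_mul_le_mul_right this h0
  rw [← hu]
  calc N (S (Ac u)) (Ac u) ≤ c₄ * b u u := h.upS u
    _ ≤ |c₄| * b u u := by
        gcongr
        exact le_abs_self _
    _ ≤ |c₄| * (K₁ * a v v) := by gcongr
    _ = _ := by ring

/-- The lower spectral bound. Split `a v v = a v (v - Pi w) + a v (Pi w)` with the stable
decomposition. The first term is a product of `A v` and `v - Pi w` in `M`, where `lowR` supplies the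
factor `ρ` that `decomp` absorbs; the second is a product of `u = Ac⁻¹ (Pt (A v))` and `w` in `b`,
where `lowS` applies. -/
lemma energy_le [FiniteDimensional ℝ W]
    (h : AuxSpace M a N b A R Ac S Pi Pt ρ c₁ c₂ c₃ c₄ K₁ K₂) (v : V) :
    a v v ≤ 2 * K₂ * (1 / c₁ + 1 / c₃) *
      (M (R (A v)) (A v) + N (S (Pt (A v))) (Pt (A v))) := by
  have hX := h.smoother_nonneg (A v)
  have hY := h.coarse_nonneg (Pt (A v))
  have hc₁ := h.c₁_pos
  have hc₃ := h.c₃_pos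
  have hK := h.K₂_pos
  by_cases hv : v = 0
  · rw [hv] at hX hY ⊢
    simp
  have hρ := h.rho_pos hv
  have ha := h.innerA.pos v hv
  obtain ⟨w, hw1, hw2⟩ := h.decomp v
  obtain ⟨u, hu⟩ := h.exists_coarse (Pt (A v))
  set X := M (R (A v)) (A v)
  set Y := N (S (Pt (A v))) (Pt (A v))
  have e1 : a v v = a v (v - Pi w) + a v (Pi w) := by simp
  have e2 : a v (v - Pi w) ^ 2 ≤ K₂ / c₁ * X * a v v := by
    rw [← h.hA]
    have h1 := h.innerM.semi.cauchy (A v) (v - Pi w)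
    have h2 : M (A v) (A v) ≤ ρ / c₁ * X := by
      have := h.lowR (A v)
      calc M (A v) (A v) = ρ / c₁ * (c₁ * ρ⁻¹ * M (A v) (A v)) := by field_simp
        _ ≤ _ := by gcongr
    calc M (A v) (v - Pi w) ^ 2 ≤ M (A v) (A v) * M (v - Pi w) (v - Pi w) := h1
      _ ≤ (ρ / c₁ * X) * M (v - Pi w) (v - Pi w) := by
          gcongr
          exact h.innerM.semi.nonneg _
      _ = X / c₁ * (ρ * M (v - Pi w) (v - Pi w)) := by ring
      _ ≤ X / c₁ * (K₂ * a v v) := by gcongr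
      _ = _ := by ring
  have e3 : a v (Pi w) ^ 2 ≤ K₂ / c₃ * Y * a v v := by
    rw [← h.hA, ← h.hPt, ← hu, h.hAc]
    have h1 := h.innerB.semi.cauchy u w
    have h2 : b u u ≤ Y / c₃ := by
      rw [le_div_iff₀ hc₃, mul_comm]
      have := h.lowS u
      rwa [hu] at this
    calc b u w ^ 2 ≤ b u u * b w w := h1
      _ ≤ (Y / c₃) * (K₂ * a v v) := by
          gcongr
          exact h.innerB.semi.nonneg _
      _ = _ := by ring
  have e4 : a v v * a v v ≤ (2 * (K₂ / c₁ * X + K₂ / c₃ * Y)) * a v v := by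
    nlinarith [sq_nonneg (a v (v - Pi w) - a v (Pi w))]
  have e5 := le_of_mul_le_mul_right e4 ha
  refine e5.trans ?_
  have : 2 * K₂ * (1 / c₁ + 1 / c₃) * (X + Y) =
      2 * (K₂ / c₁ * X + K₂ / c₃ * Y) + 2 * (K₂ / c₁ * Y + K₂ / c₃ * X) := by
    field_simp
    ring
  rw [this]
  have : 0 ≤ 2 * (K₂ / c₁ * Y + K₂ / c₃ * X) := by positivity
  linarith

lemma additive_isSPD [FiniteDimensional ℝ W]
    (h : AuxSpace M a N b A R Ac S Pi Pt ρ c₁ c₂ c₃ c₄ K₁ K₂) :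
    IsSPD (fun u v => M u v) (R + Pi ∘ₗ S ∘ₗ Pt) := by
  have key : ∀ u v, M (Pi (S (Pt u))) v = N (S (Pt u)) (Pt v) := fun u v => by
    rw [h.innerM.symm, ← h.hPt, h.innerN.symm]
  refine ⟨fun u v => ?_, fun v hv => ?_⟩
  · simp only [LinearMap.add_apply, LinearMap.comp_apply, map_add]
    rw [h.symmR, key, h.innerM.symm u (Pi _), key, h.symmS, h.innerN.symm]
  · simp only [LinearMap.add_apply, LinearMap.comp_apply, map_add]
    rw [key]
    exact add_pos_of_pos_of_nonneg (h.smoother_pos hv) (h.coarse_nonneg _)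

lemma additive_condNumber [FiniteDimensional ℝ W]
    (h : AuxSpace M a N b A R Ac S Pi Pt ρ c₁ c₂ c₃ c₄ K₁ K₂) :
    condNumber ((R + Pi ∘ₗ S ∘ₗ Pt) ∘ₗ A) ≤
      (|c₂| + |c₄| * K₁) / (2 * K₂ * (1 / c₁ + 1 / c₃))⁻¹ := by
  have hc₁ := h.c₁_pos
  have hc₃ := h.c₃_pos
  have hK := h.K₂_pos
  have hK₁ := h.K₁_pos
  have e : ∀ v, M ((R + Pi ∘ₗ S ∘ₗ Pt) (A v)) (A v) =
      M (R (A v)) (A v) + N (S (Pt (A v))) (Pt (A v)) := fun v => by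
    simp only [LinearMap.add_apply, LinearMap.comp_apply, map_add]
    rw [h.innerM.symm (Pi _), ← h.hPt, h.innerN.symm]
  refine condNumber_le h.innerM.symm h.innerA h.hA (by positivity) (by positivity)
    (fun v => ?_) (fun v => ?_)
  · rw [e, inv_mul_le_iff₀ (by positivity)]
    exact h.energy_le v
  · rw [e, add_mul]
    exact add_le_add (h.smoother_le v) (h.coarse_le v)

lemma energy_symm_smoother (h : AuxSpace M a N b A R Ac S Pi Pt ρ c₁ c₂ c₃ c₄ K₁ K₂) (u v : V) :
    a (R (A u)) v = M (R (A u)) (A v) := by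
  rw [h.innerA.symm, ← h.hA, h.innerM.symm]

lemma energy_symm_coarse (h : AuxSpace M a N b A R Ac S Pi Pt ρ c₁ c₂ c₃ c₄ K₁ K₂) (u v : V) :
    a (Pi (S (Pt (A u)))) v = N (S (Pt (A u))) (Pt (A v)) := by
  rw [h.innerA.symm, ← h.hA, ← h.hPt, h.innerN.symm]

/-- With `T = R ∘ A` this is `T² ≤ ω T` in the energy. It is Cauchy–Schwarz for the form `M (R (A
·)) (A ·)` at `v` and `x = R (A v)`, whose mixed value is `a x x`. -/
lemma energy_smoother_le (h : AuxSpace M a N b A R Ac S Pi Pt ρ c₁ c₂ c₃ c₄ K₁ K₂) {ω : ℝ}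
    (hω : ∀ v, M (R (A v)) (A v) ≤ ω * M (A v) v) (v : V) :
    a (R (A v)) (R (A v)) ≤ ω * M (R (A v)) (A v) := by
  set x := R (A v)
  have hs : IsSemiInner (M.compl₁₂ (R ∘ₗ A) A) := by
    refine ⟨fun u w => ?_, fun u => ?_⟩
    · simp only [LinearMap.compl₁₂_apply, LinearMap.comp_apply]
      rw [h.symmR, h.innerM.symm]
    · simp only [LinearMap.compl₁₂_apply, LinearMap.comp_apply]
      exact h.smoother_nonneg _
  have h1 := hs.cauchy v x
  simp only [LinearMap.compl₁₂_apply, LinearMap.comp_apply] at h1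
  rw [← h.energy_symm_smoother v x] at h1
  have h2 := hω x
  rw [h.hA] at h2
  have h3 := h.innerA.semi.nonneg x
  have h4 := h.smoother_nonneg (A v)
  -- If `x` has no energy there is nothing to cancel, and the sign of `ω` is needed; it follows from
  -- `hω v` for `v ≠ 0`.
  rcases h3.eq_or_lt with h0 | h0
  · have h5 := hω v
    by_cases hv : v = 0
    · simp [x, hv]
    rw [h.hA] at h5
    have h6 := h.innerA.pos v hv
    have h7 : 0 ≤ ω := by
      by_contra hn
      nlinarith
    rw [← h0]
    positivity
  · have : a x x * a x x ≤ (ω * M (R (A v)) (A v)) * a x x := by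
      change a x x ^ 2 ≤ M x (A v) * _ at h1
      change _ ≤ (ω * M x (A v)) * _
      change 0 ≤ M x (A v) at h4
      nlinarith
    exact le_of_mul_le_mul_right this h0

/-- The multiplicative relation. -/
def Mult (A R : V →ₗ[ℝ] V) (S : W →ₗ[ℝ] W) (Pi : W →ₗ[ℝ] V) (Pt : V →ₗ[ℝ] W)
    (B : V →ₗ[ℝ] V) : Prop :=
  LinearMap.id - B ∘ₗ A = (LinearMap.id - R ∘ₗ A) ∘ₗ
    (LinearMap.id - Pi ∘ₗ S ∘ₗ Pt ∘ₗ A) ∘ₗ (LinearMap.id - R ∘ₗ A)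

/-- As `A` is invertible, `I - B A = E` has the single solution `B = (I - E) A⁻¹`. -/
lemma mult_existsUnique [FiniteDimensional ℝ V]
    (h : AuxSpace M a N b A R Ac S Pi Pt ρ c₁ c₂ c₃ c₄ K₁ K₂) : ∃! B, Mult A R S Pi Pt B := by
  let e := LinearEquiv.ofBijective A h.exists_fine
  have he : e.symm.toLinearMap ∘ₗ A = LinearMap.id := by
    ext v
    exact e.symm_apply_apply v
  have he' : A ∘ₗ e.symm.toLinearMap = LinearMap.id := by
    ext v
    exact e.apply_symm_apply v
  unfold Mult
  generalize (LinearMap.id - R ∘ₗ A) ∘ₗ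
    (LinearMap.id - Pi ∘ₗ S ∘ₗ Pt ∘ₗ A) ∘ₗ (LinearMap.id - R ∘ₗ A) = E
  refine ⟨(LinearMap.id - E) ∘ₗ e.symm.toLinearMap, ?_, fun B hB => ?_⟩
  · change LinearMap.id - ((LinearMap.id - E) ∘ₗ e.symm.toLinearMap) ∘ₗ A = E
    rw [LinearMap.comp_assoc, he]
    simp
  · rw [← hB]
    simp only [sub_sub_cancel]
    rw [LinearMap.comp_assoc, he', LinearMap.comp_id]

/-- With `T = R ∘ A`, all three factors of `I - B A` are self-adjoint in the energy. Expanding, `B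
A` is `2T - T²` plus the coarse operator conjugated by `I - T`. -/
lemma mult_form (h : AuxSpace M a N b A R Ac S Pi Pt ρ c₁ c₂ c₃ c₄ K₁ K₂) {B : V →ₗ[ℝ] V}
    (hB : Mult A R S Pi Pt B) (u v : V) :
    M (B (A u)) (A v) = 2 * M (R (A u)) (A v) - a (R (A u)) (R (A v)) +
      N (S (Pt (A (u - R (A u))))) (Pt (A (v - R (A v)))) := by
  have h1 := congrArg (fun T => T u) hB
  simp only [LinearMap.sub_apply, LinearMap.id_apply, LinearMap.comp_apply] at h1
  have h2 : B (A u) = R (A u) + R (A (u - R (A u))) + Pi (S (Pt (A (u - R (A u))))) -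
      R (A (Pi (S (Pt (A (u - R (A u))))))) := by
    have : B (A u) = u - (u - B (A u)) := by abel
    rw [this, h1]
    simp only [map_sub]
    abel
  have e : ∀ x y, a (R (A x)) y = a x (R (A y)) := fun x y => by
    rw [h.energy_symm_smoother, h.symmR, h.innerA.symm x, h.energy_symm_smoother, h.innerM.symm]
  have h3 : M (B (A u)) (A v) = a (B (A u)) v := by
    rw [h.innerA.symm, ← h.hA, h.innerM.symm]
  rw [h3, h2, ← h.energy_symm_coarse, ← h.energy_symm_smoother]
  simp only [map_sub, map_add, LinearMap.sub_apply, LinearMap.add_apply]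
  simp only [e]
  ring

/-- The form of `mult_form` is at least `(2 - ω) * M (R (A v)) (A v)`, since the coarse term is
nonnegative and `T² ≤ ω T`. -/
lemma mult_isSPD [FiniteDimensional ℝ V] [FiniteDimensional ℝ W]
    (h : AuxSpace M a N b A R Ac S Pi Pt ρ c₁ c₂ c₃ c₄ K₁ K₂) {ω : ℝ} (hω2 : ω < 2)
    (hω : ∀ v, M (R (A v)) (A v) ≤ ω * M (A v) v) {B : V →ₗ[ℝ] V} (hB : Mult A R S Pi Pt B) :
    IsSPD (fun u v => M u v) B := by
  refine ⟨fun u v => ?_, fun v hv => ?_⟩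
  · obtain ⟨u, rfl⟩ := h.exists_fine.2 u
    obtain ⟨v, rfl⟩ := h.exists_fine.2 v
    simp only
    rw [h.innerM.symm (A u), h.mult_form hB, h.mult_form hB, h.symmR, h.innerM.symm (A u),
      h.innerA.symm, h.symmS, h.innerN.symm]
  · obtain ⟨v, rfl⟩ := h.exists_fine.2 v
    simp only
    rw [h.mult_form hB]
    have h1 := h.energy_smoother_le hω v
    have h2 := h.smoother_pos hv
    have h3 := h.coarse_nonneg (Pt (A (v - R (A v))))
    nlinarith

/-- Let `X` be the smoother term, `Q` the energy of `T v` and `Y` the coarse term at `v - T v`. From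
below, the additive estimate `energy_le` is reused: the coarse term at `v` is at most `2Y` plus
twice the one at `T v`, the latter is bounded by `Q ≤ |ω| X`, and `X ≤ (2X - Q) / (2 - ω)`. From
above, `2X - Q` is exactly the energy lost in passing from `v` to `v - T v`, so it is at most `a v
v`, and `Y` is bounded by the remaining energy. -/
lemma mult_condNumber [FiniteDimensional ℝ W]
    (h : AuxSpace M a N b A R Ac S Pi Pt ρ c₁ c₂ c₃ c₄ K₁ K₂) {ω : ℝ} (hω2 : ω < 2)
    (hω : ∀ v, M (R (A v)) (A v) ≤ ω * M (A v) v) {B : V →ₗ[ℝ] V} (hB : Mult A R S Pi Pt B) :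
    condNumber (B ∘ₗ A) ≤ (1 + |c₄| * K₁) /
      (2 * K₂ * (1 / c₁ + 1 / c₃) * ((1 + 2 * (|c₄| * K₁) * |ω|) / (2 - ω) + 2))⁻¹ := by
  have hc₁ := h.c₁_pos
  have hc₃ := h.c₃_pos
  have hK := h.K₂_pos
  have hK₁ := h.K₁_pos
  have hω' : 0 < 2 - ω := by linarith
  refine condNumber_le h.innerM.symm h.innerA h.hA (by positivity) (by positivity)
    (fun v => ?_) (fun v => ?_)
  · rw [inv_mul_le_iff₀ (by positivity), h.mult_form hB, mul_assoc]
    refine (h.energy_le v).trans ?_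
    gcongr
    have h1 := h.energy_smoother_le hω v
    have hX := h.smoother_nonneg (A v)
    have hY := h.coarse_nonneg (Pt (A (v - R (A v))))
    have h3 := h.coarse_le (R (A v))
    have hs : IsSemiInner (N.compl₁₂ (S ∘ₗ Pt ∘ₗ A) (Pt ∘ₗ A)) := by
      refine ⟨fun u w => ?_, fun u => ?_⟩
      · simp only [LinearMap.compl₁₂_apply, LinearMap.comp_apply]
        rw [h.symmS, h.innerN.symm]
      · simp only [LinearMap.compl₁₂_apply, LinearMap.comp_apply]
        exact h.coarse_nonneg _
    have h4 := hs.add_le (v - R (A v)) (R (A v))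
    simp only [LinearMap.compl₁₂_apply, LinearMap.comp_apply, sub_add_cancel] at h4
    set X := M (R (A v)) (A v)
    set Y := N (S (Pt (A (v - R (A v))))) (Pt (A (v - R (A v))))
    set Q := a (R (A v)) (R (A v))
    set κ := |c₄| * K₁
    have hκ : 0 ≤ κ := by positivity
    have h5 : κ * Q ≤ κ * |ω| * X := by
      rw [mul_assoc κ |ω| X]
      exact mul_le_mul_of_nonneg_left
        (h1.trans (mul_le_mul_of_nonneg_right (le_abs_self ω) hX)) hκ
    have h6 : X ≤ (2 * X - Q) / (2 - ω) := by
      rw [le_div_iff₀ hω']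
      nlinarith
    have h7 : 0 ≤ 2 * X - Q := by nlinarith
    calc X + N (S (Pt (A v))) (Pt (A v)) ≤ X + (2 * Y + 2 * (κ * |ω| * X)) := by linarith
      _ = (1 + 2 * κ * |ω|) * X + 2 * Y := by ring
      _ ≤ (1 + 2 * κ * |ω|) * ((2 * X - Q) / (2 - ω)) + 2 * Y := by gcongr
      _ = (1 + 2 * κ * |ω|) / (2 - ω) * (2 * X - Q) + 2 * Y := by ring
      _ ≤ ((1 + 2 * κ * |ω|) / (2 - ω) + 2) * (2 * X - Q) +
          ((1 + 2 * κ * |ω|) / (2 - ω) + 2) * Y := by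
            have : 0 ≤ (1 + 2 * κ * |ω|) / (2 - ω) := by positivity
            nlinarith
      _ = _ := by ring
  · rw [h.mult_form hB]
    have h1 := h.energy_smoother_le hω v
    have hX := h.smoother_nonneg (A v)
    have h2 := h.coarse_le (v - R (A v))
    have h3 : a (v - R (A v)) (v - R (A v)) =
        a v v - 2 * M (R (A v)) (A v) + a (R (A v)) (R (A v)) := by
      simp only [map_sub, LinearMap.sub_apply]
      have e1 := h.innerA.symm v (R (A v))
      have e2 := h.energy_symm_smoother v v
      linarith
    have h4 := h.innerA.semi.nonneg (R (A v))
    have h5 : a (v - R (A v)) (v - R (A v)) ≤ a v v := by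
      rw [h3]
      nlinarith
    have h6 := h.innerA.semi.nonneg (v - R (A v))
    have h7 : |c₄| * K₁ * a (v - R (A v)) (v - R (A v)) ≤ |c₄| * K₁ * a v v := by gcongr
    nlinarith

end AuxSpace

end

section

/-! ### Simplices and their charts -/

section Chart

variable {d n : ℕ}

/-- The reference simplex. -/
def refSimplex (n : ℕ) : Set (Fin n → ℝ) := {s | (∀ i, 0 ≤ s i) ∧ ∑ i, s i ≤ 1}

/-- Barycentric coordinates on the reference simplex. -/
def bary (s : Fin n → ℝ) : Fin (n + 1) → ℝ := Fin.cons (1 - ∑ i, s i) s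

/-- The affine parametrization of the simplex with vertices `y`. -/
def chart (y : Fin (n + 1) → E d) (s : Fin n → ℝ) : E d := ∑ k, bary s k • y k

/-- The linear part of `chart`. -/
def chartLin (y : Fin (n + 1) → E d) : E n →ₗ[ℝ] E d where
  toFun s := ∑ i, s i • (y i.succ - y 0)
  map_add' s t := by simp [add_smul, Finset.sum_add_distrib]
  map_smul' c s := by simp [Finset.smul_sum, mul_smul]

/-- The Jacobian of `chart`. -/
def jac (y : Fin (n + 1) → E d) : ℝ := (chartLin y).normDet

lemma sum_bary (s : Fin n → ℝ) : ∑ k, bary s k = 1 := by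
  simp [bary, Fin.sum_univ_succ]

@[simp] lemma bary_zero (s : Fin n → ℝ) : bary s 0 = 1 - ∑ i, s i := rfl

@[simp] lemma bary_succ (s : Fin n → ℝ) (i : Fin n) : bary s i.succ = s i := rfl

lemma bary_nonneg {s : Fin n → ℝ} (hs : s ∈ refSimplex n) (k : Fin (n + 1)) : 0 ≤ bary s k := by
  refine Fin.cases ?_ (fun i => ?_) k
  · simpa using hs.2
  · exact hs.1 i

lemma chart_eq (y : Fin (n + 1) → E d) (s : Fin n → ℝ) :
    chart y s = y 0 + chartLin y (WithLp.toLp 2 s) := by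
  simp only [chart, Fin.sum_univ_succ, bary_zero, bary_succ, chartLin, LinearMap.coe_mk,
    AddHom.coe_mk, smul_sub, Finset.sum_sub_distrib, sub_smul, Finset.sum_smul, one_smul]
  abel

lemma convexHull_range_eq (y : Fin (n + 1) → E d) :
    convexHull ℝ (Set.range y) = chart y '' refSimplex n := by
  let f : (Fin (n + 1) → ℝ) →ₗ[ℝ] E d :=
    { toFun := fun l => ∑ k, l k • y k
      map_add' := fun s t => by simp [add_smul, Finset.sum_add_distrib]
      map_smul' := fun c s => by simp [Finset.smul_sum, mul_smul] }
  have h1 : Set.range y = f '' Set.range (fun i j : Fin (n + 1) => if i = j then (1 : ℝ) else 0) := by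
    rw [← Set.range_comp]
    congr 1
    ext1 i
    simp [f]
  rw [h1, ← LinearMap.image_convexHull, convexHull_basis_eq_stdSimplex]
  ext x
  constructor
  · rintro ⟨l, ⟨hl0, hl1⟩, rfl⟩
    have hb : bary (fun i => l i.succ) = l := by
      rw [Fin.sum_univ_succ] at hl1
      ext k
      refine Fin.cases ?_ (fun i => rfl) k
      simp only [bary_zero]
      linarith
    refine ⟨fun i => l i.succ, ⟨fun i => hl0 _, ?_⟩, ?_⟩
    · rw [Fin.sum_univ_succ] at hl1
      linarith [hl0 0]
    · simp [chart, hb, f]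
  · rintro ⟨s, hs, rfl⟩
    exact ⟨bary s, ⟨bary_nonneg hs, sum_bary s⟩, rfl⟩

lemma chartLin_injective {y : Fin (n + 1) → E d} (hy : AffineIndependent ℝ y) :
    Function.Injective (chartLin y) := by
  have h := (affineIndependent_iff_linearIndependent_vsub ℝ y 0).1 hy
  have h2 : LinearIndependent ℝ fun i : Fin n => y i.succ - y 0 := by
    have := h.comp (fun i : Fin n => (⟨i.succ, Fin.succ_ne_zero i⟩ : {x // x ≠ (0 : Fin (n + 1))}))
      (fun i k hik => Fin.succ_injective _ (congrArg Subtype.val hik))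
    simpa [Function.comp_def] using this
  rw [injective_iff_map_eq_zero]
  intro s hs
  have := Fintype.linearIndependent_iff.1 h2 (fun i => s i) hs
  ext i
  exact this i

lemma continuous_chart (y : Fin (n + 1) → E d) : Continuous (chart y) := by
  have h : chart y = fun s => y 0 + chartLin y (WithLp.toLp 2 s) := funext fun s => chart_eq y s
  rw [h]
  have h1 : Continuous (chartLin y) := LinearMap.continuous_of_finiteDimensional _
  exact continuous_const.add (h1.comp (PiLp.continuous_toLp 2 _))

lemma chart_injective {y : Fin (n + 1) → E d} (hy : AffineIndependent ℝ y) :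
    Function.Injective (chart y) := by
  intro s t hst
  rw [chart_eq, chart_eq] at hst
  have := chartLin_injective hy (add_left_cancel hst)
  exact congrArg WithLp.ofLp this

lemma jac_pos {y : Fin (n + 1) → E d} (hy : AffineIndependent ℝ y) : 0 < jac y := by
  refine lt_of_le_of_ne (LinearMap.normDet_nonneg _) (Ne.symm ?_)
  exact ((chartLin y).normDet_ne_zero_tfae.out 0 4).2 (chartLin_injective hy)

/-- A translation is an isometry, a linear map scales `μHE[n]` by its `normDet`, and passing from
`Fin n → ℝ` to `E n` preserves volume. As `n` may be smaller than `d`, this covers elements and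
faces alike. -/
lemma measure_chart_image (y : Fin (n + 1) → E d) (S : Set (Fin n → ℝ)) :
    μHE[n] (chart y '' S) = ENNReal.ofReal (jac y) * volume S := by
  have h1 : chart y '' S = (fun x => y 0 + x) '' (chartLin y '' (WithLp.toLp 2 '' S)) := by
    rw [Set.image_image, Set.image_image]
    exact Set.image_congr fun s _ => chart_eq y s
  rw [h1, (isometry_add_left (y 0)).euclideanHausdorffMeasure_image]
  have h2 := (chartLin y).euclideanHausdorffMeasure_image_eq_normDet_mul_volume
    (WithLp.toLp 2 '' S)
  rw [finrank_euclideanSpace_fin] at h2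
  rw [h2]
  congr 1
  have h3 : (WithLp.toLp 2 '' S : Set (E n)) = (MeasurableEquiv.toLp 2 (Fin n → ℝ)).symm ⁻¹' S := by
    ext x
    simp only [Set.mem_image, Set.mem_preimage]
    exact ⟨fun ⟨s, hs, h⟩ => h ▸ hs, fun h => ⟨_, h, rfl⟩⟩
  rw [h3]
  exact (PiLp.volume_preserving_ofLp (Fin n)).measure_preimage_equiv (f := (MeasurableEquiv.toLp 2 (Fin n → ℝ)).symm) S

lemma isCompact_refSimplex (n : ℕ) : IsCompact (refSimplex n) := by
  refine (isCompact_Icc (a := (0 : Fin n → ℝ)) (b := 1)).of_isClosed_subset ?_ ?_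
  · have : refSimplex n = (⋂ i, {s | 0 ≤ s i}) ∩ {s | ∑ i, s i ≤ 1} := by
      ext s
      simp [refSimplex]
    rw [this]
    refine (isClosed_iInter fun i => isClosed_le continuous_const (continuous_apply i)).inter ?_
    exact isClosed_le (by fun_prop) continuous_const
  · intro s hs
    refine ⟨fun i => hs.1 i, fun i => ?_⟩
    exact (Finset.single_le_sum (fun k _ => hs.1 k) (Finset.mem_univ i)).trans hs.2

lemma measurableSet_refSimplex (n : ℕ) : MeasurableSet (refSimplex n) :=
  (isCompact_refSimplex n).measurableSet

lemma volume_refSimplex_lt_top (n : ℕ) : volume (refSimplex n) < ⊤ :=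
  (isCompact_refSimplex n).measure_lt_top

/-- The open reference simplex. -/
def refInterior (n : ℕ) : Set (Fin n → ℝ) := {s | (∀ i, 0 < s i) ∧ ∑ i, s i < 1}

lemma isOpen_refInterior (n : ℕ) : IsOpen (refInterior n) := by
  have : refInterior n = (⋂ i, {s | 0 < s i}) ∩ {s | ∑ i, s i < 1} := by
    ext s
    simp [refInterior]
  rw [this]
  refine (isOpen_iInter_of_finite fun i => isOpen_lt continuous_const (continuous_apply i)).inter ?_
  exact isOpen_lt (by fun_prop) continuous_const

lemma refInterior_subset (n : ℕ) : refInterior n ⊆ refSimplex n :=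
  fun _ hs => ⟨fun i => (hs.1 i).le, hs.2.le⟩

lemma refInterior_nonempty (n : ℕ) : (refInterior n).Nonempty := by
  refine ⟨fun _ => 1 / (n + 1), fun _ => by positivity, ?_⟩
  simp only [Finset.sum_const, Finset.card_univ, Fintype.card_fin, nsmul_eq_mul]
  rw [mul_one_div, div_lt_one (by positivity)]
  linarith

/-- The volume of the reference simplex. -/
def refVol (n : ℕ) : ℝ := volume.real (refSimplex n)

lemma refVol_pos (n : ℕ) : 0 < refVol n := by
  have h : 0 < volume (refSimplex n) :=
    lt_of_lt_of_le ((isOpen_refInterior n).measure_pos volume (refInterior_nonempty n))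
      (measure_mono (refInterior_subset n))
  exact ENNReal.toReal_pos h.ne' (volume_refSimplex_lt_top n).ne

/-- Points of the reference simplex are limits of interior points. -/
lemma refSimplex_subset_closure (n : ℕ) : refSimplex n ⊆ closure (refInterior n) := by
  intro s hs
  obtain ⟨c, hc⟩ := refInterior_nonempty n
  have h1 : Filter.Tendsto (fun t : ℝ => (1 - t) • s + t • c) (nhdsWithin 0 (Set.Ioi 0))
      (nhds s) := by
    have : Continuous fun t : ℝ => (1 - t) • s + t • c := by fun_prop
    have h2 := this.tendsto 0
    simp only [sub_zero, one_smul, zero_smul, add_zero] at h2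
    exact h2.mono_left nhdsWithin_le_nhds
  refine mem_closure_of_tendsto h1 ?_
  have h3 : Set.Ioo (0 : ℝ) 1 ∈ nhdsWithin (0 : ℝ) (Set.Ioi 0) := Ioo_mem_nhdsGT one_pos
  filter_upwards [h3] with t ht
  refine ⟨fun i => ?_, ?_⟩
  · have := hs.1 i
    have := hc.1 i
    have h4 : 0 ≤ (1 - t) * s i := mul_nonneg (by linarith [ht.2]) (hs.1 i)
    have h5 : 0 < t * c i := mul_pos ht.1 (hc.1 i)
    simp only [Pi.add_apply, Pi.smul_apply, smul_eq_mul]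
    linarith
  · simp only [Pi.add_apply, Pi.smul_apply, smul_eq_mul, Finset.sum_add_distrib, ← Finset.mul_sum]
    nlinarith [hs.2, hc.2, ht.1, ht.2]

lemma isCompact_convexHull_range (y : Fin (n + 1) → E d) :
    IsCompact (convexHull ℝ (Set.range y)) := by
  rw [convexHull_range_eq]
  exact (isCompact_refSimplex n).image (continuous_chart y)

lemma restrict_hull_eq (y : Fin (n + 1) → E d) :
    (μHE[n] : Measure (E d)).restrict (convexHull ℝ (Set.range y)) =
      ENNReal.ofReal (jac y) • (volume.restrict (refSimplex n)).map (chart y) := by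
  ext S hS
  rw [Measure.restrict_apply hS, Measure.smul_apply, smul_eq_mul,
    Measure.map_apply (continuous_chart y).measurable hS,
    Measure.restrict_apply ((continuous_chart y).measurable hS), ← measure_chart_image,
    convexHull_range_eq]
  congr 1
  ext x
  constructor
  · rintro ⟨hx, s, hs, rfl⟩
    exact ⟨s, ⟨hx, hs⟩, rfl⟩
  · rintro ⟨s, ⟨hx, hs⟩, rfl⟩
    exact ⟨hx, s, hs, rfl⟩

lemma measurableEmbedding_chart {y : Fin (n + 1) → E d} (hy : AffineIndependent ℝ y) :
    MeasurableEmbedding (chart y) :=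
  (continuous_chart y).measurableEmbedding (chart_injective hy)

/-- Change of variables on a simplex. -/
theorem setIntegral_hull {y : Fin (n + 1) → E d} (hy : AffineIndependent ℝ y) (f : E d → ℝ) :
    ∫ x in convexHull ℝ (Set.range y), f x ∂μHE[n] =
      jac y * ∫ s in refSimplex n, f (chart y s) := by
  rw [restrict_hull_eq y, integral_smul_measure, (measurableEmbedding_chart hy).integral_map,
    ENNReal.toReal_ofReal (jac_pos hy).le, smul_eq_mul]

/-- Both Jacobians, multiplied by `refVol n`, are the measure of the same simplex, so the order of
the vertices does not matter. -/
lemma jac_eq_of_range_eq {y z : Fin (n + 1) → E d} (hy : AffineIndependent ℝ y)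
    (hz : AffineIndependent ℝ z) (h : Set.range y = Set.range z) : jac y = jac z := by
  have h1 := setIntegral_hull hy fun _ => 1
  have h2 := setIntegral_hull hz fun _ => 1
  rw [h, h2] at h1
  simp only [integral_const, MeasurableSet.univ, measureReal_restrict_apply, Set.univ_inter,
    smul_eq_mul, mul_one] at h1
  exact (mul_right_cancel₀ (refVol_pos n).ne' h1).symm

lemma setIntegral_chart_eq_of_range_eq {y z : Fin (n + 1) → E d} (hy : AffineIndependent ℝ y)
    (hz : AffineIndependent ℝ z) (h : Set.range y = Set.range z) (f : E d → ℝ) :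
    ∫ s in refSimplex n, f (chart y s) = ∫ s in refSimplex n, f (chart z s) := by
  have h1 := setIntegral_hull hy f
  have h2 := setIntegral_hull hz f
  rw [h, h2, jac_eq_of_range_eq hy hz h] at h1
  exact (mul_left_cancel₀ (jac_pos hz).ne' h1).symm

/-- Integration over the reference simplex is invariant under permutations of the vertices. -/
lemma setIntegral_bary_perm (π : Equiv.Perm (Fin (n + 1))) (g : (Fin (n + 1) → ℝ) → ℝ) :
    ∫ s in refSimplex n, g (bary s ∘ π) = ∫ s in refSimplex n, g (bary s) := by
  -- The symmetry is read off from geometry: for the standard simplex in `E (n + 1)` the chart is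
  -- `bary` itself, and listing the vertices in another order permutes the barycentric coordinates
  -- without changing the hull.
  let y : Fin (n + 1) → E (n + 1) := fun k => EuclideanSpace.single k 1
  have hy : AffineIndependent ℝ y := by
    have h : LinearIndependent ℝ y := by
      have e : y = ⇑(EuclideanSpace.basisFun (Fin (n + 1)) ℝ).toBasis := by
        ext1 k
        simp [y]
      rw [e]
      exact (EuclideanSpace.basisFun (Fin (n + 1)) ℝ).toBasis.linearIndependent
    exact h.affineIndependent
  have hy' : AffineIndependent ℝ (y ∘ π.symm) := hy.comp_embedding π.symm.toEmbedding
  have h1 : ∀ s, (chart y s).ofLp = bary s := fun s => by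
    ext k
    simp [chart, y, Pi.single_apply]
  have h2 : ∀ s, (chart (y ∘ π.symm) s).ofLp = bary s ∘ π := fun s => by
    ext k
    simp only [chart, y, Function.comp_apply, WithLp.ofLp_sum, WithLp.ofLp_smul, Finset.sum_apply,
      Pi.smul_apply, PiLp.ofLp_single, Pi.single_apply, smul_eq_mul, mul_ite, mul_one, mul_zero]
    rw [Finset.sum_eq_single (π k)]
    · simp
    · intro b _ hb
      rw [if_neg]
      rintro rfl
      simp at hb
    · simp
  have := setIntegral_chart_eq_of_range_eq hy' hy (by simp [Set.range_comp]) (fun x => g x.ofLp)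
  simpa only [h1, h2] using this

end Chart

end

/-! ### Facets, heights and normals of a simplex -/

section

section Height

variable {d n : ℕ}

lemma jac_sq (y : Fin (n + 1) → E d) :
    jac y ^ 2 = (Matrix.of fun i k : Fin n =>
      inner ℝ (y i.succ - y 0) (y k.succ - y 0)).det := by
  have h := (chartLin y).normDet_sq_eq_det_gram (EuclideanSpace.basisFun (Fin n) ℝ)
  have h2 : ∀ i : Fin n, chartLin y (EuclideanSpace.basisFun (Fin n) ℝ i) = y i.succ - y 0 := by
    intro i
    simp [chartLin]
  simp only [h2] at h
  exact h

lemma jac_eq_abs_det {b : OrthonormalBasis (Fin n) ℝ (E n)} (y : Fin (n + 1) → E n) :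
    jac y = |(Matrix.of fun i k : Fin n => inner ℝ (b i) (y k.succ - y 0)).det| := by
  have h0 : 0 ≤ jac y := LinearMap.normDet_nonneg _
  rw [← abs_of_nonneg h0]
  refine (sq_eq_sq_iff_abs_eq_abs _ _).1 ?_
  rw [jac_sq]
  set A := (Matrix.of fun i k : Fin n => inner ℝ (b i) (y k.succ - y 0)) with hA
  have : (Matrix.of fun i k : Fin n =>
      inner ℝ (y i.succ - y 0) (y k.succ - y 0)) = Aᵀ * A := by
    ext i k
    simp only [Matrix.of_apply, Matrix.mul_apply, Matrix.transpose_apply, hA]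
    rw [← b.sum_inner_mul_inner (y i.succ - y 0)]
    refine Finset.sum_congr rfl fun l _ => ?_
    rw [real_inner_comm]
  rw [this, Matrix.det_mul, Matrix.det_transpose, sq]

/-- As `b 0` is orthogonal to all edge vectors, the Gram matrix is `Aᵀ * A` with a square `A` that
leaves out the direction `b 0`. -/
lemma jac_eq_abs_det_of_orthogonal {b : OrthonormalBasis (Fin (n + 1)) ℝ (E (n + 1))}
    (y : Fin (n + 1) → E (n + 1)) (h : ∀ k l, inner ℝ (b 0) (y k - y l) = 0) :
    jac y = |(Matrix.of fun i k : Fin n => inner ℝ (b i.succ) (y k.succ - y 0)).det| := by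
  have h0 : 0 ≤ jac y := LinearMap.normDet_nonneg _
  rw [← abs_of_nonneg h0]
  refine (sq_eq_sq_iff_abs_eq_abs _ _).1 ?_
  rw [jac_sq]
  set A := (Matrix.of fun i k : Fin n => inner ℝ (b i.succ) (y k.succ - y 0)) with hA
  have : (Matrix.of fun i k : Fin n =>
      inner ℝ (y i.succ - y 0) (y k.succ - y 0)) = Aᵀ * A := by
    ext i k
    simp only [Matrix.of_apply, Matrix.mul_apply, Matrix.transpose_apply, hA]
    rw [← b.sum_inner_mul_inner (y i.succ - y 0), Fin.sum_univ_succ, h, mul_zero, zero_add]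
    refine Finset.sum_congr rfl fun l _ => ?_
    rw [real_inner_comm]
  rw [this, Matrix.det_mul, Matrix.det_transpose, sq]

/-- The facet of a simplex opposite to the vertex `i`. -/
abbrev facet (y : Fin (n + 2) → E d) (i : Fin (n + 2)) : Fin (n + 1) → E d := y ∘ i.succAbove

lemma facet_affineIndependent {y : Fin (n + 2) → E d} (hy : AffineIndependent ℝ y)
    (i : Fin (n + 2)) : AffineIndependent ℝ (facet y i) :=
  hy.comp_embedding i.succAboveEmb

/-- Volume is height times base. -/
lemma jac_facet_mul_abs_inner {y : Fin (n + 2) → E (n + 1)} (hy : AffineIndependent ℝ y)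
    (i : Fin (n + 2)) {u : E (n + 1)} (hu : ‖u‖ = 1)
    (horth : ∀ k l, k ≠ i → l ≠ i → inner ℝ u (y k - y l) = 0) {l : Fin (n + 2)} (hl : l ≠ i) :
    jac (facet y i) * |inner ℝ u (y i - y l)| = jac y := by
  obtain ⟨b, hb⟩ : ∃ b : OrthonormalBasis (Fin (n + 1)) ℝ (E (n + 1)), b 0 = u := by
    have h1 : Orthonormal ℝ (({0} : Set (Fin (n + 1))).domRestrict fun _ => u) := by
      refine ⟨fun _ => hu, fun p q hpq => ?_⟩
      exact absurd (Subsingleton.elim p q) hpq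
    obtain ⟨b, hb⟩ := h1.exists_orthonormalBasis_extension_of_card_eq (by simp)
    exact ⟨b, hb 0 rfl⟩
  -- The vertex `i` is moved to the last place. In the determinant for `z` the row of `u = b 0` then
  -- has its only nonzero entry in the last column, and Laplace expansion leaves the height times
  -- the determinant of the facet.
  let z : Fin (n + 2) → E (n + 1) := Fin.snoc (α := fun _ => E (n + 1)) (facet y i) (y i)
  have hz0 : z 0 = y (i.succAbove 0) := by
    have : (0 : Fin (n + 2)) = Fin.castSucc 0 := rfl
    simp only [z, this, Fin.snoc_castSucc]
    rfl
  have hzs : ∀ k : Fin n, z (k.castSucc).succ = y (i.succAbove k.succ) := fun k => by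
    simp only [z, Fin.succ_castSucc, Fin.snoc_castSucc]
    rfl
  have hzl : z (Fin.last n).succ = y i := by
    rw [Fin.succ_last]
    simp [z]
  have hrange : Set.range z = Set.range y := by
    ext x
    constructor
    · rintro ⟨k, rfl⟩
      refine Fin.lastCases ?_ (fun k => ?_) k
      · simp [z]
      · simp [z]
    · rintro ⟨k, rfl⟩
      by_cases hk : k = i
      · exact ⟨Fin.last _, by simp [z, hk]⟩
      · obtain ⟨m, rfl⟩ := Fin.exists_succAbove_eq hk
        exact ⟨m.castSucc, by simp [z]⟩
  have hzy : ∃ π : Equiv.Perm (Fin (n + 2)), z = y ∘ π := by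
    have hinj : Function.Injective z := by
      have hc : (Finset.univ.image z).card = (Finset.univ : Finset (Fin (n + 2))).card := by
        have : Finset.univ.image z = Finset.univ.image y := by
          ext x
          simpa using Set.ext_iff.1 hrange x
        rw [this, Finset.card_image_of_injective _ hy.injective]
      exact fun p q hpq => Finset.card_image_iff.1 hc (by simp) (by simp) hpq
    have h1 : ∀ k, ∃ m, y m = z k := fun k => by
      have : z k ∈ Set.range y := hrange ▸ Set.mem_range_self k
      exact this
    choose f hf using h1
    have hfi : Function.Injective f := fun p q hpq => hinj (by rw [← hf, ← hf, hpq])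
    exact ⟨Equiv.ofBijective f ⟨hfi, Finite.surjective_of_injective hfi⟩,
      funext fun k => (hf k).symm⟩
  obtain ⟨π, hπ⟩ := hzy
  have hzi : AffineIndependent ℝ z := hπ ▸ hy.comp_embedding π.toEmbedding
  rw [← jac_eq_of_range_eq hzi hy hrange, jac_eq_abs_det (b := b),
    jac_eq_abs_det_of_orthogonal (b := b), Matrix.det_succ_row_zero,
    Finset.sum_eq_single (Fin.last n)]
  · rw [abs_mul, abs_mul, abs_pow, abs_neg, abs_one, one_pow, one_mul, mul_comm]
    congr 1
    · simp only [Matrix.of_apply, hzl, hz0, hb]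
      have : y i - y l = (y i - y (i.succAbove 0)) + (y (i.succAbove 0) - y l) := by abel
      rw [this, inner_add_right, horth _ _ (Fin.succAbove_ne i 0) hl, add_zero]
    · congr 2
      ext p q
      simp only [Matrix.submatrix_apply, Matrix.of_apply, Fin.succAbove_last, hzs, hz0,
        Function.comp_apply]
  · intro k _ hk
    obtain ⟨m, rfl⟩ : ∃ m, k = Fin.castSucc m := by
      exact ⟨k.castPred hk, by simp⟩
    simp only [Matrix.of_apply, hzs, hz0, hb]
    rw [horth _ _ (Fin.succAbove_ne i _) (Fin.succAbove_ne i _)]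
    simp
  · simp
  · intro k l
    rw [hb]
    exact horth _ _ (Fin.succAbove_ne i _) (Fin.succAbove_ne i _)

/-- `u` is the outward unit normal on the facet opposite to the vertex `i`. -/
structure IsNormal (y : Fin (n + 2) → E (n + 1)) (i : Fin (n + 2)) (u : E (n + 1)) : Prop where
  norm : ‖u‖ = 1
  orth : ∀ k l, k ≠ i → l ≠ i → inner ℝ u (y k - y l) = 0
  le : ∀ k l, l ≠ i → inner ℝ u (y k - y l) ≤ 0

/-- The `n` edge vectors of a facet cannot span `n + 1` dimensions. A unit vector orthogonal to them
is taken, with the sign fixed at the vertex `i`. -/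
lemma exists_isNormal (y : Fin (n + 2) → E (n + 1)) (i : Fin (n + 2)) : ∃ u, IsNormal y i u := by
  let S : Submodule ℝ (E (n + 1)) := Submodule.span ℝ
    (Set.range fun k : Fin n => y (i.succAbove k.succ) - y (i.succAbove 0))
  have hS : S ≠ ⊤ := by
    intro h
    have h1 : Module.finrank ℝ S ≤ n := by
      have := finrank_range_le_card (R := ℝ)
        (fun k : Fin n => y (i.succAbove k.succ) - y (i.succAbove 0))
      exact this.trans (by simp)
    rw [h, finrank_top, finrank_euclideanSpace_fin] at h1
    omega
  have hS' : Sᗮ ≠ ⊥ := fun h => hS ((Submodule.orthogonal_eq_bot_iff).1 h)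
  obtain ⟨w, hw, hw0⟩ := Submodule.exists_mem_ne_zero_of_ne_bot hS'
  have horth0 : ∀ k, inner ℝ w (y (i.succAbove k) - y (i.succAbove 0)) = 0 := by
    intro k
    refine Fin.cases ?_ (fun k => ?_) k
    · simp
    · exact (Submodule.mem_orthogonal' S w).1 hw _ (Submodule.subset_span ⟨k, rfl⟩)
  have horth : ∀ k l, k ≠ i → l ≠ i → inner ℝ w (y k - y l) = 0 := by
    intro k l hk hl
    obtain ⟨k, rfl⟩ := Fin.exists_succAbove_eq hk
    obtain ⟨l, rfl⟩ := Fin.exists_succAbove_eq hl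
    have : y (i.succAbove k) - y (i.succAbove l) =
      (y (i.succAbove k) - y (i.succAbove 0)) - (y (i.succAbove l) - y (i.succAbove 0)) := by abel
    rw [this, inner_sub_right, horth0, horth0, sub_zero]
  obtain ⟨ε, hε, hsign⟩ : ∃ ε : ℝ, |ε| = 1 ∧ ε * inner ℝ w (y i - y (i.succAbove 0)) ≤ 0 := by
    rcases le_total (inner ℝ w (y i - y (i.succAbove 0))) 0 with h | h
    · exact ⟨1, by simp, by simpa using h⟩
    · exact ⟨-1, by simp, by simpa using h⟩
  have hwn : 0 < ‖w‖ := norm_pos_iff.2 hw0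
  refine ⟨(ε * ‖w‖⁻¹) • w, ?_, fun k l hk hl => ?_, fun k l hl => ?_⟩
  · rw [norm_smul, Real.norm_eq_abs, abs_mul, hε, abs_inv, abs_norm, one_mul,
      inv_mul_cancel₀ hwn.ne']
  · rw [real_inner_smul_left, horth k l hk hl, mul_zero]
  · rw [real_inner_smul_left]
    by_cases hk : k = i
    · subst hk
      have : y k - y l = (y k - y (k.succAbove 0)) + (y (k.succAbove 0) - y l) := by abel
      rw [this, inner_add_right, horth _ _ (Fin.succAbove_ne k 0) hl, add_zero]
      have : 0 < ‖w‖⁻¹ := by positivity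
      nlinarith
    · rw [horth k l hk hl, mul_zero]

/-- In other words, `jac (facet y i)` times the outward normal is `-jac y` times the gradient of the
`i`-th barycentric coordinate, here tested on differences of vertices. -/
lemma IsNormal.jac_mul_inner {y : Fin (n + 2) → E (n + 1)} (hy : AffineIndependent ℝ y)
    {i : Fin (n + 2)} {u : E (n + 1)} (hu : IsNormal y i u) (k l : Fin (n + 2)) :
    jac (facet y i) * inner ℝ u (y k - y l) =
      -jac y * ((if k = i then 1 else 0) - (if l = i then 1 else 0)) := by
  have key : ∀ l, l ≠ i → jac (facet y i) * inner ℝ u (y i - y l) = -jac y := fun l hl => by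
    rw [← jac_facet_mul_abs_inner hy i hu.norm hu.orth hl, abs_of_nonpos (hu.le i l hl)]
    ring
  by_cases hk : k = i <;> by_cases hl : l = i
  · simp [hk, hl]
  · subst hk
    simp [hl, key l hl]
  · subst hl
    have := key k hk
    rw [← neg_sub, inner_neg_right] at this
    simp only [hk, if_false, if_true, zero_sub, mul_neg, mul_one, neg_neg]
    linarith
  · simp [hk, hl, hu.orth k l hk hl]

end Height

end

section

/-! ### Polynomials -/

section Poly

variable {m k : ℕ}

/-- Polynomials in `m` variables of total degree at most `k`. -/
abbrev Pol (m k : ℕ) : Submodule ℝ (MvPolynomial (Fin m) ℝ) := restrictTotalDegree (Fin m) ℝ k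

lemma mem_Pol {p : MvPolynomial (Fin m) ℝ} : p ∈ Pol m k ↔ p.totalDegree ≤ k :=
  mem_restrictTotalDegree _ _ _

lemma C_mem_Pol (c : ℝ) : C c ∈ Pol m k := mem_Pol.2 (by simp)

lemma X_mul_mem_Pol {p : MvPolynomial (Fin m) ℝ} (hp : p ∈ Pol m k) (i : Fin m) :
    X i * p ∈ Pol m (k + 1) := by
  rw [mem_Pol] at *
  refine (totalDegree_mul _ _).trans ?_
  rw [totalDegree_X]
  omega

lemma Pol_mono {k l : ℕ} (h : k ≤ l) : Pol m k ≤ Pol m l := fun _ hp =>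
  mem_Pol.2 ((mem_Pol.1 hp).trans h)

lemma C_mul_mem_Pol {p : MvPolynomial (Fin m) ℝ} (hp : p ∈ Pol m k) (c : ℝ) :
    C c * p ∈ Pol m k := by
  rw [← smul_eq_C_mul]
  exact Submodule.smul_mem _ c hp

lemma monomial_mem_Pol {s : Fin m →₀ ℕ} (hs : s.degree ≤ k) (c : ℝ) :
    monomial s c ∈ Pol m k := by
  rw [mem_Pol]
  exact (totalDegree_monomial_le _ _).trans hs

lemma mem_Pol_induction {p : MvPolynomial (Fin m) ℝ} {Q : MvPolynomial (Fin m) ℝ → Prop}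
    (hp : p ∈ Pol m k) (h0 : Q 0) (hadd : ∀ p q, Q p → Q q → Q (p + q))
    (hmon : ∀ s c, s.degree ≤ k → Q (monomial s c)) : Q p := by
  rw [p.as_sum]
  refine Finset.sum_induction _ Q hadd h0 fun s hs => hmon s _ ?_
  exact (le_totalDegree hs).trans (mem_Pol.1 hp)

lemma X_mul_pderiv_mem_Pol {p : MvPolynomial (Fin m) ℝ} (hp : p ∈ Pol m k) (i l : Fin m) :
    X i * pderiv l p ∈ Pol m k := by
  refine mem_Pol_induction (Q := fun p => X i * pderiv l p ∈ Pol m k) hp (by simp)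
    (fun p q hp hq => ?_) (fun s c hs => ?_)
  · rw [map_add, mul_add]
    exact Submodule.add_mem _ hp hq
  · rw [pderiv_monomial]
    by_cases h0 : s l = 0
    · simp [h0]
    · have h1 : (s - Finsupp.single l 1) + Finsupp.single l 1 = s :=
        tsub_add_cancel_of_le (Finsupp.single_le_iff.2 (Nat.one_le_iff_ne_zero.2 h0))
      have h2 : (s - Finsupp.single l 1).degree + 1 = s.degree := by
        conv_rhs => rw [← h1]
        simp
      rw [X, monomial_mul]
      refine monomial_mem_Pol ?_ _
      simp only [map_add, Finsupp.degree_single]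
      omega

/-- The top degree part splits off. -/
lemma X_mul_sub_homogeneousComponent_mem_Pol {p : MvPolynomial (Fin m) ℝ} (hp : p ∈ Pol m k)
    (i : Fin m) : X i * (p - homogeneousComponent k p) ∈ Pol m k := by
  refine mem_Pol_induction (Q := fun p => X i * (p - homogeneousComponent k p) ∈ Pol m k) hp
    (by simp) (fun p q hp hq => ?_) (fun s c hs => ?_)
  · rw [map_add, add_sub_add_comm, mul_add]
    exact Submodule.add_mem _ hp hq
  · by_cases h : s.degree = k
    · have : homogeneousComponent k (monomial s c) = monomial s c :=
        homogeneousComponent_of_mem (isHomogeneous_monomial c h) |>.trans (by simp)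
      simp [this]
    · have : homogeneousComponent k (monomial s c) = 0 :=
        (homogeneousComponent_of_mem (isHomogeneous_monomial c rfl)).trans (by
          rw [if_neg (fun h' => h h'.symm)])
      rw [this, sub_zero, X, monomial_mul]
      refine monomial_mem_Pol ?_ _
      simp only [map_add, Finsupp.degree_single]
      omega

/-- A polynomial of degree at most `k + 1` is a constant plus a combination of the coordinates
with coefficients of degree at most `k`. -/
lemma exists_eq_C_add_sum_X_mul {p : MvPolynomial (Fin m) ℝ} (hp : p ∈ Pol m (k + 1)) :
    ∃ (c : ℝ) (q : Fin m → MvPolynomial (Fin m) ℝ), (∀ i, q i ∈ Pol m k) ∧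
      p = C c + ∑ i, X i * q i := by
  refine mem_Pol_induction (Q := fun p => ∃ (c : ℝ) (q : Fin m → MvPolynomial (Fin m) ℝ),
    (∀ i, q i ∈ Pol m k) ∧ p = C c + ∑ i, X i * q i) hp ?_ ?_ ?_
  · exact ⟨0, 0, fun i => Submodule.zero_mem _, by simp⟩
  · rintro _ _ ⟨c, q, hq, rfl⟩ ⟨c', q', hq', rfl⟩
    refine ⟨c + c', q + q', fun i => Submodule.add_mem _ (hq i) (hq' i), ?_⟩
    simp only [map_add, Pi.add_apply, mul_add, Finset.sum_add_distrib]
    ring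
  · intro s c hs
    by_cases h0 : s = 0
    · exact ⟨c, 0, fun i => Submodule.zero_mem _, by simp [h0]⟩
    · obtain ⟨l, hl⟩ := Finsupp.ne_iff.1 h0
      have h1 : Finsupp.single l 1 + (s - Finsupp.single l 1) = s :=
        add_tsub_cancel_of_le (Finsupp.single_le_iff.2 (Nat.one_le_iff_ne_zero.2 hl))
      have h2 : 1 + (s - Finsupp.single l 1).degree = s.degree := by
        conv_rhs => rw [← h1]
        simp
      refine ⟨0, Pi.single l (monomial (s - Finsupp.single l 1) c), fun i => ?_, ?_⟩
      · by_cases hi : i = l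
        · subst hi
          rw [Pi.single_eq_same]
          exact monomial_mem_Pol (by omega) _
        · rw [Pi.single_eq_of_ne hi]
          exact Submodule.zero_mem _
      · rw [Finset.sum_eq_single l (fun b _ hb => by simp [Pi.single_eq_of_ne hb]) (by simp),
          Pi.single_eq_same, X, monomial_mul, h1]
        simp

lemma eq_C_of_pderiv_eq_zero {p : MvPolynomial (Fin m) ℝ} (h : ∀ i, pderiv i p = 0) :
    p = C (coeff 0 p) := by
  ext s
  rw [coeff_C]
  by_cases h0 : s = 0
  · simp [h0]
  · rw [if_neg (Ne.symm h0)]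
    obtain ⟨l, hl⟩ := Finsupp.ne_iff.1 h0
    have h1 : (s - Finsupp.single l 1) + Finsupp.single l 1 = s :=
      tsub_add_cancel_of_le (Finsupp.single_le_iff.2 (Nat.one_le_iff_ne_zero.2 hl))
    have h2 := coeff_pderiv (i := l) p (s - Finsupp.single l 1)
    rw [h l, coeff_zero, h1] at h2
    have h3 : (((s - Finsupp.single l 1 : Fin m →₀ ℕ) l : ℕ) : ℝ) + 1 ≠ 0 := by positivity
    exact (mul_eq_zero.1 h2.symm).resolve_right h3

/-- Substitution of an affine map `x ↦ b + B x`. -/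
def affComp (B : Matrix (Fin m) (Fin m) ℝ) (b : Fin m → ℝ) :
    MvPolynomial (Fin m) ℝ →ₐ[ℝ] MvPolynomial (Fin m) ℝ :=
  bind₁ fun i => C (b i) + ∑ k, C (B i k) * X k

lemma eval_affComp (B : Matrix (Fin m) (Fin m) ℝ) (b x : Fin m → ℝ) (p : MvPolynomial (Fin m) ℝ) :
    eval x (affComp B b p) = eval (b + B *ᵥ x) p := by
  have : ∀ x : Fin m → ℝ, ∀ q : MvPolynomial (Fin m) ℝ, eval x q = aeval x q := fun x q => by
    rw [aeval_eq_eval]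
  rw [this, affComp, aeval_bind₁, this]
  congr 2
  ext i
  simp [Matrix.mulVec, dotProduct]

lemma affComp_mem_Pol (B : Matrix (Fin m) (Fin m) ℝ) (b : Fin m → ℝ) {p : MvPolynomial (Fin m) ℝ}
    (hp : p ∈ Pol m k) : affComp B b p ∈ Pol m k := by
  refine mem_Pol_induction (Q := fun p => affComp B b p ∈ Pol m k) hp (by simp)
    (fun p q hp hq => ?_) (fun s c hs => ?_)
  · rw [map_add]
    exact Submodule.add_mem _ hp hq
  · rw [affComp, bind₁_monomial]
    refine C_mul_mem_Pol (mem_Pol.2 ?_) c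
    refine (totalDegree_finsetProd _ _).trans (le_trans (Finset.sum_le_sum fun i _ => ?_) hs)
    refine (totalDegree_pow _ _).trans ?_
    have : (C (b i) + ∑ k, C (B i k) * X k : MvPolynomial (Fin m) ℝ).totalDegree ≤ 1 := by
      rw [← mem_Pol]
      refine Submodule.add_mem _ (C_mem_Pol _) (Submodule.sum_mem _ fun l _ => ?_)
      exact C_mul_mem_Pol (mem_Pol.2 (by simp)) _
    calc _ ≤ s i * 1 := Nat.mul_le_mul_left _ this
      _ = s i := mul_one _

lemma pderiv_affComp (B : Matrix (Fin m) (Fin m) ℝ) (b : Fin m → ℝ) (l : Fin m)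
    (p : MvPolynomial (Fin m) ℝ) :
    pderiv l (affComp B b p) = ∑ i, C (B i l) * affComp B b (pderiv i p) := by
  induction p using MvPolynomial.induction_on with
  | C a => simp [affComp]
  | add p q hp hq => simp [hp, hq, mul_add, Finset.sum_add_distrib]
  | mul_X p i hp =>
    have hX : pderiv l (affComp B b (X i)) = C (B i l) := by
      simp only [affComp, bind₁_X_right, map_add, map_sum, pderiv_C, pderiv_C_mul, zero_add]
      rw [Finset.sum_eq_single l]
      · simp
      · intro k _ hk
        simp [pderiv_X_of_ne hk]
      · simp
    rw [map_mul, pderiv_mul, hp, hX]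
    simp only [pderiv_mul, map_add, map_mul, mul_add, Finset.sum_add_distrib]
    congr 1
    · rw [Finset.sum_mul]
      exact Finset.sum_congr rfl fun k _ => by ring
    · rw [Finset.sum_eq_single i]
      · simp [mul_comm]
      · intro k _ hk
        simp [pderiv_X_of_ne hk.symm]
      · simp

/-! ### The local spaces -/

/-- A criterion that serves both pairs. For RT the part of `r` below degree `j` is absorbed into
`p`, and only the homogeneous part multiplies `x`; for BDM it is a matter of degree. -/
lemma mem_G_of_eq {P : Pair} {j : ℕ} {q p : Fin m → MvPolynomial (Fin m) ℝ}
    {r : MvPolynomial (Fin m) ℝ} (hp : ∀ i, p i ∈ Pol m j) (hr : r ∈ Pol m j)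
    (h : ∀ i, q i = p i + X i * r) : q ∈ P.G m j := by
  cases P with
  | RT =>
    have : q = (fun i => p i + X i * (r - homogeneousComponent j r)) +
        mulX m (homogeneousComponent j r) := by
      ext1 i
      simp only [h, mulX, LinearMap.coe_mk, AddHom.coe_mk, Pi.add_apply]
      ring
    rw [this]
    refine Submodule.add_mem_sup ?_ (Submodule.mem_map_of_mem ?_)
    · intro i _
      exact Submodule.add_mem _ (hp i) (X_mul_sub_homogeneousComponent_mem_Pol hr i)
    · exact homogeneousComponent_isHomogeneous j r
  | BDM =>
    intro i _
    rw [h]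
    exact Submodule.add_mem _ (Pol_mono (Nat.le_succ j) (hp i)) (X_mul_mem_Pol hr i)

lemma mem_G_RT {j : ℕ} {q : Fin m → MvPolynomial (Fin m) ℝ} (hq : q ∈ Pair.RT.G m j) :
    ∃ (p : Fin m → MvPolynomial (Fin m) ℝ) (r : MvPolynomial (Fin m) ℝ),
      (∀ i, p i ∈ Pol m j) ∧ r ∈ Pol m j ∧ ∀ i, q i = p i + X i * r := by
  obtain ⟨p, hp, _, ⟨r, hr, rfl⟩, rfl⟩ := Submodule.mem_sup.1 hq
  refine ⟨p, r, fun i => hp i trivial, ?_, fun i => ?_⟩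
  · exact mem_Pol.2 (IsHomogeneous.totalDegree_le hr)
  · simp [mulX, mul_comm]

lemma G_apply_mem_Pol {P : Pair} {j : ℕ} {q : Fin m → MvPolynomial (Fin m) ℝ}
    (hq : q ∈ P.G m j) (i : Fin m) : q i ∈ Pol m (j + 1) := by
  cases P with
  | RT =>
    obtain ⟨p, r, hp, hr, h⟩ := mem_G_RT hq
    rw [h]
    exact Submodule.add_mem _ (Pol_mono (Nat.le_succ j) (hp i)) (X_mul_mem_Pol hr i)
  | BDM => exact hq i trivial

instance finiteDimensional_G (P : Pair) (j : ℕ) : FiniteDimensional ℝ (P.G m j) := by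
  let f : (Fin m → Pol m (j + 1)) →ₗ[ℝ] (Fin m → MvPolynomial (Fin m) ℝ) :=
    LinearMap.pi fun i => (Pol m (j + 1)).subtype ∘ₗ LinearMap.proj i
  have h : P.G m j ≤ LinearMap.range f := fun q hq =>
    ⟨fun i => ⟨q i, G_apply_mem_Pol hq i⟩, by
      ext1 i
      rfl⟩
  exact Submodule.finiteDimensional_of_le h

/-- The contravariant transformation of vector fields. -/
def piola (M B : Matrix (Fin m) (Fin m) ℝ) (b : Fin m → ℝ) (q : Fin m → MvPolynomial (Fin m) ℝ) :
    Fin m → MvPolynomial (Fin m) ℝ :=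
  fun i => ∑ l, C (M i l) * affComp B b (q l)

/-- For RT the term `x r` has to reappear: the substitution turns `x` into `b + B x`, and `M * B =
1` restores `x`, while everything else has degree at most `j`. For BDM only the degree matters. -/
lemma piola_mem_G {P : Pair} {j : ℕ} {M B : Matrix (Fin m) (Fin m) ℝ} (hMB : M * B = 1)
    (b : Fin m → ℝ) {q : Fin m → MvPolynomial (Fin m) ℝ} (hq : q ∈ P.G m j) :
    piola M B b q ∈ P.G m j := by
  cases P with
  | RT =>
    obtain ⟨p, r, hp, hr, h⟩ := mem_G_RT hq
    refine mem_G_of_eq (p := fun i => ∑ l, C (M i l) * affComp B b (p l) +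
      C (∑ l, M i l * b l) * affComp B b r) (r := affComp B b r) (fun i => ?_)
      (affComp_mem_Pol B b hr) (fun i => ?_)
    · refine Submodule.add_mem _ (Submodule.sum_mem _ fun l _ => ?_) ?_
      · exact C_mul_mem_Pol (affComp_mem_Pol B b (hp l)) _
      · exact C_mul_mem_Pol (affComp_mem_Pol B b hr) _
    · have h1 : ∀ l, affComp B b (X l) = C (b l) + ∑ k, C (B l k) * X k := fun l => by
        simp [affComp]
      have h2 : ∑ l, C (M i l) * ∑ k, C (B l k) * X k = (X i : MvPolynomial (Fin m) ℝ) := by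
        simp only [Finset.mul_sum]
        rw [Finset.sum_comm]
        have : ∀ k, ∑ l, C (M i l) * (C (B l k) * X k) =
            C ((M * B) i k) * (X k : MvPolynomial (Fin m) ℝ) := fun k => by
          simp only [Matrix.mul_apply, map_sum, map_mul, Finset.sum_mul, mul_assoc]
        simp only [this, hMB, Matrix.one_apply]
        rw [Finset.sum_eq_single i]
        · simp
        · intro k _ hk
          simp [hk.symm]
        · simp
      have h3 : ∀ l, C (M i l) * affComp B b (q l) = C (M i l) * affComp B b (p l) +
          C (M i l * b l) * affComp B b r +
          (C (M i l) * ∑ k, C (B l k) * X k) * affComp B b r := fun l => by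
        rw [h, map_add, map_mul, h1, map_mul]
        ring
      simp only [piola, h3]
      rw [Finset.sum_add_distrib, Finset.sum_add_distrib, ← Finset.sum_mul, ← Finset.sum_mul, h2,
        map_sum]
  | BDM =>
    intro i _
    exact Submodule.sum_mem _ fun l _ => C_mul_mem_Pol (affComp_mem_Pol B b (hq l trivial)) _

/-- The divergence is compatible with the contravariant transformation. -/
lemma divergence_piola {M B : Matrix (Fin m) (Fin m) ℝ} (hBM : B * M = 1) (b : Fin m → ℝ)
    (q : Fin m → MvPolynomial (Fin m) ℝ) :
    divergence (piola M B b q) = affComp B b (divergence q) := by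
  simp only [divergence, piola, map_sum, pderiv_C_mul, pderiv_affComp, Finset.mul_sum]
  have h1 : ∀ i l k : Fin m, C (M i l) * (C (B k i) * affComp B b (pderiv k (q l))) =
      C (B k i * M i l) * affComp B b (pderiv k (q l)) := fun i l k => by
    rw [map_mul]
    ring
  simp only [h1]
  rw [Finset.sum_comm]
  refine Finset.sum_congr rfl fun l _ => ?_
  rw [Finset.sum_comm]
  simp only [← Finset.sum_mul, ← map_sum, ← Matrix.mul_apply, hBM, Matrix.one_apply]
  rw [Finset.sum_eq_single l]
  · simp
  · intro k _ hk
    simp [hk]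
  · simp

end Poly

end

section

/-! ### Integration of polynomials over the reference simplex -/

section RefIntegral

variable {n : ℕ}

lemma integrableOn_refSimplex {f : (Fin n → ℝ) → ℝ} (hf : Continuous f) :
    IntegrableOn f (refSimplex n) :=
  hf.continuousOn.integrableOn_compact (isCompact_refSimplex n)

/-- Almost everywhere zero implies zero on the open simplex by continuity, and the closed simplex
lies in the closure of the open one. -/
lemma eq_zero_on_refSimplex {f : (Fin n → ℝ) → ℝ} (hf : Continuous f)
    (h0 : ∀ s ∈ refSimplex n, 0 ≤ f s) (h : ∫ s in refSimplex n, f s = 0) :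
    ∀ s ∈ refSimplex n, f s = 0 := by
  have h1 : 0 ≤ᵐ[volume.restrict (refSimplex n)] f := by
    filter_upwards [ae_restrict_mem (measurableSet_refSimplex n)] with s hs using h0 s hs
  have h2 := (setIntegral_eq_zero_iff_of_nonneg_ae h1 (integrableOn_refSimplex hf)).1 h
  have h3 : f =ᵐ[volume.restrict (refInterior n)] 0 :=
    ae_restrict_of_ae_restrict_of_subset (refInterior_subset n) h2
  have h4 := Measure.eqOn_open_of_ae_eq h3 (isOpen_refInterior n) hf.continuousOn
    continuousOn_const
  intro s hs
  have h5 : closure (refInterior n) ⊆ {s | f s = 0} :=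
    closure_minimal (fun s hs => h4 hs) (isClosed_eq hf continuous_const)
  exact h5 (refSimplex_subset_closure n hs)

/-- The integral of a polynomial over the reference simplex. -/
def refInt (n : ℕ) : MvPolynomial (Fin n) ℝ →ₗ[ℝ] ℝ where
  toFun p := ∫ s in refSimplex n, eval s p
  map_add' p q := by
    simp only [map_add]
    exact integral_add (integrableOn_refSimplex (continuous_eval p))
      (integrableOn_refSimplex (continuous_eval q))
  map_smul' c p := by
    simp only [smul_eval, RingHom.id_apply, smul_eq_mul]
    exact integral_const_mul c _

/-- The parametrization of the facet of the reference simplex opposite to the vertex `i`. -/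
def facePt (i : Fin (n + 2)) (s : Fin n → ℝ) : Fin (n + 1) → ℝ :=
  fun k => (Fin.insertNth i 0 (bary s) : Fin (n + 2) → ℝ) k.succ

lemma continuous_bary : Continuous (bary : (Fin n → ℝ) → Fin (n + 1) → ℝ) := by
  refine continuous_pi fun k => ?_
  refine Fin.cases ?_ (fun i => ?_) k
  · simp only [bary_zero]
    fun_prop
  · simp only [bary_succ]
    fun_prop

lemma continuous_insertNth {X : Type*} [TopologicalSpace X] (k : Fin (n + 1)) {f : X → ℝ}
    {g : X → Fin n → ℝ} (hf : Continuous f) (hg : Continuous g) :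
    Continuous fun x => (Fin.insertNth k (f x) (g x) : Fin (n + 1) → ℝ) := by
  refine continuous_pi fun l => ?_
  rcases eq_or_ne l k with rfl | h
  · simpa using hf
  · obtain ⟨m, rfl⟩ := Fin.exists_succAbove_eq h
    simp only [Fin.insertNth_apply_succAbove]
    exact (continuous_apply m).comp hg

lemma continuous_facePt (i : Fin (n + 2)) : Continuous (facePt i) := by
  refine continuous_pi fun k => ?_
  exact (continuous_apply k.succ).comp
    (continuous_insertNth i (continuous_const (y := (0 : ℝ))) (continuous_bary (n := n)))

lemma bary_facePt (i : Fin (n + 2)) (s : Fin n → ℝ) :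
    bary (facePt i s) = Fin.insertNth i 0 (bary s) := by
  ext k
  refine Fin.cases ?_ (fun k => rfl) k
  rw [bary_zero]
  have h : ∑ k, (Fin.insertNth i 0 (bary s) : Fin (n + 2) → ℝ) k = 1 := by
    rw [Fin.sum_univ_succAbove _ i]
    simp [sum_bary]
  rw [Fin.sum_univ_succ] at h
  simp only [facePt]
  linarith

lemma facePt_zero (s : Fin n → ℝ) : facePt 0 s = bary s := by
  ext k
  simp [facePt]

lemma facePt_succ (k : Fin (n + 1)) (s : Fin n → ℝ) : facePt k.succ s = Fin.insertNth k 0 s := by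
  ext l
  rcases eq_or_ne l k with rfl | h
  · simp [facePt]
  · obtain ⟨m, rfl⟩ := Fin.exists_succAbove_eq h
    simp only [facePt, Fin.insertNth_apply_succAbove]
    rw [← Fin.succ_succAbove_succ, Fin.insertNth_apply_succAbove, bary_succ]

lemma facePt_mem {s : Fin n → ℝ} (hs : s ∈ refSimplex n) (i : Fin (n + 2)) :
    facePt i s ∈ refSimplex (n + 1) := by
  have h : ∀ k, 0 ≤ bary (facePt i s) k := fun k => by
    rw [bary_facePt]
    rcases eq_or_ne k i with rfl | hk
    · simp
    · obtain ⟨m, rfl⟩ := Fin.exists_succAbove_eq hk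
      simpa using bary_nonneg hs m
  refine ⟨fun k => ?_, ?_⟩
  · simpa using h k.succ
  · have := h 0
    rw [bary_zero] at this
    linarith

lemma chart_facePt {d : ℕ} (y : Fin (n + 2) → E d) (i : Fin (n + 2)) (s : Fin n → ℝ) :
    chart y (facePt i s) = chart (facet y i) s := by
  simp only [chart, bary_facePt]
  rw [Fin.sum_univ_succAbove _ i]
  simp

/-- The integral of a polynomial over a facet of the reference simplex. -/
def faceInt (i : Fin (n + 2)) : MvPolynomial (Fin (n + 1)) ℝ →ₗ[ℝ] ℝ where
  toFun p := ∫ s in refSimplex n, eval (facePt i s) p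
  map_add' p q := by
    simp only [map_add]
    exact integral_add (integrableOn_refSimplex ((continuous_eval p).comp (continuous_facePt i)))
      (integrableOn_refSimplex ((continuous_eval q).comp (continuous_facePt i)))
  map_smul' c p := by
    simp only [smul_eval, RingHom.id_apply, smul_eq_mul]
    exact integral_const_mul c _

lemma refInt_apply (p : MvPolynomial (Fin n) ℝ) :
    refInt n p = ∫ s in refSimplex n, eval s p := rfl

lemma faceInt_apply (i : Fin (n + 2)) (p : MvPolynomial (Fin (n + 1)) ℝ) :
    faceInt i p = ∫ s in refSimplex n, eval (facePt i s) p := rfl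

lemma faceInt_congr {i : Fin (n + 2)} {p q : MvPolynomial (Fin (n + 1)) ℝ}
    (h : ∀ s ∈ refSimplex n, eval (facePt i s) p = eval (facePt i s) q) :
    faceInt i p = faceInt i q :=
  setIntegral_congr_fun (measurableSet_refSimplex n) h

lemma refInt_C (c : ℝ) : refInt n (C c) = refVol n * c := by
  simp [refInt_apply, refVol]

lemma hasDerivAt_eval_insertNth (p : MvPolynomial (Fin (n + 1)) ℝ) (k : Fin (n + 1))
    (s : Fin n → ℝ) (t : ℝ) :
    HasDerivAt (fun t : ℝ => eval (Fin.insertNth k t s : Fin (n + 1) → ℝ) p)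
      (eval (Fin.insertNth k t s : Fin (n + 1) → ℝ) (pderiv k p)) t := by
  induction p using MvPolynomial.induction_on with
  | C a => simpa using hasDerivAt_const t a
  | add p q hp hq => simpa using hp.fun_add hq
  | mul_X p i hp =>
    have hX : HasDerivAt (fun t : ℝ => (Fin.insertNth k t s : Fin (n + 1) → ℝ) i)
        (eval (Fin.insertNth k t s : Fin (n + 1) → ℝ) (pderiv k (X i))) t := by
      rcases eq_or_ne i k with rfl | hi
      · simpa using hasDerivAt_id' t
      · obtain ⟨m, rfl⟩ := Fin.exists_succAbove_eq hi
        simpa [pderiv_X_of_ne (Fin.succAbove_ne k m)] using hasDerivAt_const t (s m)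
    have := hp.fun_mul hX
    simp only [map_mul, eval_X, pderiv_mul, map_add]
    exact this

/-- On the slanted facet, recovering the coordinate `k` from the others instead of the coordinate
`0` is a cyclic relabelling of the barycentric coordinates, which does not change the integral. -/
lemma setIntegral_insertNth (g : (Fin (n + 1) → ℝ) → ℝ) (k : Fin (n + 1)) :
    ∫ s in refSimplex n, g (Fin.insertNth k (1 - ∑ i, s i) s) =
      ∫ s in refSimplex n, g (bary s) := by
  rw [← setIntegral_bary_perm k.cycleRange g]
  refine integral_congr_ae (Filter.Eventually.of_forall fun s => ?_)
  simp only
  congr 1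
  ext l
  rcases eq_or_ne l k with rfl | hl
  · simp
  · obtain ⟨m, rfl⟩ := Fin.exists_succAbove_eq hl
    simp [Fin.cycleRange_succAbove]

/-- The divergence theorem on the reference simplex. -/
theorem refInt_pderiv (p : MvPolynomial (Fin (n + 1)) ℝ) (k : Fin (n + 1)) :
    refInt (n + 1) (pderiv k p) = faceInt 0 p - faceInt k.succ p := by
  set D := refSimplex (n + 1)
  -- Fubini with the inner integral in direction `k`: a line over `s` meets the simplex in `0 ≤ t ≤
  -- 1 - ∑ i, s i`, with the lower end on the coordinate facet `k.succ` and the upper end on the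
  -- slanted facet `0`.
  let e := MeasurableEquiv.piFinSuccAbove (fun _ : Fin (n + 1) => ℝ) k
  have he : MeasurePreserving e.symm := (volume_preserving_piFinSuccAbove (fun _ => ℝ) k).symm e
  have hes : ∀ z : ℝ × (Fin n → ℝ), e.symm z = Fin.insertNth k z.1 z.2 := fun z => rfl
  have hi : Integrable (D.indicator fun s => eval s (pderiv k p)) :=
    (integrable_indicator_iff (measurableSet_refSimplex _)).2
      (integrableOn_refSimplex (continuous_eval _))
  have hi2 := he.integrable_comp_of_integrable hi
  have hmem : ∀ (t : ℝ) (s : Fin n → ℝ), (Fin.insertNth k t s : Fin (n + 1) → ℝ) ∈ D ↔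
      (∀ i, 0 ≤ s i) ∧ t ∈ Set.Icc 0 (1 - ∑ i, s i) := fun t s => by
    simp only [D, refSimplex, Set.mem_ofPred_eq, Fin.sum_univ_succAbove _ k, Fin.forall_iff_succAbove k,
      Fin.insertNth_apply_same, Fin.insertNth_apply_succAbove, Set.mem_Icc]
    constructor
    · rintro ⟨⟨h1, h2⟩, h3⟩
      exact ⟨h2, h1, by linarith⟩
    · rintro ⟨h2, h1, h3⟩
      exact ⟨⟨h1, h2⟩, by linarith⟩
  have hinner : ∀ s : Fin n → ℝ, ∫ t, D.indicator (fun s => eval s (pderiv k p)) (e.symm (t, s)) =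
      (refSimplex n).indicator (fun s => eval (Fin.insertNth k (1 - ∑ i, s i) s : Fin (n + 1) → ℝ) p -
        eval (Fin.insertNth k 0 s : Fin (n + 1) → ℝ) p) s := by
    intro s
    by_cases hs : s ∈ refSimplex n
    · have h1 : ∀ t, D.indicator (fun s => eval s (pderiv k p)) (e.symm (t, s)) =
          (Set.Icc 0 (1 - ∑ i, s i)).indicator
            (fun t => eval (Fin.insertNth k t s : Fin (n + 1) → ℝ) (pderiv k p)) t := by
        intro t
        rw [hes]
        by_cases ht : t ∈ Set.Icc 0 (1 - ∑ i, s i)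
        · rw [Set.indicator_of_mem ht, Set.indicator_of_mem ((hmem t s).2 ⟨hs.1, ht⟩)]
        · rw [Set.indicator_of_notMem ht, Set.indicator_of_notMem fun h => ht ((hmem t s).1 h).2]
      simp only [h1]
      have hle : (0 : ℝ) ≤ 1 - ∑ i, s i := by linarith [hs.2]
      rw [integral_indicator measurableSet_Icc, integral_Icc_eq_integral_Ioc,
        ← intervalIntegral.integral_of_le hle, Set.indicator_of_mem hs]
      refine intervalIntegral.integral_eq_sub_of_hasDerivAt
        (fun t _ => hasDerivAt_eval_insertNth p k s t) ?_
      refine Continuous.intervalIntegrable ?_ _ _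
      exact (continuous_eval _).comp (continuous_insertNth k continuous_id continuous_const)
    · rw [Set.indicator_of_notMem hs]
      have h1 : ∀ t, D.indicator (fun s => eval s (pderiv k p)) (e.symm (t, s)) = 0 := by
        intro t
        rw [Set.indicator_of_notMem]
        rw [hes, hmem]
        rintro ⟨h2, h3, h4⟩
        exact hs ⟨h2, by linarith⟩
      simp [h1]
  calc refInt (n + 1) (pderiv k p) = ∫ s, D.indicator (fun s => eval s (pderiv k p)) s :=
        (integral_indicator (measurableSet_refSimplex _)).symm
    _ = ∫ z : ℝ × (Fin n → ℝ), D.indicator (fun s => eval s (pderiv k p)) (e.symm z) :=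
        (he.integral_comp e.symm.measurableEmbedding _).symm
    _ = ∫ s : Fin n → ℝ, ∫ t : ℝ, D.indicator (fun s => eval s (pderiv k p)) (e.symm (t, s)) := by
        rw [Measure.volume_eq_prod]
        exact integral_prod_symm _ hi2
    _ = ∫ s in refSimplex n, (eval (Fin.insertNth k (1 - ∑ i, s i) s : Fin (n + 1) → ℝ) p -
          eval (Fin.insertNth k 0 s : Fin (n + 1) → ℝ) p) := by
        simp only [hinner]
        exact integral_indicator (measurableSet_refSimplex _)
    _ = faceInt 0 p - faceInt k.succ p := by
        rw [integral_sub, setIntegral_insertNth (fun x => eval x p) k]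
        · simp only [faceInt_apply, facePt_zero, facePt_succ]
        · refine integrableOn_refSimplex ((continuous_eval p).comp ?_)
          exact continuous_insertNth k (by fun_prop) continuous_id
        · refine integrableOn_refSimplex ((continuous_eval p).comp ?_)
          exact continuous_insertNth k continuous_const continuous_id

/-- The form `∫ p q` on the reference simplex. -/
def refForm (n : ℕ) : LinearMap.BilinForm ℝ (MvPolynomial (Fin n) ℝ) :=
  (LinearMap.mul ℝ (MvPolynomial (Fin n) ℝ)).compr₂ (refInt n)

/-- The form `∫ p q` on a facet of the reference simplex. -/
def faceForm (i : Fin (n + 2)) : LinearMap.BilinForm ℝ (MvPolynomial (Fin (n + 1)) ℝ) :=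
  (LinearMap.mul ℝ (MvPolynomial (Fin (n + 1)) ℝ)).compr₂ (faceInt i)

@[simp] lemma refForm_apply (p q : MvPolynomial (Fin n) ℝ) :
    refForm n p q = refInt n (p * q) := rfl

@[simp] lemma faceForm_apply (i : Fin (n + 2)) (p q : MvPolynomial (Fin (n + 1)) ℝ) :
    faceForm i p q = faceInt i (p * q) := rfl

lemma eq_zero_of_eval_refSimplex {p : MvPolynomial (Fin n) ℝ}
    (h : ∀ s ∈ refInterior n, eval s p = 0) : p = 0 := by
  -- The open simplex contains a cube, a product of infinite sets, and this suffices to determine a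
  -- polynomial.
  refine MvPolynomial.funext_set (fun _ => Set.Ioo (0 : ℝ) (1 / (n + 1))) (fun _ => ?_)
    fun x hx => ?_
  · exact Set.Ioo_infinite (by positivity)
  · rw [map_zero]
    refine h x ⟨fun i => (hx i trivial).1, ?_⟩
    rcases Nat.eq_zero_or_pos n with rfl | hn
    · simp
    have : ∑ i, x i < ∑ i : Fin n, (1 / (n + 1) : ℝ) := by
      refine Finset.sum_lt_sum_of_nonempty ?_ fun i _ => (hx i trivial).2
      exact ⟨⟨0, hn⟩, by simp⟩
    refine this.trans ?_
    simp only [Finset.sum_const, Finset.card_univ, Fintype.card_fin, nsmul_eq_mul]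
    rw [mul_one_div, div_lt_one (by positivity)]
    linarith

lemma refForm_isInner (n : ℕ) : IsInner (refForm n) := by
  refine ⟨fun p q => by simp [mul_comm], fun p hp => ?_⟩
  have h0 : ∀ s ∈ refSimplex n, 0 ≤ eval s (p * p) := fun s _ => by
    rw [map_mul]
    exact mul_self_nonneg _
  refine lt_of_le_of_ne (setIntegral_nonneg (measurableSet_refSimplex n) h0) fun h => hp ?_
  refine eq_zero_of_eval_refSimplex fun s hs => ?_
  have := eq_zero_on_refSimplex (continuous_eval (p * p)) h0 h.symm s (refInterior_subset n hs)
  rw [map_mul] at this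
  exact mul_self_eq_zero.1 this

lemma faceForm_isSemiInner (i : Fin (n + 2)) : IsSemiInner (faceForm i) := by
  refine ⟨fun p q => by simp [mul_comm], fun p => ?_⟩
  refine setIntegral_nonneg (measurableSet_refSimplex n) fun s _ => ?_
  change 0 ≤ eval (facePt i s) (p * p)
  rw [map_mul]
  exact mul_self_nonneg _

lemma eval_facePt_eq_zero {i : Fin (n + 2)} {p : MvPolynomial (Fin (n + 1)) ℝ}
    (h : faceInt i (p * p) = 0) : ∀ s ∈ refSimplex n, eval (facePt i s) p = 0 := by
  intro s hs
  have := eq_zero_on_refSimplex ((continuous_eval (p * p)).comp (continuous_facePt i))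
    (fun s _ => by
      simp only [Function.comp_apply, map_mul]
      exact mul_self_nonneg _) h s hs
  simp only [Function.comp_apply, map_mul] at this
  exact mul_self_eq_zero.1 this

end RefIntegral

end

section

lemma IsSemiInner.comp {V W : Type*} [AddCommGroup V] [Module ℝ V] [AddCommGroup W] [Module ℝ W]
    {M : LinearMap.BilinForm ℝ V} (h : IsSemiInner M) (f : W →ₗ[ℝ] V) :
    IsSemiInner (M.compl₁₂ f f) :=
  ⟨fun _ _ => h.symm _ _, fun _ => h.nonneg _⟩

lemma IsSemiInner.add {V : Type*} [AddCommGroup V] [Module ℝ V]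
    {M N : LinearMap.BilinForm ℝ V} (h : IsSemiInner M) (h' : IsSemiInner N) :
    IsSemiInner (M + N) :=
  ⟨fun u v => by simp [h.symm u v, h'.symm u v], fun v => by
    simpa using add_nonneg (h.nonneg v) (h'.nonneg v)⟩

lemma IsSemiInner.sum {V ι : Type*} [AddCommGroup V] [Module ℝ V] [Fintype ι]
    {M : ι → LinearMap.BilinForm ℝ V} (h : ∀ i, IsSemiInner (M i)) :
    IsSemiInner (∑ i, M i) := by
  refine ⟨fun u v => ?_, fun v => ?_⟩
  · simp only [LinearMap.sum_apply]
    exact Finset.sum_congr rfl fun i _ => (h i).symm u v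
  · simp only [LinearMap.sum_apply]
    exact Finset.sum_nonneg fun i _ => (h i).nonneg v

/-! ### The weak gradient on the reference simplex -/

section RefGrad

variable {n : ℕ}

/-- A function in the interior and one function for each facet of the reference simplex. -/
abbrev LocalData (n : ℕ) :=
  MvPolynomial (Fin (n + 1)) ℝ × (Fin (n + 2) → MvPolynomial (Fin (n + 1)) ℝ)

/-- Polynomial vector fields. -/
abbrev VecPoly (n : ℕ) := Fin (n + 1) → MvPolynomial (Fin (n + 1)) ℝ

/-- The directional component of a vector field along the gradient of the `i`-th barycentric
coordinate. -/
def flux (i : Fin (n + 2)) : VecPoly n →ₗ[ℝ] MvPolynomial (Fin (n + 1)) ℝ :=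
  Fin.cases (-∑ k, LinearMap.proj k) (fun k => LinearMap.proj k) i

lemma flux_zero (q : VecPoly n) : flux 0 q = -∑ k, q k := by
  simp [flux]

lemma flux_succ (k : Fin (n + 1)) (q : VecPoly n) : flux k.succ q = q k := by
  simp [flux]

/-- The divergence as a linear map. -/
def divL (n : ℕ) : VecPoly n →ₗ[ℝ] MvPolynomial (Fin (n + 1)) ℝ :=
  ∑ k, (pderiv k).toLinearMap ∘ₗ LinearMap.proj k

lemma divL_apply (q : VecPoly n) : divL n q = divergence q := by
  simp [divL, divergence]

/-- The right hand side of the definition of the weak gradient. -/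
def refPairing (n : ℕ) : LocalData n →ₗ[ℝ] VecPoly n →ₗ[ℝ] ℝ :=
  -((refForm (n + 1)).compl₁₂ (LinearMap.fst ℝ _ _) (divL n)) -
    ∑ i, (faceForm i).compl₁₂ (LinearMap.proj i ∘ₗ LinearMap.snd ℝ _ _) (flux i)

lemma refPairing_apply (v : LocalData n) (q : VecPoly n) :
    refPairing n v q =
      -refInt (n + 1) (v.1 * divergence q) - ∑ i, faceInt i (v.2 i * flux i q) := by
  simp [refPairing, divL_apply]

/-- The minus sign appears because `flux i`, the component along the gradient of a barycentric
coordinate, points inwards. No facet areas appear because the length of that gradient compensates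
for them. -/
lemma refInt_divergence (q : VecPoly n) :
    refInt (n + 1) (divergence q) = -∑ i, faceInt i (flux i q) := by
  simp only [divergence, map_sum, refInt_pderiv, Finset.sum_sub_distrib, Fin.sum_univ_succ (n := n + 1),
    flux_zero, flux_succ, map_neg]
  ring

/-- Integration by parts applied to the field `v.1 * q`. In this form the pairing tests the gradient
of the interior part and the jumps `v.1 - v.2 i`, and its kernel can be analysed. -/
lemma refPairing_eq (v : LocalData n) (q : VecPoly n) :
    refPairing n v q = refInt (n + 1) (∑ k, pderiv k v.1 * q k) +
      ∑ i, faceInt i ((v.1 - v.2 i) * flux i q) := by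
  have h1 := refInt_divergence (fun k => v.1 * q k)
  have h2 : divergence (fun k => v.1 * q k) = ∑ k, pderiv k v.1 * q k + v.1 * divergence q := by
    simp only [divergence, pderiv_mul, Finset.sum_add_distrib, Finset.mul_sum]
  have h3 : ∀ i, flux i (fun k => v.1 * q k) = v.1 * flux i q := fun i => by
    refine Fin.cases ?_ (fun k => ?_) i
    · simp only [flux_zero, Finset.mul_sum, mul_neg]
    · simp only [flux_succ]
  simp only [h2, h3, map_add] at h1
  rw [refPairing_apply]
  simp only [sub_mul, map_sub, Finset.sum_sub_distrib]
  linarith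

/-- The `L²` inner product of vector fields on the reference simplex. -/
def vecForm (n : ℕ) : LinearMap.BilinForm ℝ (VecPoly n) :=
  ∑ k, (refForm (n + 1)).compl₁₂ (LinearMap.proj k) (LinearMap.proj k)

lemma vecForm_apply (p q : VecPoly n) : vecForm n p q = refInt (n + 1) (∑ k, p k * q k) := by
  simp [vecForm]

lemma vecForm_isInner (n : ℕ) : IsInner (vecForm n) := by
  have hs : IsSemiInner (vecForm n) :=
    IsSemiInner.sum fun k => (refForm_isInner (n + 1)).semi.comp _
  refine ⟨hs.symm, fun q hq => lt_of_le_of_ne (hs.nonneg q) fun h => hq ?_⟩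
  have h1 : ∑ k, refForm (n + 1) (q k) (q k) = 0 := by
    rw [h]
    simp [vecForm]
  rw [Finset.sum_eq_zero_iff_of_nonneg fun k _ => (refForm_isInner _).semi.nonneg _] at h1
  ext1 k
  by_contra hk
  exact ((refForm_isInner _).pos (q k) hk).ne' (h1 k (Finset.mem_univ k))

variable (P : Pair) (j : ℕ)

lemma exists_refGrad : ∃ T : LocalData n →ₗ[ℝ] P.G (n + 1) j, ∀ v q,
    vecForm n (T v) (q : P.G (n + 1) j) = refPairing n v q := by
  have h : IsInner ((vecForm n).restrict (P.G (n + 1) j)) :=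
    ⟨fun u v => (vecForm_isInner n).symm _ _, fun v hv =>
      (vecForm_isInner n).pos _ fun h => hv (Subtype.ext h)⟩
  exact h.exists_operator ((refPairing n).compl₁₂ LinearMap.id (P.G (n + 1) j).subtype)

/-- The weak gradient on the reference simplex. -/
def refGrad : LocalData n →ₗ[ℝ] P.G (n + 1) j := Classical.choose (exists_refGrad P j)

lemma refGrad_spec (v : LocalData n) {q : VecPoly n} (hq : q ∈ P.G (n + 1) j) :
    vecForm n (refGrad P j v) q = refPairing n v q :=
  Classical.choose_spec (exists_refGrad P j) v ⟨q, hq⟩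

/-- The energy of the weak gradient on the reference simplex. -/
def refEnergy : LinearMap.BilinForm ℝ (LocalData n) :=
  (vecForm n).compl₁₂ ((P.G (n + 1) j).subtype ∘ₗ refGrad P j)
    ((P.G (n + 1) j).subtype ∘ₗ refGrad P j)

lemma refEnergy_apply (u v : LocalData n) :
    refEnergy P j u v = vecForm n (refGrad P j u) (refGrad P j v) := rfl

lemma refEnergy_isSemiInner : IsSemiInner (refEnergy P j (n := n)) :=
  (vecForm_isInner n).semi.comp _

variable {P j}

lemma refGrad_eq_zero {v : LocalData n} (h : ∀ q ∈ P.G (n + 1) j, refPairing n v q = 0) :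
    refGrad P j v = 0 := by
  by_contra hne
  have h1 := refGrad_spec P j v (refGrad P j v).2
  rw [h _ (refGrad P j v).2] at h1
  exact ((vecForm_isInner n).pos _ fun h0 => hne (Subtype.ext h0)).ne' h1

lemma refPairing_eq_zero {v : LocalData n} (h : refEnergy P j v v = 0) {q : VecPoly n}
    (hq : q ∈ P.G (n + 1) j) : refPairing n v q = 0 := by
  rw [← refGrad_spec P j v hq]
  exact (vecForm_isInner n).semi.apply_eq_zero h q

lemma refGrad_const (c : ℝ) :
    refGrad P j ((C c, fun _ => C c) : LocalData n) = 0 := by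
  refine refGrad_eq_zero fun q _ => ?_
  rw [refPairing_apply]
  simp only [← smul_eq_C_mul, map_smul, smul_eq_mul, ← Finset.mul_sum]
  rw [refInt_divergence]
  ring

/-- The coordinates of the vertices of the reference simplex. -/
def refVertex (i : Fin (n + 2)) : Fin (n + 1) → ℝ := fun k => if i = k.succ then 1 else 0

lemma sum_refVertex (i : Fin (n + 2)) : ∑ k, refVertex i k = if i = 0 then 0 else 1 := by
  refine Fin.cases ?_ (fun m => ?_) i
  · simp [refVertex, (Fin.succ_ne_zero _).symm]
  · simp [refVertex, Fin.succ_ne_zero, Fin.succ_inj]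

lemma sum_facePt_zero (s : Fin n → ℝ) : ∑ k, facePt 0 s k = 1 := by
  rw [facePt_zero, sum_bary]

lemma facePt_succ_self (k : Fin (n + 1)) (s : Fin n → ℝ) : facePt k.succ s k = 0 := by
  simp [facePt_succ]

/-- Prescribed normal components on one facet, zero normal components on the others. -/
lemma exists_field_of_face (i : Fin (n + 2)) {R : MvPolynomial (Fin (n + 1)) ℝ}
    (hR : R ∈ Pol (n + 1) (P.faceDegree j)) : ∃ q ∈ P.G (n + 1) j, ∀ k s,
      eval (facePt k s) (flux k q) = if k = i then eval (facePt k s) R else 0 := by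
  -- The model is `(a_i - x) R` with `a_i` the vertex opposite to the facet `i`, which is tangential
  -- on every facet through `a_i`. On a coordinate facet the term with `X k` drops out, so `R` may
  -- be replaced by any `r` with `∑ x_k r_k = R` on the facet `0`.
  suffices h : ∃ q ∈ P.G (n + 1) j, ∃ r : VecPoly n,
      (∀ k, q k = C (refVertex i k) * R - X k * r k) ∧ ∀ s, ∑ k, facePt 0 s k *
        eval (facePt 0 s) (r k) = eval (facePt 0 s) R by
    obtain ⟨q, hq, r, hqr, hr⟩ := h
    refine ⟨q, hq, fun k s => ?_⟩
    refine Fin.cases ?_ (fun k => ?_) k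
    · simp only [flux_zero, hqr, map_neg, map_sum, map_sub, map_mul, eval_C, eval_X,
        Finset.sum_sub_distrib, hr, ← Finset.sum_mul, sum_refVertex]
      by_cases h0 : i = 0
      · simp [h0]
      · simp [h0, Ne.symm h0]
    · simp only [flux_succ, hqr, map_sub, map_mul, eval_C, eval_X, facePt_succ_self, zero_mul,
        sub_zero, refVertex]
      by_cases h0 : i = k.succ
      · simp [h0]
      · simp [h0, Ne.symm h0]
  cases P with
  | RT =>
    refine ⟨fun k => C (refVertex i k) * R - X k * R, ?_, fun _ => R, fun k => rfl, fun s => ?_⟩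
    · refine mem_G_of_eq (p := fun k => C (refVertex i k) * R) (r := -R)
        (fun k => C_mul_mem_Pol hR _) (Submodule.neg_mem _ hR) fun k => ?_
      ring
    · rw [← Finset.sum_mul, sum_facePt_zero, one_mul]
  | BDM =>
    -- Here `R` has degree `j + 1` and `x R` would be too large. Writing `R = c + ∑ x_k p_k` yields
    -- `r_k = p_k + c` of degree `j`, because `∑ x_k = 1` on the facet `0`.
    obtain ⟨c, p, hp, hRp⟩ := exists_eq_C_add_sum_X_mul hR
    refine ⟨fun k => C (refVertex i k) * R - X k * (p k + C c), ?_, fun k => p k + C c,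
      fun k => rfl, fun s => ?_⟩
    · intro k _
      exact Submodule.sub_mem _ (C_mul_mem_Pol hR _)
        (X_mul_mem_Pol (Submodule.add_mem _ (hp k) (C_mem_Pol c)) k)
    · simp only [hRp, map_add, map_sum, map_mul, eval_C, eval_X, mul_add, Finset.sum_add_distrib,
        ← Finset.sum_mul, sum_facePt_zero]
      ring

/-- A test field without normal components that controls the gradient. -/
lemma pderiv_eq_zero_of_pairing {v : LocalData n} (hv : v.1 ∈ Pol (n + 1) j)
    (h : ∀ q ∈ P.G (n + 1) j, refPairing n v q = 0) (k : Fin (n + 1)) : pderiv k v.1 = 0 := by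
  set g : VecPoly n := fun k => pderiv k v.1
  set r := ∑ k, X k * g k
  -- The test field is `q_k = x_k (∑ x_l g_l - g_k)` with `g` the gradient of `v.1`. It has no
  -- normal component on any facet, and `-g · q = ∑ x_k g_k² - (∑ x_k g_k)²` is nonnegative by
  -- Cauchy–Schwarz because `∑ x_k ≤ 1`. Each `x_k g_k` has degree at most `j`, which places `q` in
  -- `G_j` for both pairs.
  have hq : (fun k => X k * (r - g k) : VecPoly n) ∈ P.G (n + 1) j := by
    refine mem_G_of_eq (p := fun k => -(X k * g k)) (r := r) (fun k => ?_) ?_ fun k => ?_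
    · exact Submodule.neg_mem _ (X_mul_pderiv_mem_Pol hv _ _)
    · exact Submodule.sum_mem _ fun k _ => X_mul_pderiv_mem_Pol hv _ _
    · ring
  have h1 := h _ hq
  rw [refPairing_eq] at h1
  have h2 : ∀ i, faceInt i ((v.1 - v.2 i) * flux i (fun k => X k * (r - g k) : VecPoly n)) = 0 := by
    intro i
    rw [← map_zero (faceInt i)]
    refine faceInt_congr fun s _ => ?_
    rw [map_mul, map_zero]
    refine mul_eq_zero_of_right _ ?_
    refine Fin.cases ?_ (fun k => ?_) i
    · have h3 : eval (facePt 0 s) r = ∑ k, facePt 0 s k * eval (facePt 0 s) (g k) := by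
        simp [r]
      simp only [flux_zero, map_neg, map_sum, map_mul, eval_X, map_sub, mul_sub,
        Finset.sum_sub_distrib, ← Finset.sum_mul, sum_facePt_zero, h3]
      ring
    · simp [flux_succ, facePt_succ_self]
  rw [Finset.sum_eq_zero fun i _ => h2 i, add_zero] at h1
  set f : MvPolynomial (Fin (n + 1)) ℝ := -∑ k, g k * (X k * (r - g k))
  have hf : ∀ s, eval s f = ∑ k, s k * eval s (g k) ^ 2 - (∑ k, s k * eval s (g k)) ^ 2 := by
    intro s
    have h3 : eval s r = ∑ k, s k * eval s (g k) := by
      simp [r]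
    simp only [f, map_neg, map_sum, map_mul, eval_X, map_sub, h3]
    have : ∀ k, eval s (g k) * (s k * (∑ k, s k * eval s (g k) - eval s (g k))) =
        (s k * eval s (g k)) * (∑ k, s k * eval s (g k)) - s k * eval s (g k) ^ 2 := fun k => by
      ring
    simp only [this, Finset.sum_sub_distrib, ← Finset.sum_mul]
    ring
  have hcs : ∀ s ∈ refSimplex (n + 1), (∑ k, s k * eval s (g k)) ^ 2 ≤
      (∑ k, s k) * ∑ k, s k * eval s (g k) ^ 2 := by
    intro s hs
    have := Finset.sum_mul_sq_le_sq_mul_sq Finset.univ (fun k => √(s k))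
      (fun k => √(s k) * eval s (g k))
    simp only [mul_pow, ← mul_assoc, Real.mul_self_sqrt (hs.1 _), Real.sq_sqrt (hs.1 _)] at this
    exact this
  have hsq : ∀ s ∈ refSimplex (n + 1), 0 ≤ ∑ k, s k * eval s (g k) ^ 2 := fun s hs =>
    Finset.sum_nonneg fun k _ => mul_nonneg (hs.1 k) (sq_nonneg _)
  have hf0 : ∀ s ∈ refSimplex (n + 1), 0 ≤ eval s f := by
    intro s hs
    rw [hf]
    have h1 := hcs s hs
    have h2 := hsq s hs
    nlinarith [hs.2]
  have hfi : ∫ s in refSimplex (n + 1), eval s f = 0 := by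
    rw [← refInt_apply, map_neg]
    exact neg_eq_zero.2 h1
  have hz := eq_zero_on_refSimplex (continuous_eval f) hf0 hfi
  refine eq_zero_of_eval_refSimplex fun s hs => ?_
  have hs' := refInterior_subset _ hs
  have e1 := hz s hs'
  rw [hf] at e1
  have e2 := hcs s hs'
  have e3 := hsq s hs'
  -- In the interior `∑ s_k < 1` is strict, so equality forces the weighted sum of squares to
  -- vanish.
  have e4 : ∑ k, s k * eval s (g k) ^ 2 = 0 := by
    have := hs.2
    by_contra hne
    have : 0 < ∑ k, s k * eval s (g k) ^ 2 := lt_of_le_of_ne e3 (Ne.symm hne)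
    nlinarith
  rw [Finset.sum_eq_zero_iff_of_nonneg fun k _ => mul_nonneg (hs.1 k).le (sq_nonneg _)] at e4
  have e5 := e4 k (Finset.mem_univ k)
  exact pow_eq_zero_iff two_ne_zero |>.1 ((mul_eq_zero.1 e5).resolve_left (hs.1 k).ne')

/-- Unisolvence: the weak gradient vanishes only for constants. -/
lemma const_of_pairing {v : LocalData n} (hv : v.1 ∈ Pol (n + 1) j)
    (hvb : ∀ i, v.2 i ∈ Pol (n + 1) (P.faceDegree j))
    (h : ∀ q ∈ P.G (n + 1) j, refPairing n v q = 0) :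
    ∃ c, v.1 = C c ∧ ∀ i, ∀ s ∈ refSimplex n, eval (facePt i s) (v.2 i) = c := by
  have h0 := pderiv_eq_zero_of_pairing hv h
  have h1 := eq_C_of_pderiv_eq_zero h0
  refine ⟨_, h1, fun i s hs => ?_⟩
  have hl : j ≤ P.faceDegree j := by
    cases P <;> simp [Pair.faceDegree]
  -- The normal component on the facet `i` is prescribed to be the jump itself, whose degree is
  -- admissible because `j ≤ l`. The pairing then becomes the squared norm of the jump.
  obtain ⟨q, hq, hqf⟩ := exists_field_of_face (P := P) i
    (Submodule.sub_mem _ (Pol_mono hl hv) (hvb i))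
  have h2 := h q hq
  rw [refPairing_eq] at h2
  simp only [h0, zero_mul, Finset.sum_const_zero, map_zero, zero_add] at h2
  rw [Finset.sum_eq_single i] at h2
  · have h3 : faceInt i ((v.1 - v.2 i) * (v.1 - v.2 i)) = 0 := by
      rw [← h2]
      refine faceInt_congr fun s _ => ?_
      rw [map_mul, map_mul, hqf, if_pos rfl]
    have h4 := eval_facePt_eq_zero h3 s hs
    rw [map_sub, h1, eval_C] at h4
    linarith
  · intro k _ hk
    rw [← map_zero (faceInt k)]
    refine faceInt_congr fun s _ => ?_
    rw [map_mul, hqf, if_neg hk, mul_zero, map_zero]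
  · simp

/-! ### Norm equivalences on the reference simplex -/

/-- The inclusion of the local finite element space. -/
def localIncl (n j l : ℕ) :
    (Pol (n + 1) j × (Fin (n + 2) → Pol (n + 1) l)) →ₗ[ℝ] LocalData n :=
  LinearMap.prodMap (Pol (n + 1) j).subtype
    (LinearMap.pi fun i => (Pol (n + 1) l).subtype ∘ₗ LinearMap.proj i)

/-- A facet function is stored as a polynomial in all variables, of which only the restriction to
the facet counts. The forms are therefore merely semidefinite and are compared through their
kernels; the degree bounds provide the finite dimension. -/
lemma exists_bound_localData {l : ℕ} {a b : LinearMap.BilinForm ℝ (LocalData n)}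
    (ha : IsSemiInner a) (hb : IsSemiInner b)
    (hab : ∀ v : LocalData n, v.1 ∈ Pol (n + 1) j → (∀ i, v.2 i ∈ Pol (n + 1) l) →
      a v v = 0 → b v v = 0) :
    ∃ C : ℝ, 0 < C ∧ ∀ v : LocalData n, v.1 ∈ Pol (n + 1) j → (∀ i, v.2 i ∈ Pol (n + 1) l) →
      b v v ≤ C * a v v := by
  obtain ⟨C, hC, h⟩ := (ha.comp (localIncl n j l)).exists_bound (hb.comp (localIncl n j l))
    fun v hv => hab _ v.1.2 (fun i => (v.2 i).2) hv
  exact ⟨C, hC, fun v hv hvb => h (⟨v.1, hv⟩, fun i => ⟨v.2 i, hvb i⟩)⟩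

/-- The form `∑ ∫ f_i(u) f_i(v)` over the facets. -/
def faceSum (f : Fin (n + 2) → LocalData n →ₗ[ℝ] MvPolynomial (Fin (n + 1)) ℝ) :
    LinearMap.BilinForm ℝ (LocalData n) :=
  ∑ i, (faceForm i).compl₁₂ (f i) (f i)

lemma faceSum_apply (f : Fin (n + 2) → LocalData n →ₗ[ℝ] MvPolynomial (Fin (n + 1)) ℝ)
    (u v : LocalData n) : faceSum f u v = ∑ i, faceInt i (f i u * f i v) := by
  simp [faceSum]

lemma faceSum_isSemiInner (f : Fin (n + 2) → LocalData n →ₗ[ℝ] MvPolynomial (Fin (n + 1)) ℝ) :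
    IsSemiInner (faceSum f) :=
  IsSemiInner.sum fun i => (faceForm_isSemiInner i).comp _

variable (P j)

/-- Inverse inequality. -/
lemma exists_refEnergy_le (n : ℕ) : ∃ C : ℝ, 0 < C ∧ ∀ v : LocalData n, v.1 ∈ Pol (n + 1) j →
    (∀ i, v.2 i ∈ Pol (n + 1) (P.faceDegree j)) →
    refEnergy P j v v ≤ C * (refInt (n + 1) (v.1 * v.1) +
      ∑ i, faceInt i ((v.1 - v.2 i) * (v.1 - v.2 i))) := by
  let a : LinearMap.BilinForm ℝ (LocalData n) :=
    (refForm (n + 1)).compl₁₂ (LinearMap.fst ℝ _ _) (LinearMap.fst ℝ _ _) +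
      faceSum fun i => LinearMap.fst ℝ _ _ - LinearMap.proj i ∘ₗ LinearMap.snd ℝ _ _
  have ha : IsSemiInner a :=
    ((refForm_isInner (n + 1)).semi.comp _).add (faceSum_isSemiInner _)
  have haa : ∀ v, a v v = refInt (n + 1) (v.1 * v.1) +
      ∑ i, faceInt i ((v.1 - v.2 i) * (v.1 - v.2 i)) := fun v => by
    simp [a, faceSum_apply]
  have hnn : ∀ i p, 0 ≤ faceInt (n := n) i (p * p) := fun i p => (faceForm_isSemiInner i).nonneg p
  obtain ⟨C, hC, h⟩ := exists_bound_localData (l := P.faceDegree j) ha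
    (refEnergy_isSemiInner P j) (j := j) (fun v hv hvb h0 => by
      rw [haa] at h0
      have h1 : 0 ≤ refInt (n + 1) (v.1 * v.1) := (refForm_isInner (n + 1)).semi.nonneg v.1
      have h2 : 0 ≤ ∑ i, faceInt i ((v.1 - v.2 i) * (v.1 - v.2 i)) :=
        Finset.sum_nonneg fun i _ => hnn i _
      have h3 : v.1 = 0 := by
        by_contra hne
        have := (refForm_isInner (n + 1)).pos _ hne
        rw [refForm_apply] at this
        linarith
      have h4 : ∑ i, faceInt i ((v.1 - v.2 i) * (v.1 - v.2 i)) = 0 := by linarith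
      rw [Finset.sum_eq_zero_iff_of_nonneg fun i _ => hnn i _] at h4
      have h5 : refGrad P j v = 0 := by
        refine refGrad_eq_zero fun q _ => ?_
        rw [refPairing_eq, h3]
        simp only [map_zero, zero_mul, Finset.sum_const_zero, zero_add]
        refine Finset.sum_eq_zero fun i _ => ?_
        have h6 := h4 i (Finset.mem_univ i)
        rw [h3] at h6
        exact (faceForm_isSemiInner i).apply_eq_zero h6 (flux i q)
      rw [refEnergy_apply, h5]
      simp)
  exact ⟨C, hC, fun v hv hvb => haa v ▸ h v hv hvb⟩

/-- Poincaré inequality for the values on the facets. -/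
lemma exists_faceInt_sub_mean_le (n : ℕ) : ∃ C : ℝ, 0 < C ∧ ∀ v : LocalData n,
    v.1 ∈ Pol (n + 1) j → (∀ i, v.2 i ∈ Pol (n + 1) (P.faceDegree j)) →
    ∑ i, faceInt i ((v.2 i - MvPolynomial.C (refInt (n + 1) v.1 / refVol (n + 1))) *
      (v.2 i - MvPolynomial.C (refInt (n + 1) v.1 / refVol (n + 1)))) ≤ C * refEnergy P j v v := by
  let f : Fin (n + 2) → LocalData n →ₗ[ℝ] MvPolynomial (Fin (n + 1)) ℝ := fun i =>
    (LinearMap.proj i ∘ₗ LinearMap.snd ℝ _ _ : LocalData n →ₗ[ℝ] MvPolynomial (Fin (n + 1)) ℝ) -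
      (Algebra.linearMap ℝ (MvPolynomial (Fin (n + 1)) ℝ)) ∘ₗ
        ((refVol (n + 1))⁻¹ • (refInt (n + 1) ∘ₗ LinearMap.fst ℝ _ _))
  have hf : ∀ i v, f i v = v.2 i - MvPolynomial.C (refInt (n + 1) v.1 / refVol (n + 1)) :=
    fun i v => by
      simp [f, MvPolynomial.algebraMap_eq, div_eq_inv_mul]
  obtain ⟨C, hC, h⟩ := exists_bound_localData (l := P.faceDegree j) (j := j)
    (refEnergy_isSemiInner P j (n := n)) (faceSum_isSemiInner f) (fun v hv hvb h0 => by
      -- A function without energy is a constant `c`, which equals its own mean.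
      obtain ⟨c, hc, hcb⟩ := const_of_pairing hv hvb fun q hq => refPairing_eq_zero h0 hq
      rw [faceSum_apply]
      refine Finset.sum_eq_zero fun i _ => ?_
      rw [← map_zero (faceInt i)]
      refine faceInt_congr fun s hs => ?_
      rw [map_mul, hf, map_sub, hcb i s hs, hc, refInt_C, eval_C,
        mul_div_cancel_left₀ _ (refVol_pos _).ne']
      simp)
  refine ⟨C, hC, fun v hv hvb => ?_⟩
  have := h v hv hvb
  simpa only [faceSum_apply, hf] using this

/-- Poincaré inequality for functions that vanish on the facets. -/
lemma exists_refInt_le (n : ℕ) : ∃ C : ℝ, 0 < C ∧ ∀ v ∈ Pol (n + 1) j,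
    refInt (n + 1) (v * v) + ∑ i, faceInt i (v * v) ≤
      C * refEnergy P j ((v, 0) : LocalData n) (v, 0) := by
  let ι : Pol (n + 1) j →ₗ[ℝ] LocalData n := LinearMap.inl ℝ _ _ ∘ₗ (Pol (n + 1) j).subtype
  let b : LinearMap.BilinForm ℝ (LocalData n) :=
    (refForm (n + 1)).compl₁₂ (LinearMap.fst ℝ _ _) (LinearMap.fst ℝ _ _) +
      faceSum fun i => LinearMap.fst ℝ _ _
  have hb : IsSemiInner b :=
    ((refForm_isInner (n + 1)).semi.comp _).add (faceSum_isSemiInner _)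
  have hbb : ∀ v, b v v = refInt (n + 1) (v.1 * v.1) + ∑ i, faceInt i (v.1 * v.1) := fun v => by
    simp [b, faceSum_apply]
  obtain ⟨C, hC, h⟩ := ((refEnergy_isSemiInner P j (n := n)).comp ι).exists_bound (hb.comp ι)
    (fun v hv => by
      -- Without energy the function is constant, and its zero facet values make the constant zero.
      obtain ⟨c, hc, hcb⟩ := const_of_pairing (P := P) (v := ι v) v.2
        (fun i => Submodule.zero_mem _) fun q hq => refPairing_eq_zero hv hq
      obtain ⟨s, hs⟩ := refInterior_nonempty n
      have h1 := hcb 0 s (refInterior_subset n hs)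
      have h2 : c = 0 := by
        rw [← h1]
        simp [ι]
      have h3 : ι v = 0 := by
        refine Prod.ext ?_ rfl
        rw [hc, h2]
        simp
      simp only [LinearMap.compl₁₂_apply, h3]
      simp)
  refine ⟨C, hC, fun v hv => ?_⟩
  have := h ⟨v, hv⟩
  simp only [LinearMap.compl₁₂_apply, hbb] at this
  exact this

end RefGrad

end

section

/-! ### Transformation from the reference simplex -/

section Transform

variable {n : ℕ} {y : Fin (n + 2) → E (n + 1)}

/-- The matrix of the linear part of `chart y`. -/
def chartMat (y : Fin (n + 2) → E (n + 1)) : Matrix (Fin (n + 1)) (Fin (n + 1)) ℝ :=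
  fun k l => (y l.succ - y 0) k

/-- An outward unit normal. -/
def outNormal (y : Fin (n + 2) → E (n + 1)) (i : Fin (n + 2)) : E (n + 1) :=
  Classical.choose (exists_isNormal y i)

lemma outNormal_spec (y : Fin (n + 2) → E (n + 1)) (i : Fin (n + 2)) :
    IsNormal y i (outNormal y i) := Classical.choose_spec (exists_isNormal y i)

/-- The inverse of `chartMat y`. -/
def chartInv (y : Fin (n + 2) → E (n + 1)) : Matrix (Fin (n + 1)) (Fin (n + 1)) ℝ :=
  fun l k => -(jac (facet y l.succ) / jac y) * outNormal y l.succ k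

/-- The rows of `chartInv` are the gradients of the barycentric coordinates, written through outward
normals and Jacobians. The product is the identity by `IsNormal.jac_mul_inner`, and the norms of the
rows are inverse heights, which an inscribed ball controls. -/
lemma chartInv_mul (hy : AffineIndependent ℝ y) : chartInv y * chartMat y = 1 := by
  ext l k
  have h1 := (outNormal_spec y l.succ).jac_mul_inner hy k.succ 0
  have h2 : inner ℝ (outNormal y l.succ) (y k.succ - y 0) =
      ∑ i, outNormal y l.succ i * (y k.succ - y 0) i := by
    rw [PiLp.inner_apply]
    refine Finset.sum_congr rfl fun i _ => ?_
    simp [mul_comm]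
  rw [Matrix.mul_apply]
  simp only [chartInv, chartMat, mul_assoc, ← Finset.mul_sum]
  rw [← h2]
  have hj := (jac_pos hy).ne'
  have h3 : -(jac (facet y l.succ) / jac y) * inner ℝ (outNormal y l.succ) (y k.succ - y 0) =
      -(jac (facet y l.succ) * inner ℝ (outNormal y l.succ) (y k.succ - y 0)) / jac y := by ring
  rw [h3, h1]
  rw [if_neg (Fin.succ_ne_zero l).symm, Matrix.one_apply]
  by_cases h : l = k
  · simp [h, hj]
  · have : ¬ k.succ = l.succ := fun h' => h (Fin.succ_injective _ h').symm
    simp [h, this]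

lemma mul_chartInv (hy : AffineIndependent ℝ y) : chartMat y * chartInv y = 1 :=
  mul_eq_one_comm.1 (chartInv_mul hy)

lemma chart_ofLp (y : Fin (n + 2) → E (n + 1)) (s : Fin (n + 1) → ℝ) :
    (chart y s).ofLp = (y 0).ofLp + chartMat y *ᵥ s := by
  rw [chart_eq]
  ext k
  simp [chartLin, chartMat, Matrix.mulVec, dotProduct, mul_comm]

/-- Pull back of polynomials to the reference simplex. -/
abbrev pull (y : Fin (n + 2) → E (n + 1)) :
    MvPolynomial (Fin (n + 1)) ℝ →ₐ[ℝ] MvPolynomial (Fin (n + 1)) ℝ :=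
  affComp (chartMat y) (y 0).ofLp

lemma eval_pull (s : Fin (n + 1) → ℝ) (p : MvPolynomial (Fin (n + 1)) ℝ) :
    eval s (pull y p) = pval p (chart y s) := by
  rw [eval_affComp, pval, chart_ofLp]

/-- Pull back of vector fields to the reference simplex. -/
abbrev pullVec (y : Fin (n + 2) → E (n + 1)) (q : VecPoly n) : VecPoly n :=
  piola (chartInv y) (chartMat y) (y 0).ofLp q

/-- Push forward of vector fields from the reference simplex. -/
abbrev pushVec (y : Fin (n + 2) → E (n + 1)) (q : VecPoly n) : VecPoly n :=
  piola (chartMat y) (chartInv y) (-(chartInv y *ᵥ (y 0).ofLp)) q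

lemma sum_mul_pullVec (hy : AffineIndependent ℝ y) (q : VecPoly n) (k : Fin (n + 1)) :
    ∑ l, C (chartMat y k l) * pullVec y q l = pull y (q k) := by
  simp only [piola, Finset.mul_sum, ← mul_assoc, ← map_mul]
  rw [Finset.sum_comm]
  simp only [← Finset.sum_mul, ← map_sum, ← Matrix.mul_apply, mul_chartInv hy, Matrix.one_apply]
  rw [Finset.sum_eq_single k]
  · simp
  · intro l _ hl
    simp [hl.symm]
  · simp

lemma pull_affComp_inv (hy : AffineIndependent ℝ y) (p : MvPolynomial (Fin (n + 1)) ℝ) :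
    pull y (affComp (chartInv y) (-(chartInv y *ᵥ (y 0).ofLp)) p) = p := by
  refine MvPolynomial.funext fun s => ?_
  rw [eval_affComp, eval_affComp]
  congr 2
  rw [Matrix.mulVec_add, Matrix.mulVec_mulVec, chartInv_mul hy, Matrix.one_mulVec]
  abel

lemma pull_pushVec (hy : AffineIndependent ℝ y) (q : VecPoly n) (k : Fin (n + 1)) :
    pull y (pushVec y q k) = ∑ l, C (chartMat y k l) * q l := by
  simp only [piola, map_sum, map_mul]
  refine Finset.sum_congr rfl fun l _ => ?_
  rw [pull_affComp_inv hy]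
  simp [affComp]

lemma pullVec_pushVec (hy : AffineIndependent ℝ y) (q : VecPoly n) :
    pullVec y (pushVec y q) = q := by
  ext1 i
  change ∑ l, C (chartInv y i l) * pull y (pushVec y q l) = _
  simp only [pull_pushVec hy, Finset.mul_sum, ← mul_assoc, ← map_mul]
  rw [Finset.sum_comm]
  simp only [← Finset.sum_mul, ← map_sum, ← Matrix.mul_apply, chartInv_mul hy, Matrix.one_apply]
  rw [Finset.sum_eq_single i]
  · simp
  · intro l _ hl
    simp [hl.symm]
  · simp

lemma pull_injective (hy : AffineIndependent ℝ y) : Function.Injective (pull y) := by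
  rw [injective_iff_map_eq_zero]
  intro p hp
  refine MvPolynomial.funext fun x => ?_
  have h1 : x = (y 0).ofLp + chartMat y *ᵥ (chartInv y *ᵥ (x - (y 0).ofLp)) := by
    rw [Matrix.mulVec_mulVec, mul_chartInv hy, Matrix.one_mulVec]
    abel
  rw [h1, ← eval_affComp, hp]
  simp

/-- The form `∫ p · q` over the simplex, up to the Jacobian. -/
def elemForm (y : Fin (n + 2) → E (n + 1)) : LinearMap.BilinForm ℝ (VecPoly n) :=
  (vecForm n).compl₁₂ (LinearMap.pi fun k => (pull y).toLinearMap ∘ₗ LinearMap.proj k)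
    (LinearMap.pi fun k => (pull y).toLinearMap ∘ₗ LinearMap.proj k)

lemma elemForm_apply (p q : VecPoly n) :
    elemForm y p q = vecForm n (fun k => pull y (p k)) (fun k => pull y (q k)) := rfl

lemma elemForm_isInner (hy : AffineIndependent ℝ y) : IsInner (elemForm y) := by
  refine ⟨fun u v => (vecForm_isInner n).symm _ _, fun q hq => ?_⟩
  rw [elemForm_apply]
  refine (vecForm_isInner n).pos _ fun h => hq ?_
  ext1 k
  exact pull_injective hy ((congrFun h k).trans (map_zero _).symm)

lemma exists_elemGrad (hy : AffineIndependent ℝ y) (P : Pair) (j : ℕ) :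
    ∃ T : LocalData n →ₗ[ℝ] P.G (n + 1) j, ∀ v, ∀ q ∈ P.G (n + 1) j,
      elemForm y (T v) q = refPairing n v (pullVec y q) := by
  have h : IsInner ((elemForm y).restrict (P.G (n + 1) j)) :=
    ⟨fun u v => (elemForm_isInner hy).symm _ _, fun v hv =>
      (elemForm_isInner hy).pos _ fun h => hv (Subtype.ext h)⟩
  let f : P.G (n + 1) j →ₗ[ℝ] VecPoly n := LinearMap.pi fun i =>
    ∑ l, chartInv y i l • ((pull y).toLinearMap ∘ₗ LinearMap.proj l ∘ₗ (P.G (n + 1) j).subtype)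
  have hf : ∀ q, f q = pullVec y q := fun q => by
    ext1 i
    simp [f, piola, smul_eq_C_mul]
  obtain ⟨T, hT⟩ := h.exists_operator ((refPairing n).compl₁₂ LinearMap.id f)
  refine ⟨T, fun v q hq => ?_⟩
  have := hT v ⟨q, hq⟩
  simp only [LinearMap.compl₁₂_apply, LinearMap.id_apply, hf] at this
  exact this

lemma refInt_mono {p q : MvPolynomial (Fin n) ℝ} (h : ∀ s, eval s p ≤ eval s q) :
    refInt n p ≤ refInt n q :=
  setIntegral_mono (integrableOn_refSimplex (continuous_eval p))
    (integrableOn_refSimplex (continuous_eval q)) h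

lemma vecForm_mul_le (A : Matrix (Fin (n + 1)) (Fin (n + 1)) ℝ) (q : VecPoly n) :
    vecForm n (fun k => ∑ l, C (A k l) * q l) (fun k => ∑ l, C (A k l) * q l) ≤
      (∑ k, ∑ l, A k l ^ 2) * vecForm n q q := by
  rw [vecForm_apply, vecForm_apply, ← smul_eq_mul, ← map_smul]
  refine refInt_mono fun s => ?_
  simp only [map_sum, map_mul, eval_C, smul_eval, ← sq, map_pow]
  rw [Finset.sum_mul]
  refine Finset.sum_le_sum fun k _ => ?_
  exact Finset.sum_mul_sq_le_sq_mul_sq _ _ _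

lemma le_of_sq_le_mul {a b : ℝ} (ha : 0 ≤ a) (h : a ^ 2 ≤ b * a) (hb : 0 ≤ b) : a ≤ b := by
  rcases ha.eq_or_lt with h0 | h0
  · rwa [← h0]
  · rw [sq] at h
    exact le_of_mul_le_mul_right h h0

variable {P : Pair} {j : ℕ}

/-- Both `g` and the reference weak gradient represent the functional of `v`, in two different inner
products. Testing `g` with the push-forward of the reference weak gradient gives the reference
energy, and Cauchy–Schwarz costs the squared norm of the matrix of the chart. -/
lemma refEnergy_le_elemForm (hy : AffineIndependent ℝ y) {v : LocalData n} {g : VecPoly n}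
    (h : ∀ q ∈ P.G (n + 1) j, elemForm y g q = refPairing n v (pullVec y q)) :
    refEnergy P j v v ≤ (∑ k, ∑ l, chartMat y k l ^ 2) * elemForm y g g := by
  let R : VecPoly n := (refGrad P j v).1
  have hq : pushVec y R ∈ P.G (n + 1) j := piola_mem_G (mul_chartInv hy) _ (refGrad P j v).2
  have h1 : refEnergy P j v v = elemForm y g (pushVec y R) := by
    rw [h _ hq, pullVec_pushVec hy, refEnergy_apply, refGrad_spec P j v (refGrad P j v).2]
  have h2 := (elemForm_isInner hy).semi.cauchy g (pushVec y R)
  have h3 : elemForm y (pushVec y R) (pushVec y R) ≤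
      (∑ k, ∑ l, chartMat y k l ^ 2) * refEnergy P j v v := by
    rw [elemForm_apply]
    simp only [pull_pushVec hy]
    exact vecForm_mul_le _ _
  have h4 := (elemForm_isInner hy).semi.nonneg g
  refine le_of_sq_le_mul ((refEnergy_isSemiInner P j).nonneg v) ?_
    (mul_nonneg (Finset.sum_nonneg fun _ _ => Finset.sum_nonneg fun _ _ => sq_nonneg _) h4)
  rw [← h1] at h2
  calc _ ≤ elemForm y g g * elemForm y (pushVec y R) (pushVec y R) := h2
    _ ≤ elemForm y g g * ((∑ k, ∑ l, chartMat y k l ^ 2) * refEnergy P j v v) := by gcongr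
    _ = _ := by ring

/-- The same argument in the other direction, with the pull-back of `g` as the test field and the
inverse matrix. -/
lemma elemForm_le_refEnergy (hy : AffineIndependent ℝ y) {v : LocalData n} {g : VecPoly n}
    (hg : g ∈ P.G (n + 1) j)
    (h : ∀ q ∈ P.G (n + 1) j, elemForm y g q = refPairing n v (pullVec y q)) :
    elemForm y g g ≤ (∑ k, ∑ l, chartInv y k l ^ 2) * refEnergy P j v v := by
  have hq : pullVec y g ∈ P.G (n + 1) j := piola_mem_G (chartInv_mul hy) _ hg
  have h1 : elemForm y g g = vecForm n (refGrad P j v) (pullVec y g) := by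
    rw [h _ hg, refGrad_spec P j v hq]
  have h2 := (vecForm_isInner n).semi.cauchy (refGrad P j v) (pullVec y g)
  have h3 : vecForm n (pullVec y g) (pullVec y g) ≤
      (∑ k, ∑ l, chartInv y k l ^ 2) * elemForm y g g := vecForm_mul_le _ _
  have h4 := (refEnergy_isSemiInner P j).nonneg v
  have h5 := (elemForm_isInner hy).semi.nonneg g
  refine le_of_sq_le_mul h5 ?_
    (mul_nonneg (Finset.sum_nonneg fun _ _ => Finset.sum_nonneg fun _ _ => sq_nonneg _) h4)
  rw [← h1, ← refEnergy_apply] at h2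
  calc _ ≤ refEnergy P j v v * vecForm n (pullVec y g) (pullVec y g) := h2
    _ ≤ refEnergy P j v v * ((∑ k, ∑ l, chartInv y k l ^ 2) * elemForm y g g) := by gcongr
    _ = _ := by ring

/-! ### Size of the transformation -/

lemma dist_le_diam (i k : Fin (n + 2)) :
    ‖y i - y k‖ ≤ Metric.diam (convexHull ℝ (Set.range y)) := by
  rw [← dist_eq_norm]
  exact Metric.dist_le_diam_of_mem (isCompact_convexHull_range y).isBounded
    (subset_convexHull ℝ _ ⟨i, rfl⟩) (subset_convexHull ℝ _ ⟨k, rfl⟩)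

lemma norm_sq_eq_sum (x : E n) : ‖x‖ ^ 2 = ∑ k, x k ^ 2 := by
  rw [EuclideanSpace.norm_sq_eq]
  simp

lemma sum_chartMat_sq_le {h : ℝ} (hh : Metric.diam (convexHull ℝ (Set.range y)) ≤ h) :
    ∑ k, ∑ l, chartMat y k l ^ 2 ≤ (n + 1) * h ^ 2 := by
  rw [Finset.sum_comm]
  have : ∀ l : Fin (n + 1), ∑ k, chartMat y k l ^ 2 ≤ h ^ 2 := fun l => by
    have h1 := norm_sq_eq_sum (y l.succ - y 0)
    have h2 := (dist_le_diam (y := y) l.succ 0).trans hh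
    simp only [chartMat]
    rw [← h1]
    gcongr
  calc _ ≤ ∑ l : Fin (n + 1), h ^ 2 := Finset.sum_le_sum fun l _ => this l
    _ = _ := by simp

lemma jac_le_mul_jac_facet (hy : AffineIndependent ℝ y) {h : ℝ}
    (hh : Metric.diam (convexHull ℝ (Set.range y)) ≤ h) (i : Fin (n + 2)) :
    jac y ≤ h * jac (facet y i) := by
  have hu := outNormal_spec y i
  rw [← jac_facet_mul_abs_inner hy i hu.norm hu.orth (Fin.succAbove_ne i 0), mul_comm]
  refine mul_le_mul_of_nonneg_right ?_ (jac_pos (facet_affineIndependent hy i)).le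
  refine (abs_real_inner_le_norm _ _).trans ?_
  rw [hu.norm, one_mul]
  exact (dist_le_diam _ _).trans hh

/-- The simplex lies in the slab between the facet and its parallel through the opposite vertex. The
slab contains `c` and `c + t u` for all `0 ≤ t < r`, so its height is at least `r`. -/
lemma mul_jac_facet_le (hy : AffineIndependent ℝ y) {r : ℝ} {c : E (n + 1)} (hr : 0 < r)
    (hc : Metric.ball c r ⊆ convexHull ℝ (Set.range y)) (i : Fin (n + 2)) :
    r * jac (facet y i) ≤ jac y := by
  have hu := outNormal_spec y i
  set u := outNormal y i
  set l := i.succAbove 0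
  have hl : l ≠ i := Fin.succAbove_ne i 0
  rw [← jac_facet_mul_abs_inner hy i hu.norm hu.orth hl, mul_comm]
  refine mul_le_mul_of_nonneg_left ?_ (jac_pos (facet_affineIndependent hy i)).le
  have hlin : ∀ a : ℝ, Convex ℝ {x : E (n + 1) | inner ℝ u x ≤ a} := fun a =>
    convex_halfSpace_le (LinearMap.isLinear (innerₛₗ ℝ u)) a
  have hlin' : ∀ a : ℝ, Convex ℝ {x : E (n + 1) | a ≤ inner ℝ u x} := fun a =>
    convex_halfSpace_ge (LinearMap.isLinear (innerₛₗ ℝ u)) a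
  have h1 : convexHull ℝ (Set.range y) ⊆ {x | inner ℝ u x ≤ inner ℝ u (y l)} := by
    refine convexHull_min ?_ (hlin _)
    rintro _ ⟨k, rfl⟩
    have := hu.le k l hl
    rw [inner_sub_right] at this
    exact sub_nonpos.1 this
  have h2 : convexHull ℝ (Set.range y) ⊆ {x | inner ℝ u (y i) ≤ inner ℝ u x} := by
    refine convexHull_min ?_ (hlin' _)
    rintro _ ⟨k, rfl⟩
    by_cases hk : k = i
    · simp [hk]
    · have := hu.le i k hk
      rw [inner_sub_right] at this
      exact sub_nonpos.1 this
  have h3 : inner ℝ u (y i) ≤ inner ℝ u c := h2 (hc (Metric.mem_ball_self hr))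
  have huu : inner ℝ u u = (1 : ℝ) := by
    rw [real_inner_self_eq_norm_sq, hu.norm]
    norm_num
  refine le_of_forall_lt fun t ht => ?_
  by_cases ht0 : t < 0
  · exact ht0.trans_le (abs_nonneg _)
  push Not at ht0
  obtain ⟨t', ht1, ht2⟩ := exists_between ht
  have h4 : c + t' • u ∈ Metric.ball c r := by
    rw [Metric.mem_ball, dist_eq_norm, add_sub_cancel_left, norm_smul, hu.norm, mul_one,
      Real.norm_eq_abs, abs_of_nonneg (by linarith)]
    exact ht2
  have h5 : inner ℝ u (c + t' • u) ≤ inner ℝ u (y l) := h1 (hc h4)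
  rw [inner_add_right, real_inner_smul_right, huu] at h5
  rw [inner_sub_right, abs_sub_comm]
  refine lt_of_lt_of_le ?_ (le_abs_self _)
  linarith

lemma sum_chartInv_sq_le (hy : AffineIndependent ℝ y) {r : ℝ} {c : E (n + 1)} (hr : 0 < r)
    (hc : Metric.ball c r ⊆ convexHull ℝ (Set.range y)) :
    ∑ k, ∑ l, chartInv y k l ^ 2 ≤ (n + 1) / r ^ 2 := by
  have : ∀ k : Fin (n + 1), ∑ l, chartInv y k l ^ 2 ≤ 1 / r ^ 2 := fun k => by
    simp only [chartInv, mul_pow, ← Finset.mul_sum, neg_sq]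
    have h2 := norm_sq_eq_sum (outNormal y k.succ)
    rw [(outNormal_spec y k.succ).norm] at h2
    rw [← h2, one_pow, mul_one, ← one_div_pow]
    have hj := jac_pos hy
    have hjf := jac_pos (facet_affineIndependent hy k.succ)
    have h3 : jac (facet y k.succ) / jac y ≤ 1 / r := by
      rw [div_le_div_iff₀ hj hr, one_mul, mul_comm]
      exact mul_jac_facet_le hy hr hc _
    gcongr
  calc _ ≤ ∑ k : Fin (n + 1), 1 / r ^ 2 := Finset.sum_le_sum fun l _ => this l
    _ = _ := by
      simp only [Finset.sum_const, Finset.card_univ, Fintype.card_fin, nsmul_eq_mul]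
      push_cast
      ring

end Transform

end

section

/-! ### Elements of a mesh -/

namespace Mesh

variable {n : ℕ} {Ω : Set (E (n + 1))} (T : Mesh (n + 1) Ω)

lemma mem_elements {K : Finset (E (n + 1))} :
    K ∈ T.elements ↔ K ∈ T.faces ∧ K.card = n + 2 := by
  simp [elements]

lemma mem_sides {e : Finset (E (n + 1))} :
    e ∈ T.sides ↔ e ∈ T.faces ∧ e.card = n + 1 := by
  simp [sides]

lemma element_mem (K : T.elements) : K.1 ∈ T.faces := (T.mem_elements.1 K.2).1

lemma side_mem (e : T.sides) : e.1 ∈ T.faces := (T.mem_sides.1 e.2).1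

/-- The vertices of an element, in some order. -/
def vert (K : T.elements) (i : Fin (n + 2)) : E (n + 1) :=
  ((K.1.equivFinOfCardEq (T.mem_elements.1 K.2).2).symm i).1

lemma range_vert (K : T.elements) : Set.range (T.vert K) = K.1 := by
  ext x
  constructor
  · rintro ⟨i, rfl⟩
    exact ((K.1.equivFinOfCardEq (T.mem_elements.1 K.2).2).symm i).2
  · intro hx
    exact ⟨K.1.equivFinOfCardEq (T.mem_elements.1 K.2).2 ⟨x, hx⟩, by simp [vert]⟩

lemma vert_mem (K : T.elements) (i : Fin (n + 2)) : T.vert K i ∈ K.1 :=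
  ((K.1.equivFinOfCardEq (T.mem_elements.1 K.2).2).symm i).2

lemma vert_affineIndependent (K : T.elements) : AffineIndependent ℝ (T.vert K) :=
  (T.indep (T.element_mem K)).comp_embedding
    (K.1.equivFinOfCardEq (T.mem_elements.1 K.2).2).symm.toEmbedding

lemma vert_injective (K : T.elements) : Function.Injective (T.vert K) :=
  (T.vert_affineIndependent K).injective

lemma hull_eq (K : T.elements) : hull K.1 = convexHull ℝ (Set.range (T.vert K)) := by
  rw [range_vert]

open Classical in
/-- The edge/face of `K` opposite to the `i`-th vertex. -/
def side (K : T.elements) (i : Fin (n + 2)) : T.sides :=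
  ⟨K.1.erase (T.vert K i), by
    have hc : (K.1.erase (T.vert K i)).card = n + 1 := by
      rw [Finset.card_erase_of_mem (T.vert_mem K i), (T.mem_elements.1 K.2).2]
      rfl
    refine T.mem_sides.2 ⟨T.down_closed (T.element_mem K) (Finset.erase_subset _ _) ?_, hc⟩
    rw [← Finset.card_pos, hc]
    omega⟩

lemma coe_side (K : T.elements) (i : Fin (n + 2)) :
    ((T.side K i).1 : Set (E (n + 1))) = Set.range (facet (T.vert K) i) := by
  classical
  ext x
  simp only [side, Finset.coe_erase, Set.mem_sdiff, ← range_vert, Set.mem_range, Set.mem_singleton_iff,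
    Function.comp_apply]
  constructor
  · rintro ⟨⟨k, rfl⟩, hk⟩
    obtain ⟨m, rfl⟩ := Fin.exists_succAbove_eq (show k ≠ i from fun h => hk (h ▸ rfl))
    exact ⟨m, rfl⟩
  · rintro ⟨m, rfl⟩
    exact ⟨⟨_, rfl⟩, fun h => Fin.succAbove_ne i m (T.vert_injective K h)⟩

lemma hull_side_eq (K : T.elements) (i : Fin (n + 2)) :
    hull (T.side K i).1 = convexHull ℝ (Set.range (facet (T.vert K) i)) := by
  rw [hull, coe_side]

lemma exists_side_eq {K : T.elements} {e : T.sides} (h : e.1 ⊆ K.1) : ∃ i, T.side K i = e := by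
  classical
  have hc : (K.1 \ e.1).card = 1 := by
    rw [Finset.card_sdiff_of_subset h, (T.mem_elements.1 K.2).2, (T.mem_sides.1 e.2).2]
    omega
  obtain ⟨x, hx⟩ := Finset.card_eq_one.1 hc
  have hxK : x ∈ K.1 \ e.1 := hx ▸ Finset.mem_singleton_self x
  obtain ⟨i, hi⟩ : x ∈ Set.range (T.vert K) := by
    rw [range_vert]
    exact (Finset.mem_sdiff.1 hxK).1
  refine ⟨i, Subtype.ext ?_⟩
  simp only [side, hi]
  rw [← Finset.sdiff_singleton_eq_erase, ← hx, Finset.sdiff_sdiff_eq_self h]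

lemma side_subset (K : T.elements) (i : Fin (n + 2)) : (T.side K i).1 ⊆ K.1 := by
  classical
  exact Finset.erase_subset _ _

lemma side_injective (K : T.elements) : Function.Injective (T.side K) := by
  classical
  intro i k h
  have h1 : K.1.erase (T.vert K i) = K.1.erase (T.vert K k) := congrArg Subtype.val h
  by_contra hne
  have h2 : T.vert K i ∈ K.1.erase (T.vert K k) :=
    Finset.mem_erase.2 ⟨fun h => hne (T.vert_injective K h), T.vert_mem K i⟩
  rw [← h1] at h2
  exact Finset.notMem_erase _ _ h2

lemma sum_sidesOf {M : Type*} [AddCommMonoid M] (K : T.elements) (f : T.sides → M) :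
    ∑ e ∈ T.sidesOf K, f e = ∑ i, f (T.side K i) := by
  classical
  have h : T.sidesOf K = Finset.univ.image (T.side K) := by
    ext e
    simp only [sidesOf, Finset.mem_filter, Finset.mem_univ, true_and, Finset.mem_image]
    constructor
    · exact fun h => T.exists_side_eq h
    · rintro ⟨i, rfl⟩
      exact T.side_subset K i
  rw [h, Finset.sum_image fun _ _ _ _ h => T.side_injective K h]

/-- The Jacobian of an element. -/
abbrev jacE (K : T.elements) : ℝ := jac (T.vert K)

/-- The Jacobian of an edge/face of an element. -/
abbrev jacF (K : T.elements) (i : Fin (n + 2)) : ℝ := jac (facet (T.vert K) i)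

lemma jacE_pos (K : T.elements) : 0 < T.jacE K := jac_pos (T.vert_affineIndependent K)

lemma jacF_pos (K : T.elements) (i : Fin (n + 2)) : 0 < T.jacF K i :=
  jac_pos (facet_affineIndependent (T.vert_affineIndependent K) i)

lemma setIntegral_element (K : T.elements) (f : E (n + 1) → ℝ) :
    ∫ x in hull K.1, f x = T.jacE K * ∫ s in refSimplex (n + 1), f (chart (T.vert K) s) := by
  rw [hull_eq, ← setIntegral_hull (T.vert_affineIndependent K),
    EuclideanSpace.euclideanHausdorffMeasure_eq_volume]

/-- `n + 1 - 1` is the `d - 1` of the definitions at `d = n + 1`. The facet is parametrized by the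
chart of the element on `facePt i`, so interior and facet data of an element live on one reference
simplex. -/
lemma setIntegral_side (K : T.elements) (i : Fin (n + 2)) (f : E (n + 1) → ℝ) :
    ∫ x in hull (T.side K i).1, f x ∂μHE[n + 1 - 1] =
      T.jacF K i * ∫ s in refSimplex n, f (chart (T.vert K) (facePt i s)) := by
  rw [hull_side_eq]
  simp only [chart_facePt]
  exact setIntegral_hull (facet_affineIndependent (T.vert_affineIndependent K) i) f

lemma chart_mem_hull (K : T.elements) {s : Fin (n + 1) → ℝ} (hs : s ∈ refSimplex (n + 1)) :
    chart (T.vert K) s ∈ hull K.1 := by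
  rw [hull_eq, convexHull_range_eq]
  exact ⟨s, hs, rfl⟩

lemma chart_mem_hull_side (K : T.elements) (i : Fin (n + 2)) {s : Fin n → ℝ}
    (hs : s ∈ refSimplex n) : chart (T.vert K) (facePt i s) ∈ hull (T.side K i).1 := by
  rw [hull_side_eq, convexHull_range_eq, chart_facePt]
  exact ⟨s, hs, rfl⟩

lemma exists_chart_eq {K : T.elements} {x : E (n + 1)} (hx : x ∈ hull K.1) :
    ∃ s ∈ refSimplex (n + 1), chart (T.vert K) s = x := by
  rw [hull_eq, convexHull_range_eq] at hx
  exact hx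

lemma exists_chart_facePt_eq {K : T.elements} {i : Fin (n + 2)} {x : E (n + 1)}
    (hx : x ∈ hull (T.side K i).1) : ∃ s ∈ refSimplex n, chart (T.vert K) (facePt i s) = x := by
  rw [hull_side_eq, convexHull_range_eq] at hx
  obtain ⟨s, hs, h⟩ := hx
  exact ⟨s, hs, by rw [chart_facePt, h]⟩

/-- `normal` is an `epsilon` choice; the existence of an outward normal makes its defining
properties available, and no others are used. -/
lemma normal_isNormal (K : T.elements) (i : Fin (n + 2)) :
    IsNormal (T.vert K) i (normal K.1 (T.side K i).1) := by
  have hmem : ∀ x, x ∈ (T.side K i).1 ↔ ∃ k, k ≠ i ∧ T.vert K k = x := fun x => by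
    rw [← Finset.mem_coe, coe_side]
    constructor
    · rintro ⟨m, rfl⟩
      exact ⟨_, Fin.succAbove_ne i m, rfl⟩
    · rintro ⟨k, hk, rfl⟩
      obtain ⟨m, rfl⟩ := Fin.exists_succAbove_eq hk
      exact ⟨m, rfl⟩
  have hmemK : ∀ x, x ∈ K.1 ↔ ∃ k, T.vert K k = x := fun x => by
    rw [← Finset.mem_coe, ← range_vert, Set.mem_range]
  have hex : ∃ u : E (n + 1), ‖u‖ = 1 ∧ ∀ x ∈ (T.side K i).1,
      (∀ y ∈ (T.side K i).1, inner ℝ u (y - x) = 0) ∧ ∀ y ∈ K.1, inner ℝ u (y - x) ≤ 0 := by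
    obtain ⟨u, hu⟩ := exists_isNormal (T.vert K) i
    refine ⟨u, hu.norm, fun x hx => ?_⟩
    obtain ⟨k, hk, rfl⟩ := (hmem x).1 hx
    refine ⟨fun z hz => ?_, fun z hz => ?_⟩
    · obtain ⟨l, hl, rfl⟩ := (hmem z).1 hz
      exact hu.orth l k hl hk
    · obtain ⟨l, rfl⟩ := (hmemK z).1 hz
      exact hu.le l k hk
  have h := Classical.epsilon_spec hex
  refine ⟨h.1, fun k l hk hl => ?_, fun k l hl => ?_⟩
  · exact (h.2 _ ((hmem _).2 ⟨l, hl, rfl⟩)).1 _ ((hmem _).2 ⟨k, hk, rfl⟩)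
  · exact (h.2 _ ((hmem _).2 ⟨l, hl, rfl⟩)).2 _ ((hmemK _).2 ⟨k, rfl⟩)

/-- The data `p` on the reference simplex represent the weak function `v` on the element `K`. -/
structure LocalRep (P : Pair) (j : ℕ) (v : T.Weak) (K : T.elements) (p : LocalData n) : Prop where
  interior_eq : ∀ s ∈ refSimplex (n + 1), v.1 K (chart (T.vert K) s) = eval s p.1
  face_eq : ∀ i, ∀ s ∈ refSimplex n,
    v.2 (T.side K i) (chart (T.vert K) (facePt i s)) = eval (facePt i s) (p.2 i)
  deg_inner : p.1 ∈ Pol (n + 1) j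
  deg_face : ∀ i, p.2 i ∈ Pol (n + 1) (P.faceDegree j)

variable {T} {P : Pair} {j : ℕ} {K : T.elements}

lemma exists_localRep {v : T.Weak} (hv : v ∈ T.Vh P j) (K : T.elements) :
    ∃ p, T.LocalRep P j v K p := by
  obtain ⟨p0, hp0, h0⟩ := hv.1 K
  have hb := fun i => hv.2.1 (T.side K i)
  choose pb hpb h using hb
  refine ⟨(pull (T.vert K) p0, fun i => pull (T.vert K) (pb i)), fun s hs => ?_, fun i s hs => ?_,
    affComp_mem_Pol _ _ hp0, fun i => affComp_mem_Pol _ _ (hpb i)⟩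
  · rw [h0, Set.indicator_of_mem (T.chart_mem_hull K hs), eval_pull]
  · rw [h, Set.indicator_of_mem (T.chart_mem_hull_side K i hs), eval_pull]

lemma LocalRep.add {u v : T.Weak} {p q : LocalData n} (hu : T.LocalRep P j u K p)
    (hv : T.LocalRep P j v K q) : T.LocalRep P j (u + v) K (p + q) where
  interior_eq s hs := by simp [hu.interior_eq s hs, hv.interior_eq s hs]
  face_eq i s hs := by simp [hu.face_eq i s hs, hv.face_eq i s hs]
  deg_inner := Submodule.add_mem _ hu.deg_inner hv.deg_inner
  deg_face i := Submodule.add_mem _ (hu.deg_face i) (hv.deg_face i)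

lemma LocalRep.smul {u : T.Weak} {p : LocalData n} (c : ℝ) (hu : T.LocalRep P j u K p) :
    T.LocalRep P j (c • u) K (c • p) where
  interior_eq s hs := by simp [hu.interior_eq s hs, smul_eval]
  face_eq i s hs := by simp [hu.face_eq i s hs, smul_eval]
  deg_inner := Submodule.smul_mem _ c hu.deg_inner
  deg_face i := Submodule.smul_mem _ c (hu.deg_face i)

lemma setIntegral_vval (K : T.elements) (p q : VecPoly n) :
    ∫ x in hull K.1, vval p x ⬝ᵥ vval q x = T.jacE K * elemForm (T.vert K) p q := by
  rw [setIntegral_element, elemForm_apply, vecForm_apply, refInt_apply]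
  congr 1
  refine integral_congr_ae (Filter.Eventually.of_forall fun s => ?_)
  simp [vval, dotProduct, eval_pull]

/-- The definition of the weak gradient transforms exactly. The contravariant pull-back preserves
the divergence, and on a facet `jacF` times the normal component of `q` becomes `-jacE` times the
flux of the pulled back field. The factor `jacE` is thus common to all terms and cancels against
that of the left side. -/
lemma LocalRep.rhs {v : T.Weak} {p : LocalData n} (hv : T.LocalRep P j v K p) (q : VecPoly n) :
    -(∫ x in hull K.1, v.1 K x * pval (divergence q) x) +
      ∑ e ∈ T.sidesOf K, ∫ x in hull e.1,
        v.2 e x * (vval q x ⬝ᵥ (normal K.1 e.1).ofLp) ∂μHE[n + 1 - 1] =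
      T.jacE K * refPairing n p (pullVec (T.vert K) q) := by
  have hy := T.vert_affineIndependent K
  rw [refPairing_apply, divergence_piola (mul_chartInv hy), mul_sub, mul_neg, sub_eq_add_neg,
    T.sum_sidesOf, Finset.mul_sum, ← Finset.sum_neg_distrib]
  congr 1
  · rw [setIntegral_element, refInt_apply]
    congr 2
    refine setIntegral_congr_fun (measurableSet_refSimplex _) fun s hs => ?_
    simp only
    rw [hv.interior_eq s hs, map_mul, eval_pull]
  · refine Finset.sum_congr rfl fun i _ => ?_
    rw [setIntegral_side, faceInt_apply, ← integral_const_mul, ← integral_const_mul,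
      ← integral_neg]
    refine setIntegral_congr_fun (measurableSet_refSimplex _) fun s hs => ?_
    simp only
    rw [hv.face_eq i s hs, map_mul]
    set t := facePt i s
    have hq : ∀ k, vval q (chart (T.vert K) t) k =
        ∑ l, chartMat (T.vert K) k l * eval t (pullVec (T.vert K) q l) := fun k => by
      rw [vval, ← eval_pull, ← sum_mul_pullVec hy]
      simp
    have hN := T.normal_isNormal K i
    set u := normal K.1 (T.side K i).1
    have h1 : T.jacF K i * (vval q (chart (T.vert K) t) ⬝ᵥ u.ofLp) =
        ∑ l, eval t (pullVec (T.vert K) q l) *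
          (T.jacF K i * inner ℝ u (T.vert K l.succ - T.vert K 0)) := by
      simp only [dotProduct, hq, Finset.sum_mul, Finset.mul_sum, PiLp.inner_apply]
      rw [Finset.sum_comm]
      refine Finset.sum_congr rfl fun l _ => Finset.sum_congr rfl fun k _ => ?_
      simp only [chartMat, RCLike.inner_apply, conj_trivial]
      ring
    have h2 : T.jacF K i * (vval q (chart (T.vert K) t) ⬝ᵥ u.ofLp) =
        -(T.jacE K * eval t (flux i (pullVec (T.vert K) q))) := by
      rw [h1]
      simp only [hN.jac_mul_inner hy]
      refine Fin.cases ?_ (fun m => ?_) i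
      · simp only [Fin.succ_ne_zero, if_false, if_true, flux_zero, map_neg, map_sum, Finset.mul_sum,
          mul_neg, neg_neg]
        exact Finset.sum_congr rfl fun l _ => by ring
      · rw [flux_succ, Finset.sum_eq_single m]
        · simp only [if_true, (Fin.succ_ne_zero m).symm, if_false]
          ring
        · intro l _ hl
          have : ¬ l.succ = m.succ := fun h => hl (Fin.succ_injective _ h)
          simp [this, (Fin.succ_ne_zero m).symm]
        · simp
    calc _ = eval t (p.2 i) * (T.jacF K i * (vval q (chart (T.vert K) t) ⬝ᵥ u.ofLp)) := by ring
      _ = _ := by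
        rw [h2]
        ring

lemma weakGrad_spec {v : T.Weak} {p : LocalData n} (hv : T.LocalRep P j v K p) :
    T.weakGrad P j v K ∈ P.G (n + 1) j ∧ ∀ q ∈ P.G (n + 1) j,
      elemForm (T.vert K) (T.weakGrad P j v K) q = refPairing n p (pullVec (T.vert K) q) := by
  have hJ := T.jacE_pos K
  have hex : ∃ g, g ∈ P.G (n + 1) j ∧ ∀ q ∈ P.G (n + 1) j,
    ∫ x in hull K.1, vval g x ⬝ᵥ vval q x =
      -(∫ x in hull K.1, v.1 K x * pval (divergence q) x) +
      ∑ e ∈ T.sidesOf K, ∫ x in hull e.1,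
        v.2 e x * (vval q x ⬝ᵥ (normal K.1 e.1).ofLp) ∂μHE[n + 1 - 1] := by
    obtain ⟨S, hS⟩ := exists_elemGrad (T.vert_affineIndependent K) P j
    refine ⟨S p, (S p).2, fun q hq => ?_⟩
    rw [hv.rhs, setIntegral_vval, hS p q hq]
  have h := Classical.epsilon_spec hex
  refine ⟨h.1, fun q hq => ?_⟩
  have h2 := h.2 q hq
  rw [hv.rhs, setIntegral_vval] at h2
  exact mul_left_cancel₀ hJ.ne' h2

lemma weakGrad_eq {v : T.Weak} {p : LocalData n} (hv : T.LocalRep P j v K p) {g : VecPoly n}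
    (hg : g ∈ P.G (n + 1) j) (h : ∀ q ∈ P.G (n + 1) j,
      elemForm (T.vert K) g q = refPairing n p (pullVec (T.vert K) q)) :
    T.weakGrad P j v K = g := by
  have hs := weakGrad_spec hv
  rw [← sub_eq_zero]
  by_contra hne
  refine ((elemForm_isInner (T.vert_affineIndependent K)).pos _ hne).ne' ?_
  rw [LinearMap.map_sub₂, hs.2 _ (Submodule.sub_mem _ hs.1 hg),
    h _ (Submodule.sub_mem _ hs.1 hg), sub_self]

lemma weakGrad_add {u v : T.Weak} (hu : u ∈ T.Vh P j) (hv : v ∈ T.Vh P j) (K : T.elements) :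
    T.weakGrad P j (u + v) K = T.weakGrad P j u K + T.weakGrad P j v K := by
  obtain ⟨p, hp⟩ := exists_localRep hu K
  obtain ⟨q, hq⟩ := exists_localRep hv K
  have h1 := weakGrad_spec hp
  have h2 := weakGrad_spec hq
  refine weakGrad_eq (hp.add hq) (Submodule.add_mem _ h1.1 h2.1) fun r hr => ?_
  simp [h1.2 r hr, h2.2 r hr]

lemma weakGrad_smul {u : T.Weak} (c : ℝ) (hu : u ∈ T.Vh P j) (K : T.elements) :
    T.weakGrad P j (c • u) K = c • T.weakGrad P j u K := by
  obtain ⟨p, hp⟩ := exists_localRep hu K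
  have h1 := weakGrad_spec hp
  refine weakGrad_eq (hp.smul c) (Submodule.smul_mem _ c h1.1) fun r hr => ?_
  simp [h1.2 r hr]

/-! ### Local estimates -/

/-- The energy of the weak gradient on an element. -/
def gradSq (P : Pair) (j : ℕ) (v : T.Weak) (K : T.elements) : ℝ :=
  ∫ x in hull K.1, vval (T.weakGrad P j v K) x ⬝ᵥ vval (T.weakGrad P j v K) x

lemma gradSq_nonneg (v : T.Weak) (K : T.elements) : 0 ≤ gradSq P j v K :=
  integral_nonneg fun x => by
    simp only [dotProduct]
    exact Finset.sum_nonneg fun i _ => mul_self_nonneg _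

/-- The size of an element is comparable to `h`. -/
structure IsSized (K : T.elements) (κ h : ℝ) : Prop where
  kpos : 0 < κ
  hpos : 0 < h
  diam : Metric.diam (hull K.1) ≤ h
  ball : ∃ c, Metric.ball c (κ * h) ⊆ hull K.1

variable {κ h : ℝ}

lemma IsSized.jacE_le (hK : IsSized K κ h) (i : Fin (n + 2)) : T.jacE K ≤ h * T.jacF K i := by
  refine jac_le_mul_jac_facet (T.vert_affineIndependent K) ?_ i
  rw [← hull_eq]
  exact hK.diam

lemma IsSized.jacF_le (hK : IsSized K κ h) (i : Fin (n + 2)) :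
    h * T.jacF K i ≤ κ⁻¹ * T.jacE K := by
  obtain ⟨c, hc⟩ := hK.ball
  rw [hull_eq] at hc
  have := mul_jac_facet_le (T.vert_affineIndependent K) (mul_pos hK.kpos hK.hpos) hc i
  rw [le_inv_mul_iff₀ hK.kpos]
  linarith

/-- Together with `IsSized.gradSq_le` this is the scaling of gradients: pulled back to the reference
simplex, the squared gradient gains a factor `h²`, up to constants depending on `n` and `κ`. -/
lemma IsSized.refEnergy_le (hK : IsSized K κ h) {v : T.Weak} {p : LocalData n}
    (hv : T.LocalRep P j v K p) :
    T.jacE K * refEnergy P j p p ≤ (n + 1) * h ^ 2 * gradSq P j v K := by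
  have hy := T.vert_affineIndependent K
  have h1 := refEnergy_le_elemForm hy (weakGrad_spec hv).2
  have h2 : ∑ k, ∑ l, chartMat (T.vert K) k l ^ 2 ≤ (n + 1) * h ^ 2 := by
    refine sum_chartMat_sq_le ?_
    rw [← hull_eq]
    exact hK.diam
  have h3 := (elemForm_isInner hy).semi.nonneg (T.weakGrad P j v K)
  have h4 := T.jacE_pos K
  rw [gradSq, setIntegral_vval]
  calc _ ≤ T.jacE K * ((n + 1) * h ^ 2 *
        elemForm (T.vert K) (T.weakGrad P j v K) (T.weakGrad P j v K)) := by
        gcongr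
        exact h1.trans (by gcongr)
    _ = _ := by ring

lemma IsSized.gradSq_le (hK : IsSized K κ h) {v : T.Weak} {p : LocalData n}
    (hv : T.LocalRep P j v K p) :
    gradSq P j v K ≤ (n + 1) / (κ * h) ^ 2 * (T.jacE K * refEnergy P j p p) := by
  have hy := T.vert_affineIndependent K
  obtain ⟨c, hc⟩ := hK.ball
  rw [hull_eq] at hc
  have h1 := elemForm_le_refEnergy hy (weakGrad_spec hv).1 (weakGrad_spec hv).2
  have h2 := sum_chartInv_sq_le hy (mul_pos hK.kpos hK.hpos) hc
  have h3 := (refEnergy_isSemiInner P j (n := n)).nonneg p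
  have h4 := T.jacE_pos K
  rw [gradSq, setIntegral_vval]
  calc _ ≤ T.jacE K * ((n + 1) / (κ * h) ^ 2 * refEnergy P j p p) := by
        gcongr
        exact h1.trans (by gcongr)
    _ = _ := by ring

lemma LocalRep.integral_inner {u v : T.Weak} {p q : LocalData n} (hu : T.LocalRep P j u K p)
    (hv : T.LocalRep P j v K q) :
    ∫ x in hull K.1, u.1 K x * v.1 K x = T.jacE K * refInt (n + 1) (p.1 * q.1) := by
  rw [setIntegral_element, refInt_apply]
  congr 1
  refine setIntegral_congr_fun (measurableSet_refSimplex _) fun s hs => ?_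
  rw [hu.interior_eq s hs, hv.interior_eq s hs, map_mul]

lemma integral_side_eq {f g : E (n + 1) → ℝ} {i : Fin (n + 2)}
    {p q : MvPolynomial (Fin (n + 1)) ℝ}
    (hf : ∀ s ∈ refSimplex n, f (chart (T.vert K) (facePt i s)) = eval (facePt i s) p)
    (hg : ∀ s ∈ refSimplex n, g (chart (T.vert K) (facePt i s)) = eval (facePt i s) q) :
    ∫ x in hull (T.side K i).1, f x * g x ∂μHE[n + 1 - 1] =
      T.jacF K i * faceInt i (p * q) := by
  rw [setIntegral_side, faceInt_apply]
  congr 1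
  refine setIntegral_congr_fun (measurableSet_refSimplex _) fun s hs => ?_
  rw [hf s hs, hg s hs, map_mul]

/-- The local part of the discrete `L²` inner product, with `h` as the weight of the boundary. -/
def localIp (h : ℝ) (u v : T.Weak) (K : T.elements) : ℝ :=
  (∫ x in hull K.1, u.1 K x * v.1 K x) + h * ∑ e ∈ T.sidesOf K,
    ∫ x in hull e.1, (u.1 K x - u.2 e x) * (v.1 K x - v.2 e x) ∂μHE[n + 1 - 1]

lemma LocalRep.face_sub {v : T.Weak} {p : LocalData n} (hv : T.LocalRep P j v K p)
    (i : Fin (n + 2)) {s : Fin n → ℝ} (hs : s ∈ refSimplex n) :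
    v.1 K (chart (T.vert K) (facePt i s)) - v.2 (T.side K i) (chart (T.vert K) (facePt i s)) =
      eval (facePt i s) (p.1 - p.2 i) := by
  rw [hv.interior_eq _ (facePt_mem hs i), hv.face_eq i s hs, map_sub]

lemma LocalRep.localIp_eq {u v : T.Weak} {p q : LocalData n} (hu : T.LocalRep P j u K p)
    (hv : T.LocalRep P j v K q) : localIp h u v K = T.jacE K * refInt (n + 1) (p.1 * q.1) +
      h * ∑ i, T.jacF K i * faceInt i ((p.1 - p.2 i) * (q.1 - q.2 i)) := by
  rw [localIp, hu.integral_inner hv, T.sum_sidesOf]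
  congr 2
  refine Finset.sum_congr rfl fun i _ => ?_
  exact integral_side_eq (f := fun x => u.1 K x - u.2 (T.side K i) x)
    (g := fun x => v.1 K x - v.2 (T.side K i) x)
    (fun s hs => hu.face_sub i hs) (fun s hs => hv.face_sub i hs)

end Mesh

end

/-! ### Local inverse, Poincaré and Friedrichs inequalities scaled to an element -/

section

lemma faceInt_mul_self_nonneg {n : ℕ} (i : Fin (n + 2)) (p : MvPolynomial (Fin (n + 1)) ℝ) :
    0 ≤ faceInt i (p * p) :=
  (faceForm_isSemiInner i).nonneg p

lemma refInt_mul_self_nonneg {n : ℕ} (p : MvPolynomial (Fin n) ℝ) : 0 ≤ refInt n (p * p) :=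
  (refForm_isInner n).semi.nonneg p

namespace Mesh

variable {n : ℕ} {Ω : Set (E (n + 1))} {T : Mesh (n + 1) Ω} {P : Pair} {j : ℕ} {K : T.elements}
  {κ h : ℝ}

/-- The squared `L²` norm on an edge/face. -/
def sideSq (f : E (n + 1) → ℝ) (e : Finset (E (n + 1))) : ℝ :=
  ∫ x in hull e, f x * f x ∂μHE[n + 1 - 1]

lemma LocalRep.sideSq_sub {v : T.Weak} {p : LocalData n} (hv : T.LocalRep P j v K p)
    (i : Fin (n + 2)) (c : ℝ) :
    sideSq (fun x => v.2 (T.side K i) x - c) (T.side K i).1 =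
      T.jacF K i * faceInt i ((p.2 i - C c) * (p.2 i - C c)) := by
  have h1 : ∀ s ∈ refSimplex n, v.2 (T.side K i) (chart (T.vert K) (facePt i s)) - c =
      eval (facePt i s) (p.2 i - C c) := fun s hs => by
    rw [hv.face_eq i s hs, map_sub, eval_C]
  exact integral_side_eq h1 h1

variable (P j n κ)

/-- The inverse inequality. -/
lemma exists_gradSq_le_localIp : ∃ C : ℝ, 0 < C ∧ ∀ (Ω : Set (E (n + 1))) (T : Mesh (n + 1) Ω)
    (K : T.elements) (h : ℝ), IsSized K κ h → ∀ v ∈ T.Vh P j,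
    h ^ 2 * gradSq P j v K ≤ C * localIp h v v K := by
  -- For `κ ≤ 0` no element is sized and the claim is void; the real constants involve `κ⁻¹`.
  by_cases hκ : 0 < κ
  swap
  · exact ⟨1, one_pos, fun Ω T K h hK => (hκ hK.kpos).elim⟩
  obtain ⟨C₀, hC₀, h0⟩ := exists_refEnergy_le P j n
  refine ⟨(n + 1) / κ ^ 2 * C₀, by positivity, fun Ω T K h hK v hv => ?_⟩
  obtain ⟨p, hp⟩ := exists_localRep hv K
  have h1 := hK.gradSq_le hp
  have h2 := h0 p hp.deg_inner hp.deg_face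
  have hJ := T.jacE_pos K
  have hh := hK.hpos
  have h3 : ∑ i, T.jacE K * faceInt i ((p.1 - p.2 i) * (p.1 - p.2 i)) ≤
      h * ∑ i, T.jacF K i * faceInt i ((p.1 - p.2 i) * (p.1 - p.2 i)) := by
    rw [Finset.mul_sum]
    refine Finset.sum_le_sum fun i _ => ?_
    rw [← mul_assoc]
    exact mul_le_mul_of_nonneg_right (hK.jacE_le i) (faceInt_mul_self_nonneg _ _)
  calc h ^ 2 * gradSq P j v K
      ≤ h ^ 2 * ((n + 1) / (κ * h) ^ 2 * (T.jacE K * (C₀ * (refInt (n + 1) (p.1 * p.1) +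
      ∑ i, faceInt i ((p.1 - p.2 i) * (p.1 - p.2 i)))))) := by
        refine mul_le_mul_of_nonneg_left (h1.trans ?_) (by positivity)
        gcongr
    _ = (n + 1) / κ ^ 2 * C₀ * (T.jacE K * refInt (n + 1) (p.1 * p.1) +
      ∑ i, T.jacE K * faceInt i ((p.1 - p.2 i) * (p.1 - p.2 i))) := by
        rw [← Finset.mul_sum]
        field_simp
    _ ≤ _ := by
        rw [hp.localIp_eq hp]
        gcongr

/-- The energy of a weak function with constant interior part. -/
lemma exists_gradSq_le_sideSq : ∃ C : ℝ, 0 < C ∧ ∀ (Ω : Set (E (n + 1))) (T : Mesh (n + 1) Ω)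
    (K : T.elements) (h : ℝ), IsSized K κ h → ∀ v ∈ T.Vh P j, ∀ c : ℝ,
    (∀ x ∈ hull K.1, v.1 K x = c) →
    h * gradSq P j v K ≤
      C * ∑ i, sideSq (fun x => v.2 (T.side K i) x - c) (T.side K i).1 := by
  by_cases hκ : 0 < κ
  swap
  · exact ⟨1, one_pos, fun Ω T K h hK => (hκ hK.kpos).elim⟩
  obtain ⟨C₀, hC₀, h0⟩ := exists_refEnergy_le P j n
  refine ⟨(n + 1) / κ ^ 2 * C₀, by positivity, fun Ω T K h hK v hv c hc => ?_⟩
  obtain ⟨p', hp'⟩ := exists_localRep hv K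
  have hp : T.LocalRep P j v K (C c, p'.2) :=
    { interior_eq := fun s hs => by rw [hc _ (T.chart_mem_hull K hs), eval_C]
      face_eq := hp'.face_eq
      deg_inner := C_mem_Pol _
      deg_face := hp'.deg_face }
  have hJ := T.jacE_pos K
  have hh := hK.hpos
  set r : LocalData n := (0, fun i => p'.2 i - C c)
  -- The weak gradient of a constant is zero, so `c` may be subtracted from all parts. What remains
  -- has no interior part, and only the facet differences enter.
  have hr : refEnergy P j ((C c, p'.2) : LocalData n) (C c, p'.2) = refEnergy P j r r := by
    have : ((C c, p'.2) : LocalData n) = (C c, fun _ => C c) + r := by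
      ext1
      · simp [r]
      · funext i
        simp [r]
    rw [refEnergy_apply, refEnergy_apply, this, map_add, refGrad_const, zero_add]
  have h1 := hK.gradSq_le hp
  rw [hr] at h1
  have h2 := h0 r (Submodule.zero_mem _)
    fun i => Submodule.sub_mem _ (hp'.deg_face i) (C_mem_Pol _)
  have h3 : refInt (n + 1) (r.1 * r.1) + ∑ i, faceInt i ((r.1 - r.2 i) * (r.1 - r.2 i)) =
      ∑ i, faceInt i ((p'.2 i - C c) * (p'.2 i - C c)) := by
    simp [r, ← neg_mul_neg (p'.2 _ - C c)]
  rw [h3] at h2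
  calc h * gradSq P j v K
      ≤ h * ((n + 1) / (κ * h) ^ 2 * (T.jacE K * (C₀ *
      ∑ i, faceInt i ((p'.2 i - C c) * (p'.2 i - C c))))) := by
        refine mul_le_mul_of_nonneg_left (h1.trans ?_) hh.le
        gcongr
    _ = (n + 1) / κ ^ 2 * C₀ * ∑ i, h⁻¹ * T.jacE K *
        faceInt i ((p'.2 i - C c) * (p'.2 i - C c)) := by
        rw [← Finset.mul_sum]
        field_simp
    _ ≤ _ := by
        refine mul_le_mul_of_nonneg_left (Finset.sum_le_sum fun i _ => ?_) (by positivity)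
        rw [hp'.sideSq_sub]
        refine mul_le_mul_of_nonneg_right ?_ (faceInt_mul_self_nonneg _ _)
        rw [inv_mul_le_iff₀ hh]
        exact hK.jacE_le i

/-- A Poincaré inequality. -/
lemma exists_sideSq_sub_le : ∃ C : ℝ, 0 < C ∧ ∀ (Ω : Set (E (n + 1))) (T : Mesh (n + 1) Ω)
    (K : T.elements) (h : ℝ), IsSized K κ h → ∀ v ∈ T.Vh P j, ∃ c : ℝ, ∀ i,
    sideSq (fun x => v.2 (T.side K i) x - c) (T.side K i).1 ≤ C * h * gradSq P j v K := by
  by_cases hκ : 0 < κ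
  swap
  · exact ⟨1, one_pos, fun Ω T K h hK => (hκ hK.kpos).elim⟩
  obtain ⟨C₀, hC₀, h0⟩ := exists_faceInt_sub_mean_le P j n
  refine ⟨κ⁻¹ * C₀ * (n + 1), by positivity, fun Ω T K h hK v hv => ?_⟩
  obtain ⟨p, hp⟩ := exists_localRep hv K
  -- The constant is the mean of the interior part over the element. It is the same for all facets,
  -- which later allows neighbouring elements to be compared.
  refine ⟨refInt (n + 1) p.1 / refVol (n + 1), fun i => ?_⟩
  set c := refInt (n + 1) p.1 / refVol (n + 1)
  have hJ := T.jacE_pos K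
  have hh := hK.hpos
  have h2 := h0 p hp.deg_inner hp.deg_face
  have h3 := Finset.single_le_sum (f := fun i => faceInt i ((p.2 i - C c) * (p.2 i - C c)))
    (fun i _ => faceInt_mul_self_nonneg _ _) (Finset.mem_univ i)
  have h4 := h3.trans h2
  have h5 := hK.refEnergy_le hp
  have h6 := (refEnergy_isSemiInner P j (n := n)).nonneg p
  rw [hp.sideSq_sub]
  have h7 := hK.jacF_le i
  rw [← le_div_iff₀' hh] at h7
  calc _ ≤ κ⁻¹ * T.jacE K / h * (C₀ * refEnergy P j p p) := by
        refine mul_le_mul h7 h4 (faceInt_mul_self_nonneg _ _) (by positivity)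
    _ = κ⁻¹ * C₀ / h * (T.jacE K * refEnergy P j p p) := by ring
    _ ≤ κ⁻¹ * C₀ / h * ((n + 1) * h ^ 2 * gradSq P j v K) := by gcongr
    _ = _ := by
        field_simp

/-- A Friedrichs inequality for weak functions without boundary part. -/
lemma exists_localIp_le : ∃ C : ℝ, 0 < C ∧ ∀ (Ω : Set (E (n + 1))) (T : Mesh (n + 1) Ω)
    (K : T.elements) (h : ℝ), IsSized K κ h → ∀ v ∈ T.Vh P j, (∀ i, v.2 (T.side K i) = 0) →
    localIp h v v K ≤ C * h ^ 2 * gradSq P j v K := by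
  by_cases hκ : 0 < κ
  swap
  · exact ⟨1, one_pos, fun Ω T K h hK => (hκ hK.kpos).elim⟩
  obtain ⟨C₀, hC₀, h0⟩ := exists_refInt_le P j n
  refine ⟨(1 + κ⁻¹) * C₀ * (n + 1), by positivity, fun Ω T K h hK v hv hvb => ?_⟩
  obtain ⟨p', hp'⟩ := exists_localRep hv K
  have hp : T.LocalRep P j v K (p'.1, 0) :=
    { interior_eq := hp'.interior_eq
      face_eq := fun i s hs => by simp [hvb i]
      deg_inner := hp'.deg_inner
      deg_face := fun i => Submodule.zero_mem _ }
  have hJ := T.jacE_pos K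
  have h2 := h0 p'.1 hp'.deg_inner
  have h5 := hK.refEnergy_le hp
  rw [hp.localIp_eq hp]
  simp only [Pi.zero_apply, sub_zero]
  have h3 : h * ∑ i, T.jacF K i * faceInt i (p'.1 * p'.1) ≤
      κ⁻¹ * T.jacE K * ∑ i, faceInt i (p'.1 * p'.1) := by
    rw [Finset.mul_sum, Finset.mul_sum]
    refine Finset.sum_le_sum fun i _ => ?_
    rw [← mul_assoc]
    exact mul_le_mul_of_nonneg_right (hK.jacF_le i) (faceInt_mul_self_nonneg _ _)
  have h6 := refInt_mul_self_nonneg p'.1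
  have h7 : 0 ≤ ∑ i, faceInt i (p'.1 * p'.1) :=
    Finset.sum_nonneg fun i _ => faceInt_mul_self_nonneg _ _
  calc _ ≤ T.jacE K * refInt (n + 1) (p'.1 * p'.1) +
        κ⁻¹ * T.jacE K * ∑ i, faceInt i (p'.1 * p'.1) := by gcongr
    _ ≤ (1 + κ⁻¹) * T.jacE K * (refInt (n + 1) (p'.1 * p'.1) + ∑ i, faceInt i (p'.1 * p'.1)) := by
        have hk : 0 < κ⁻¹ := by positivity
        have e1 := mul_nonneg hJ.le h7
        have e2 := mul_nonneg (mul_nonneg hk.le hJ.le) h6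
        nlinarith
    _ ≤ (1 + κ⁻¹) * T.jacE K * (C₀ * refEnergy P j ((p'.1, 0) : LocalData n) (p'.1, 0)) := by
        gcongr
    _ = (1 + κ⁻¹) * C₀ * (T.jacE K * refEnergy P j ((p'.1, 0) : LocalData n) (p'.1, 0)) := by ring
    _ ≤ (1 + κ⁻¹) * C₀ * ((n + 1) * h ^ 2 * gradSq P j v K) := by gcongr
    _ = _ := by ring

variable {P j n κ}

/-! ### Volumes -/

/-- The volume of the unit ball. -/
def ballVol (n : ℕ) : ℝ := volume.real (Metric.ball (0 : E (n + 1)) 1)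

lemma ballVol_pos (n : ℕ) : 0 < ballVol n :=
  ENNReal.toReal_pos (Metric.measure_ball_pos _ _ one_pos).ne' measure_ball_lt_top.ne

lemma volume_ball_eq (x : E (n + 1)) {r : ℝ} (hr : 0 ≤ r) :
    volume.real (Metric.ball x r) = r ^ (n + 1) * ballVol n := by
  rw [Measure.real, Measure.addHaar_ball _ _ hr, ENNReal.toReal_mul, ENNReal.toReal_ofReal (by positivity),
    finrank_euclideanSpace_fin]
  rfl

lemma volume_closedBall_eq (x : E (n + 1)) {r : ℝ} (hr : 0 ≤ r) :
    volume.real (Metric.closedBall x r) = r ^ (n + 1) * ballVol n := by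
  rw [Measure.real, Measure.addHaar_closedBall _ _ hr, ENNReal.toReal_mul,
    ENNReal.toReal_ofReal (by positivity), finrank_euclideanSpace_fin]
  rfl

lemma isCompact_hull (s : Finset (E (n + 1))) : IsCompact (hull s) :=
  s.finite_toSet.isCompact_convexHull (𝕜 := ℝ)

lemma measurableSet_hull (s : Finset (E (n + 1))) : MeasurableSet (hull s) :=
  (isCompact_hull s).measurableSet

lemma volume_hull_ne_top (s : Finset (E (n + 1))) : volume (hull s) ≠ ⊤ :=
  (isCompact_hull s).measure_lt_top.ne

lemma volume_element (K : T.elements) : volume.real (hull K.1) = T.jacE K * refVol (n + 1) := by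
  have := T.setIntegral_element K fun _ => 1
  simpa [refVol] using this

lemma subset_closedBall_of_mem {K : T.elements} (hK : IsSized K κ h) {x : E (n + 1)}
    (hx : x ∈ hull K.1) : hull K.1 ⊆ Metric.closedBall x h := fun _ hz =>
  (Metric.dist_le_diam_of_mem (isCompact_hull _).isBounded hz hx).trans hK.diam

lemma IsSized.volume_le (hK : IsSized K κ h) : volume.real (hull K.1) ≤ h ^ (n + 1) * ballVol n := by
  have hx : T.vert K 0 ∈ hull K.1 := subset_convexHull ℝ _ (T.vert_mem K 0)
  rw [← volume_closedBall_eq (T.vert K 0) hK.hpos.le]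
  exact measureReal_mono (subset_closedBall_of_mem hK hx) measure_closedBall_lt_top.ne

lemma IsSized.le_volume (hK : IsSized K κ h) :
    (κ * h) ^ (n + 1) * ballVol n ≤ volume.real (hull K.1) := by
  obtain ⟨c, hc⟩ := hK.ball
  rw [← volume_ball_eq c (mul_pos hK.kpos hK.hpos).le]
  exact measureReal_mono hc (volume_hull_ne_top _)

lemma sideSq_const (K : T.elements) (i : Fin (n + 2)) (c : ℝ) :
    sideSq (fun _ => c) (T.side K i).1 = T.jacF K i * refVol n * c ^ 2 := by
  rw [sideSq, T.setIntegral_side]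
  simp [refVol]
  ring

lemma IsSized.jacF_le_pow (hK : IsSized K κ h) (i : Fin (n + 2)) :
    T.jacF K i ≤ κ⁻¹ * (ballVol n / refVol (n + 1)) * h ^ n := by
  have h1 := hK.jacF_le i
  have h2 := hK.volume_le
  rw [volume_element] at h2
  have hh := hK.hpos
  have hk := hK.kpos
  have hr := refVol_pos (n + 1)
  rw [← le_div_iff₀ hr] at h2
  rw [← le_div_iff₀' hh] at h1
  refine h1.trans ?_
  calc κ⁻¹ * T.jacE K / h ≤ κ⁻¹ * (h ^ (n + 1) * ballVol n / refVol (n + 1)) / h := by gcongr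
    _ = _ := by
      field_simp
      ring

lemma IsSized.le_jacF (hK : IsSized K κ h) (i : Fin (n + 2)) :
    κ ^ (n + 1) * (ballVol n / refVol (n + 1)) * h ^ n ≤ T.jacF K i := by
  have h1 := hK.jacE_le i
  have h2 := hK.le_volume
  rw [volume_element] at h2
  have hh := hK.hpos
  have hk := hK.kpos
  have hr := refVol_pos (n + 1)
  rw [← div_le_iff₀ hr] at h2
  rw [← div_le_iff₀' hh] at h1
  refine le_trans ?_ h1
  calc _ = ((κ * h) ^ (n + 1) * ballVol n / refVol (n + 1)) / h := by
        field_simp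
        ring
    _ ≤ _ := by gcongr

end Mesh

end

/-! ### Geometry of the mesh: common faces and connectedness of vertex stars -/

section

variable {n : ℕ}

lemma affineSpan_ne_top {s : Finset (E (n + 1))} (hs : s.card ≤ n + 1) :
    affineSpan ℝ (s : Set (E (n + 1))) ≠ ⊤ := by
  classical
  intro h
  rcases s.eq_empty_or_nonempty with rfl | hne
  · have := congrArg (fun S : AffineSubspace ℝ (E (n + 1)) => (S : Set (E (n + 1)))) h
    simp only [Finset.coe_empty, AffineSubspace.span_empty, AffineSubspace.bot_coe,
      AffineSubspace.top_coe] at this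
    exact Set.empty_ne_univ this
  · obtain ⟨m, hm⟩ : ∃ m, s.card = m + 1 := ⟨s.card - 1, by have := hne.card_pos; omega⟩
    have h1 := finrank_vectorSpan_image_finset_le ℝ (id : E (n + 1) → E (n + 1)) s hm
    rw [Finset.image_id, ← direction_affineSpan, h, AffineSubspace.direction_top, finrank_top,
      finrank_euclideanSpace_fin] at h1
    omega

lemma volume_affineSpan {s : Finset (E (n + 1))} (hs : s.card ≤ n + 1) :
    volume (affineSpan ℝ (s : Set (E (n + 1))) : Set (E (n + 1))) = 0 :=
  Measure.addHaar_affineSubspace _ _ (affineSpan_ne_top hs)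

lemma volume_hull_eq_zero {s : Finset (E (n + 1))} (hs : s.card ≤ n + 1) :
    volume (hull s) = 0 :=
  measure_mono_null (convexHull_subset_affineSpan _) (volume_affineSpan hs)

/-- Almost all segments avoid the simplices of codimension two. -/
lemma exists_segment_disjoint {F : Set (Finset (E (n + 1)))} (hF : F.Finite)
    (hcard : ∀ s ∈ F, s.card ≤ n) {U V : Set (E (n + 1))} (hU : IsOpen U) (hV : IsOpen V)
    (hU0 : U.Nonempty) (hV0 : V.Nonempty) :
    ∃ p ∈ U, ∃ q ∈ V, ∀ z ∈ segment ℝ p q, ∀ s ∈ F, z ∉ hull s := by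
  classical
  have key : ∀ {W : Set (E (n + 1))}, IsOpen W → W.Nonempty →
      ∀ G : Finset (E (n + 1)) → Finset (E (n + 1)), (∀ s ∈ F, (G s).card ≤ n + 1) →
      ∃ p ∈ W, ∀ s ∈ F, p ∉ affineSpan ℝ (G s : Set (E (n + 1))) := by
    intro W hW hW0 G hG
    have h0 : volume (⋃ s ∈ F, (affineSpan ℝ (G s : Set (E (n + 1))) : Set (E (n + 1)))) = 0 :=
      (measure_biUnion_null_iff hF.countable).2 fun s hs => volume_affineSpan (hG s hs)
    have h1 : ¬ W ⊆ ⋃ s ∈ F, (affineSpan ℝ (G s : Set (E (n + 1))) : Set (E (n + 1))) := fun h =>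
      (hW.measure_pos volume hW0).ne' (measure_mono_null h h0)
    obtain ⟨p, hp, hp'⟩ := Set.not_subset.1 h1
    refine ⟨p, hp, fun s hs h => hp' (Set.mem_biUnion hs h)⟩
  -- First `p` avoids the affine spans of the simplices in `F`, then `q` avoids the spans of these
  -- simplices with `p` added, which have at most `n + 1` points and are still null sets. A point `z
  -- ≠ p` of the segment in such a simplex would place `q` on the line through `p` and `z`, hence in
  -- the larger span.
  obtain ⟨p, hp, hp'⟩ := key hU hU0 id fun s hs => (hcard s hs).trans (by omega)
  obtain ⟨q, hq, hq'⟩ := key hV hV0 (fun s => insert p s) fun s hs =>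
    (Finset.card_insert_le _ _).trans (by have := hcard s hs; omega)
  refine ⟨p, hp, q, hq, fun z hz s hs hzs => ?_⟩
  rw [segment_eq_image_lineMap] at hz
  obtain ⟨t, -, rfl⟩ := hz
  have hzs' := convexHull_subset_affineSpan _ hzs
  rcases eq_or_ne t 0 with rfl | ht
  · rw [AffineMap.lineMap_apply_zero] at hzs'
    exact hp' s hs hzs'
  · refine hq' s hs ?_
    have hpm : p ∈ affineSpan ℝ ((insert p s : Finset (E (n + 1))) : Set (E (n + 1))) :=
      subset_affineSpan ℝ _ (by simp)
    have hzm : AffineMap.lineMap p q t ∈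
        affineSpan ℝ ((insert p s : Finset (E (n + 1))) : Set (E (n + 1))) :=
      affineSpan_mono ℝ (by simp) hzs'
    have h1 := AffineMap.lineMap_mem t⁻¹ hpm hzm
    rwa [AffineMap.lineMap_lineMap_right, inv_mul_cancel₀ ht, AffineMap.lineMap_apply_one] at h1

namespace Mesh

variable {Ω : Set (E (n + 1))} (T : Mesh (n + 1) Ω)

lemma exists_element {s : Finset (E (n + 1))} (hs : s ∈ T.faces) : ∃ K : T.elements, s ⊆ K.1 := by
  obtain ⟨K, hK, hsK, hc⟩ := T.pure s hs
  exact ⟨⟨K, T.mem_elements.2 ⟨hK, hc⟩⟩, hsK⟩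

lemma hull_mono {s t : Finset (E (n + 1))} (h : s ⊆ t) : hull s ⊆ hull t :=
  convexHull_mono (Finset.coe_subset.2 h)

lemma iUnion_hull : ⋃ K : T.elements, hull K.1 = closure Ω := by
  rw [← T.cover]
  refine Set.Subset.antisymm ?_ ?_
  · exact Set.iUnion_subset fun K => Set.subset_biUnion_of_mem (u := fun s => hull s)
      (T.element_mem K)
  · refine Set.iUnion₂_subset fun s hs => ?_
    obtain ⟨K, hK⟩ := T.exists_element hs
    exact (hull_mono hK).trans (Set.subset_iUnion (fun K : T.elements => hull K.1) K)

lemma hull_subset_closure (K : T.elements) : hull K.1 ⊆ closure Ω := by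
  rw [← T.iUnion_hull]
  exact Set.subset_iUnion (fun K : T.elements => hull K.1) K

lemma exists_mem_hull {x : E (n + 1)} (hx : x ∈ closure Ω) : ∃ K : T.elements, x ∈ hull K.1 := by
  rw [← T.iUnion_hull] at hx
  exact Set.mem_iUnion.1 hx

open Classical in
lemma mem_hull_inter {s t : Finset (E (n + 1))} (hs : s ∈ T.faces) (ht : t ∈ T.faces)
    {x : E (n + 1)} (hxs : x ∈ hull s) (hxt : x ∈ hull t) : x ∈ hull (s ∩ t) := by
  rw [hull, Finset.coe_inter]
  exact T.inter_subset_convexHull hs ht ⟨hxs, hxt⟩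

open Classical in
lemma inter_mem_faces {s t : Finset (E (n + 1))} (hs : s ∈ T.faces) (ht : t ∈ T.faces)
    {x : E (n + 1)} (hxs : x ∈ hull s) (hxt : x ∈ hull t) : s ∩ t ∈ T.faces := by
  refine T.down_closed hs Finset.inter_subset_left ?_
  have h := T.mem_hull_inter hs ht hxs hxt
  rw [← Finset.coe_nonempty, ← convexHull_nonempty_iff (𝕜 := ℝ)]
  exact ⟨x, h⟩

lemma mem_hull_of_mem {s : Finset (E (n + 1))} {x : E (n + 1)} (hx : x ∈ s) : x ∈ hull s :=
  subset_convexHull ℝ _ hx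

/-- By conformity the vertex `{x}` and `s` meet in a face, which is nonempty and contained in `{x}`.
-/
lemma vertex_mem {K : T.elements} {x : E (n + 1)} (hx : x ∈ K.1) {s : Finset (E (n + 1))}
    (hs : s ∈ T.faces) (hxs : x ∈ hull s) : x ∈ s := by
  classical
  have h1 : {x} ∈ T.faces :=
    T.down_closed (T.element_mem K) (Finset.singleton_subset_iff.2 hx) (Finset.singleton_nonempty x)
  have h2 := T.inter_mem_faces h1 hs (mem_hull_of_mem (Finset.mem_singleton_self x)) hxs
  obtain ⟨y, hy⟩ := T.nonempty_of_mem_faces h2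
  rw [Finset.mem_inter, Finset.mem_singleton] at hy
  exact hy.1 ▸ hy.2

lemma exists_side_of_mem_frontier {x : E (n + 1)} (hx : x ∈ frontier Ω) :
    ∃ e : T.sides, hull e.1 ⊆ frontier Ω ∧ x ∈ hull e.1 := by
  rw [T.boundary] at hx
  simp only [Set.mem_ofPred_eq, Set.mem_iUnion] at hx
  obtain ⟨e, ⟨h1, h2, h3⟩, hx⟩ := hx
  exact ⟨⟨e, T.mem_sides.2 ⟨h1, h2⟩⟩, h3, hx⟩

lemma volume_frontier (T : Mesh (n + 1) Ω) : volume (frontier Ω) = 0 := by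
  have h : frontier Ω ⊆ ⋃ e : T.sides, hull e.1 := fun x hx => by
    obtain ⟨e, -, he⟩ := T.exists_side_of_mem_frontier hx
    exact Set.mem_iUnion.2 ⟨e, he⟩
  refine measure_mono_null h (measure_iUnion_null fun e => ?_)
  exact volume_hull_eq_zero (T.mem_sides.1 e.2).2.le

lemma eq_of_subset {K K' : T.elements} (h : K.1 ⊆ K'.1) : K = K' :=
  Subtype.ext (Finset.eq_of_subset_of_card_le h
    (by rw [(T.mem_elements.1 K.2).2, (T.mem_elements.1 K'.2).2]))

open Classical in
lemma card_inter_le {K K' : T.elements} (h : K ≠ K') : (K.1 ∩ K'.1).card ≤ n + 1 := by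
  by_contra hc
  refine h (T.eq_of_subset ?_)
  have h1 : K.1 ∩ K'.1 = K.1 := Finset.eq_of_subset_of_card_le Finset.inter_subset_left
    (by rw [(T.mem_elements.1 K.2).2]; omega)
  exact Finset.inter_eq_left.1 h1

lemma aedisjoint_hull {K K' : T.elements} (h : K ≠ K') :
    AEDisjoint volume (hull K.1) (hull K'.1) := by
  classical
  refine measure_mono_null ?_ (volume_hull_eq_zero (T.card_inter_le h))
  exact fun x hx => T.mem_hull_inter (T.element_mem K) (T.element_mem K') hx.1 hx.2

lemma pairwise_aedisjoint :
    Pairwise (Function.onFun (AEDisjoint volume) fun K : T.elements => hull K.1) :=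
  fun _ _ h => T.aedisjoint_hull h

variable {T} {κ h : ℝ}

open Classical in
/-- The number of elements that share a vertex is bounded. -/
lemma card_star_le (hT : ∀ K : T.elements, IsSized K κ h) {K₀ : T.elements} (x : E (n + 1)) :
    ((Finset.univ.filter fun K : T.elements => x ∈ K.1).card : ℝ) ≤ (κ⁻¹) ^ (n + 1) := by
  set S := Finset.univ.filter fun K : T.elements => x ∈ K.1
  have hκ := (hT K₀).kpos
  have hh := (hT K₀).hpos
  -- The elements around `x` overlap in null sets and lie in the ball of radius `h` about `x`, and
  -- each of them contains a ball of radius `κ h`.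
  have h1 : volume.real (⋃ K ∈ S, hull K.1) = ∑ K ∈ S, volume.real (hull K.1) :=
    measureReal_biUnion_finset₀ (fun K _ K' _ hne => T.aedisjoint_hull hne)
      (fun K _ => (measurableSet_hull _).nullMeasurableSet) fun K _ => volume_hull_ne_top _
  have h2 : volume.real (⋃ K ∈ S, hull K.1) ≤ h ^ (n + 1) * ballVol n := by
    rw [← volume_closedBall_eq x hh.le]
    refine measureReal_mono (Set.iUnion₂_subset fun K hK => ?_) measure_closedBall_lt_top.ne
    exact subset_closedBall_of_mem (hT K) (mem_hull_of_mem (Finset.mem_filter.1 hK).2)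
  have h3 : S.card • ((κ * h) ^ (n + 1) * ballVol n) ≤ ∑ K ∈ S, volume.real (hull K.1) :=
    Finset.card_nsmul_le_sum _ _ _ fun K _ => (hT K).le_volume
  rw [← h1, nsmul_eq_mul] at h3
  have h4 := h3.trans h2
  have h5 := ballVol_pos n
  rw [inv_pow, ← one_div, le_div_iff₀ (by positivity)]
  refine le_of_mul_le_mul_right ?_ (show 0 < h ^ (n + 1) * ballVol n by positivity)
  calc _ = (S.card : ℝ) * ((κ * h) ^ (n + 1) * ballVol n) := by ring
    _ ≤ _ := by linarith

/-- `K` and `K'` share an edge/face that contains the vertex `x`. -/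
def Adjacent (x : E (n + 1)) (K K' : T.elements) : Prop :=
  ∃ e : T.sides, x ∈ e.1 ∧ e.1 ⊆ K.1 ∧ e.1 ⊆ K'.1

/-- `K` has an edge/face on the boundary that contains the vertex `x`. -/
def OnBoundary (x : E (n + 1)) (K : T.elements) : Prop :=
  ∃ e : T.sides, x ∈ e.1 ∧ e.1 ⊆ K.1 ∧ hull e.1 ⊆ frontier Ω

/-- The simplices without the vertex `x` form a finite union of closed sets that misses `x`. Near
`x`, therefore, only faces through `x` can be crossed. -/
lemma exists_ball_of_vertex {K : T.elements} {x : E (n + 1)} (hx : x ∈ K.1) :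
    ∃ δ > 0, ∀ y ∈ Metric.ball x δ, ∀ s ∈ T.faces, y ∈ hull s → x ∈ s := by
  have hfin : {s ∈ T.faces | x ∉ s}.Finite := T.finite_faces.subset fun s hs => hs.1
  have hclosed : IsClosed (⋃ s ∈ {s ∈ T.faces | x ∉ s}, hull s) :=
    hfin.isClosed_biUnion fun s _ => (isCompact_hull s).isClosed
  have hx' : x ∈ (⋃ s ∈ {s ∈ T.faces | x ∉ s}, hull s)ᶜ := by
    simp only [Set.mem_compl_iff, Set.mem_iUnion, Set.mem_ofPred_eq, not_exists]
    exact fun s hs hxs => hs.2 (T.vertex_mem hx hs.1 hxs)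
  obtain ⟨δ, hδ, hb⟩ := Metric.isOpen_iff.1 hclosed.isOpen_compl x hx'
  refine ⟨δ, hδ, fun y hy s hs hys => ?_⟩
  by_contra hxs
  exact hb hy (Set.mem_biUnion (⟨hs, hxs⟩ : s ∈ {s ∈ T.faces | x ∉ s}) hys)

lemma nonempty_interior_hull (K : T.elements) : (interior (hull K.1)).Nonempty := by
  rw [interior_convexHull_nonempty_iff_affineSpan_eq_top, ← range_vert,
    (T.vert_affineIndependent K).affineSpan_eq_top_iff_card_eq_finrank_add_one]
  simp

lemma nonempty_ball_inter_interior {K : T.elements} {x : E (n + 1)} (hx : x ∈ K.1) {δ : ℝ}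
    (hδ : 0 < δ) : (Metric.ball x δ ∩ interior (hull K.1)).Nonempty := by
  have h1 : hull K.1 ⊆ closure (interior (hull K.1)) := by
    rw [(convex_convexHull ℝ _).closure_interior_eq_closure_of_nonempty_interior
      (nonempty_interior_hull K)]
    exact subset_closure
  exact mem_closure_iff.1 (h1 (mem_hull_of_mem hx)) _ Metric.isOpen_ball (Metric.mem_ball_self hδ)

/-- The star of a vertex is connected across edges/faces, unless the boundary intervenes. -/
lemma star_connected (hΩ : IsOpen Ω) {x : E (n + 1)} {K K' : T.elements} (hK : x ∈ K.1)
    (hK' : x ∈ K'.1) :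
    Relation.ReflTransGen (Adjacent x) K K' ∨
      ∃ K₁, Relation.ReflTransGen (Adjacent x) K K₁ ∧ OnBoundary x K₁ := by
  classical
  by_contra! hcon
  obtain ⟨hK1, hS⟩ := hcon
  set S : Set T.elements := {K₁ | Relation.ReflTransGen (Adjacent x) K K₁}
  obtain ⟨δ, hδ, hball⟩ := exists_ball_of_vertex hK
  -- Interior points of `K` and `K'` near `x` are joined by a segment that misses all simplices of
  -- codimension two or more.
  obtain ⟨p, hp, q, hq, hpq⟩ := exists_segment_disjoint (F := {s ∈ T.faces | s.card ≤ n})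
    (T.finite_faces.subset fun s hs => hs.1) (fun s hs => hs.2)
    (Metric.isOpen_ball.inter isOpen_interior) (Metric.isOpen_ball.inter isOpen_interior)
    (nonempty_ball_inter_interior hK hδ) (nonempty_ball_inter_interior hK' hδ)
  have hseg : segment ℝ p q ⊆ Metric.ball x δ := (convex_ball x δ).segment_subset hp.1 hq.1
  have hcard : ∀ z ∈ segment ℝ p q, ∀ s ∈ T.faces, z ∈ hull s → n + 1 ≤ s.card := fun z hz s hs hzs => by
    by_contra hc
    exact hpq z hz s ⟨hs, by omega⟩ hzs
  -- Two distinct elements through a point `z` of the segment meet in a simplex with at least `n +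
  -- 1` vertices, so in an edge/face, and this contains `x` because `z` is close to `x`. Hence
  -- reachability spreads along the segment.
  have hadj : ∀ z ∈ segment ℝ p q, ∀ K₁ K₂ : T.elements, z ∈ hull K₁.1 → z ∈ hull K₂.1 →
      K₁ ∈ S → K₂ ∈ S := fun z hz K₁ K₂ h1 h2 hK₁ => by
    rcases eq_or_ne K₁ K₂ with rfl | hne
    · exact hK₁
    have hf := T.inter_mem_faces (T.element_mem K₁) (T.element_mem K₂) h1 h2
    have hm := T.mem_hull_inter (T.element_mem K₁) (T.element_mem K₂) h1 h2
    have hc : (K₁.1 ∩ K₂.1).card = n + 1 := le_antisymm (T.card_inter_le hne) (hcard z hz _ hf hm)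
    refine Relation.ReflTransGen.tail hK₁ ⟨⟨_, T.mem_sides.2 ⟨hf, hc⟩⟩, ?_,
      Finset.inter_subset_left, Finset.inter_subset_right⟩
    exact hball z (hseg hz) _ hf hm
  have hF1 : IsClosed (⋃ K₁ ∈ S, hull K₁.1) :=
    (Set.toFinite S).isClosed_biUnion fun K₁ _ => (isCompact_hull _).isClosed
  have hF2 : IsClosed ((⋃ K₁ ∈ Sᶜ, hull K₁.1) ∪ Ωᶜ) :=
    ((Set.toFinite Sᶜ).isClosed_biUnion fun K₁ _ => (isCompact_hull _).isClosed).union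
      hΩ.isClosed_compl
  have hpre : IsPreconnected (segment ℝ p q) := (convex_segment p q).isPreconnected
  -- The segment is covered by two closed sets, the reachable elements and the rest together with
  -- the complement of `Ω`. Both meet the segment, so they share a point `z` on it. If `z` lies in
  -- an unreachable element, `hadj` is contradicted; otherwise `z` is a boundary point of a
  -- reachable element, and that element has a boundary edge/face through `x`.
  obtain ⟨z, hz, hz1, hz2⟩ := isPreconnected_closed_iff.1 hpre _ _ hF1 hF2 (fun z _ => by
      by_cases hzΩ : z ∈ Ω
      · obtain ⟨K₁, hz1⟩ := T.exists_mem_hull (subset_closure hzΩ)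
        by_cases hK₁ : K₁ ∈ S
        · exact Or.inl (Set.mem_biUnion hK₁ hz1)
        · exact Or.inr (Or.inl (Set.mem_biUnion hK₁ hz1))
      · exact Or.inr (Or.inr hzΩ))
    ⟨p, left_mem_segment ℝ p q, Set.mem_biUnion (show K ∈ S from Relation.ReflTransGen.refl)
      (interior_subset hp.2)⟩
    ⟨q, right_mem_segment ℝ p q, Or.inl (Set.mem_biUnion (show K' ∈ Sᶜ from hK1)
      (interior_subset hq.2))⟩
  obtain ⟨K₁, hK₁, hzK₁⟩ := Set.mem_iUnion₂.1 hz1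
  rcases hz2 with hz2 | hz2
  · obtain ⟨K₂, hK₂, hzK₂⟩ := Set.mem_iUnion₂.1 hz2
    exact hK₂ (hadj z hz K₁ K₂ hzK₁ hzK₂ hK₁)
  · have hzf : z ∈ frontier Ω := by
      rw [frontier, hΩ.interior_eq]
      exact ⟨T.hull_subset_closure K₁ hzK₁, hz2⟩
    obtain ⟨e, he, hze⟩ := T.exists_side_of_mem_frontier hzf
    have hf := T.inter_mem_faces (T.element_mem K₁) (T.side_mem e) hzK₁ hze
    have hm := T.mem_hull_inter (T.element_mem K₁) (T.side_mem e) hzK₁ hze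
    have h1 := hcard z hz _ hf hm
    have h2 : K₁.1 ∩ e.1 = e.1 := Finset.eq_of_subset_of_card_le Finset.inter_subset_right
      (by rw [(T.mem_sides.1 e.2).2]; exact h1)
    rw [h2] at hm
    exact hS K₁ hK₁ ⟨e, hball z (hseg hz) _ (T.side_mem e) hm, Finset.inter_eq_right.1 h2, he⟩

open Classical in
/-- Differences along the star of a vertex. -/
lemma abs_sub_le_of_reachable {x : E (n + 1)} {c g : T.elements → ℝ} (hg : ∀ K, 0 ≤ g K)
    (hc : ∀ K K' : T.elements, Adjacent x K K' → |c K - c K'| ≤ g K + g K') {K K' : T.elements}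
    (hK : x ∈ K.1) (hr : Relation.ReflTransGen (Adjacent x) K K') :
    x ∈ K'.1 ∧ |c K - c K'| ≤ 2 * ∑ K₁ ∈ Finset.univ.filter (fun K₁ : T.elements => x ∈ K₁.1), g K₁ := by
  let V := {K₁ : T.elements // x ∈ K₁.1}
  let G : SimpleGraph V := SimpleGraph.fromRel fun a b => Adjacent x a.1 b.1
  have hmem : ∀ K', Relation.ReflTransGen (Adjacent x) K K' →
      ∃ h : x ∈ K'.1, G.Reachable ⟨K, hK⟩ ⟨K', h⟩ := by
    intro K' hr
    induction hr with
    | refl => exact ⟨hK, SimpleGraph.Reachable.refl _⟩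
    | @tail b c _ hbc ih =>
      obtain ⟨hb, hrb⟩ := ih
      have hcx : x ∈ c.1 := by
        obtain ⟨e, he, -, hec⟩ := hbc
        exact hec he
      refine ⟨hcx, ?_⟩
      rcases eq_or_ne (⟨b, hb⟩ : V) ⟨c, hcx⟩ with heq | hne
      · rwa [← heq]
      · exact hrb.trans (SimpleGraph.Adj.reachable
          ((SimpleGraph.fromRel_adj _ _ _).2 ⟨hne, Or.inl hbc⟩))
  obtain ⟨hK', hreach⟩ := hmem K' hr
  refine ⟨hK', ?_⟩
  have hwalk : ∀ {a b : V} (p : G.Walk a b),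
      |c a.1 - c b.1| ≤ 2 * (p.support.map fun a => g a.1).sum - g a.1 - g b.1 := by
    intro a b p
    induction p with
    | nil =>
      simp
      linarith
    | @cons a b d hab p ih =>
      have h1 : |c a.1 - c b.1| ≤ g a.1 + g b.1 := by
        rcases ((SimpleGraph.fromRel_adj _ _ _).1 hab).2 with h | h
        · exact hc _ _ h
        · have := hc _ _ h
          rw [abs_sub_comm] at this
          linarith
      have h2 := abs_sub_le (c a.1) (c b.1) (c d.1)
      simp only [SimpleGraph.Walk.support_cons, List.map_cons, List.sum_cons]
      linarith
  -- A path visits each element at most once, so the sum of `g` along it is at most the sum over all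
  -- elements around `x`. In `hwalk` every visited element is counted twice, once for each neighbour
  -- on the walk.
  obtain ⟨p, hp⟩ := hreach.exists_isPath
  have h1 := hwalk p
  have h2 : (p.support.map fun a => g a.1).sum ≤
      ∑ K₁ ∈ Finset.univ.filter (fun K₁ : T.elements => x ∈ K₁.1), g K₁ := by
    rw [← List.sum_toFinset _ hp.support_nodup]
    refine (Finset.sum_le_sum_of_subset_of_nonneg (Finset.subset_univ _)
      fun a _ _ => hg a.1).trans (le_of_eq ?_)
    exact (Finset.sum_subtype _ (fun a => by simp) g).symm
  have h3 := hg K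
  have h4 := hg K'
  linarith

open Classical in
/-- Nodal values that vanish on the boundary and are close to the given element values. -/
lemma exists_nodal (hΩ : IsOpen Ω) {c g : T.elements → ℝ} (hg : ∀ K, 0 ≤ g K)
    (hc : ∀ x (K K' : T.elements), Adjacent x K K' → |c K - c K'| ≤ g K + g K')
    (hb : ∀ x (K : T.elements), OnBoundary x K → |c K| ≤ g K) :
    ∃ f : E (n + 1) → ℝ, (∀ x ∈ frontier Ω, f x = 0) ∧ ∀ (K : T.elements), ∀ x ∈ K.1,
      |f x - c K| ≤ 3 * ∑ K₁ ∈ Finset.univ.filter (fun K₁ : T.elements => x ∈ K₁.1), g K₁ := by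
  have hbdry : ∀ x (K K₁ : T.elements), x ∈ K.1 → Relation.ReflTransGen (Adjacent x) K K₁ →
      OnBoundary x K₁ → |c K| ≤
        3 * ∑ K₁ ∈ Finset.univ.filter (fun K₁ : T.elements => x ∈ K₁.1), g K₁ := by
    intro x K K₁ hx hr hB
    obtain ⟨hx1, h1⟩ := abs_sub_le_of_reachable hg (hc x) hx hr
    have h2 := hb x K₁ hB
    have h3 : g K₁ ≤ ∑ K₁ ∈ Finset.univ.filter (fun K₁ : T.elements => x ∈ K₁.1), g K₁ :=
      Finset.single_le_sum (fun K _ => hg K) (by simpa using hx1)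
    have h4 := abs_add_le (c K - c K₁) (c K₁)
    rw [sub_add_cancel] at h4
    linarith
  -- At a vertex off the boundary the value of an arbitrary adjacent element is taken, and zero on
  -- the boundary. If the chain between two elements is blocked by the boundary, then the vertex
  -- itself lies there and the value zero is compared through `hbdry`.
  refine ⟨fun x => if hx : x ∉ frontier Ω ∧ ∃ K : T.elements, x ∈ K.1 then c hx.2.choose else 0,
    fun x hx => by simp [hx], fun K x hx => ?_⟩
  have hsum : 0 ≤ ∑ K₁ ∈ Finset.univ.filter (fun K₁ : T.elements => x ∈ K₁.1), g K₁ :=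
    Finset.sum_nonneg fun K _ => hg K
  by_cases hxf : x ∈ frontier Ω
  · beta_reduce
    rw [dif_neg (fun h => h.1 hxf), zero_sub, abs_neg]
    obtain ⟨e, he, hxe⟩ := T.exists_side_of_mem_frontier hxf
    obtain ⟨K', hK'⟩ := T.exists_element (T.side_mem e)
    have hxe' := T.vertex_mem hx (T.side_mem e) hxe
    rcases star_connected hΩ hx (hK' hxe') with h | ⟨K₁, h, hB⟩
    · exact hbdry x K K' hx h ⟨e, hxe', hK', he⟩
    · exact hbdry x K K₁ hx h hB
  · have hex : x ∉ frontier Ω ∧ ∃ K : T.elements, x ∈ K.1 := ⟨hxf, K, hx⟩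
    beta_reduce
    rw [dif_pos hex]
    rcases star_connected hΩ hex.2.choose_spec hx with h | ⟨K₁, h, e, hxe, -, he⟩
    · have := (abs_sub_le_of_reachable hg (hc x) hex.2.choose_spec h).2
      linarith
    · exact (hxf (he (mem_hull_of_mem hxe))).elim

variable (T)

lemma diam_le_meshSize (K : T.elements) : Metric.diam (hull K.1) ≤ T.meshSize :=
  le_ciSup (f := fun K : T.elements => Metric.diam (hull K.1)) (Set.finite_range _).bddAbove K

/-- `h ≤ τ diam K ≤ τ σ r`, so the ball contained in `K` has radius at least `h / (σ τ)`. The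
existence of an element already makes `σ` and `τ` positive. -/
lemma isSized {σ τ : ℝ} (hs : T.IsShapeRegular σ) (hq : T.IsQuasiUniform τ) (K : T.elements) :
    IsSized K (1 / (σ * τ)) T.meshSize := by
  obtain ⟨c, r, hr, hb, hd⟩ := hs K.1 K.2
  have hq' := hq K.1 K.2
  have hd0 : 0 < Metric.diam (hull K.1) := by
    have h1 : 0 < Metric.diam (Metric.ball c r) := by
      rw [Metric.diam_ball_eq _ hr.le]
      positivity
    exact h1.trans_le (Metric.diam_mono hb (isCompact_hull _).isBounded)
  have hh : 0 < T.meshSize := hd0.trans_le (T.diam_le_meshSize K)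
  have hσ : 0 < σ := (mul_pos_iff_of_pos_right hr).1 (hd0.trans_le hd)
  have hτ : 0 < τ := (mul_pos_iff_of_pos_right hd0).1 (hh.trans_le hq')
  refine ⟨by positivity, hh, T.diam_le_meshSize K, c, (Metric.ball_subset_ball ?_).trans hb⟩
  rw [one_div, inv_mul_le_iff₀ (by positivity)]
  calc T.meshSize ≤ τ * Metric.diam (hull K.1) := hq'
    _ ≤ τ * (σ * r) := by gcongr
    _ = _ := by ring

end Mesh

end

section

variable {n : ℕ} {Ω : Set (E (n + 1))} {α β : ℝ} {𝔸 : E (n + 1) → Matrix (Fin (n + 1)) (Fin (n + 1)) ℝ}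

/-! ### The diffusion coefficient -/

/-- Polarization with the sum and difference of two unit vectors. Bounded entries make the
integrands of the energy integrable. -/
lemma IsDiffusion.abs_le (h𝔸 : IsDiffusion Ω α β 𝔸) (hα : 0 < α) {x : E (n + 1)} (hx : x ∈ Ω)
    (i k : Fin (n + 1)) : |𝔸 x i k| ≤ β := by
  have hpos : ∀ ξ : Fin (n + 1) → ℝ, 0 ≤ ξ ⬝ᵥ (𝔸 x *ᵥ ξ) := fun ξ => by
    refine le_trans (mul_nonneg hα.le ?_) (h𝔸.lower x hx ξ)
    exact Finset.sum_nonneg fun _ _ => mul_self_nonneg _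
  have hs : 𝔸 x k i = 𝔸 x i k := congrFun (congrFun (h𝔸.symm x hx) i) k
  set a : Fin (n + 1) → ℝ := Pi.single i 1
  set b : Fin (n + 1) → ℝ := Pi.single k 1
  have h1 : a ⬝ᵥ (𝔸 x *ᵥ b) = 𝔸 x i k := by simp [a, b]
  have h2 : b ⬝ᵥ (𝔸 x *ᵥ a) = 𝔸 x i k := by simp [a, b, hs]
  have hβ : 0 ≤ β := by
    have h3 := (hpos a).trans (h𝔸.upper x hx a)
    simpa [a] using h3
  have hab : a ⬝ᵥ b ≤ 1 ∧ 0 ≤ a ⬝ᵥ b := by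
    simp only [a, b, single_dotProduct, one_mul, Pi.single_apply]
    split_ifs <;> norm_num
  have haa : a ⬝ᵥ a = 1 := by simp [a]
  have hbb : b ⬝ᵥ b = 1 := by simp [b]
  have hba : b ⬝ᵥ a = a ⬝ᵥ b := dotProduct_comm _ _
  have e1 := h𝔸.upper x hx (a + b)
  have e2 := hpos (a - b)
  have e3 := h𝔸.upper x hx (a - b)
  have e4 := hpos (a + b)
  simp only [Matrix.mulVec_add, Matrix.mulVec_sub, add_dotProduct, dotProduct_add, sub_dotProduct,
    dotProduct_sub, h1, h2, haa, hbb, hba] at e1 e2 e3 e4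
  rw [_root_.abs_le]
  constructor <;> nlinarith [mul_le_mul_of_nonneg_left hab.1 hβ, mul_nonneg hβ hab.2]

namespace Mesh

variable (T : Mesh (n + 1) Ω)

/-- Elements lie only in the closure of `Ω`, while the coefficient is controlled on `Ω`; the
difference is a null set because the boundary consists of edges/faces. -/
lemma ae_mem (hΩ : IsOpen Ω) (K : T.elements) : ∀ᵐ x ∂(volume.restrict (hull K.1)), x ∈ Ω := by
  have h1 : ∀ᵐ x ∂(volume.restrict (hull K.1)), x ∉ frontier Ω :=
    ae_restrict_of_ae (measure_eq_zero_iff_ae_notMem.1 T.volume_frontier)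
  filter_upwards [h1, ae_restrict_mem (measurableSet_hull _)] with x h hx
  by_contra hxΩ
  refine h ?_
  rw [frontier, hΩ.interior_eq]
  exact ⟨T.hull_subset_closure K hx, hxΩ⟩

lemma restrict_le (hΩ : IsOpen Ω) (K : T.elements) :
    volume.restrict (hull K.1) ≤ volume.restrict Ω := by
  refine Measure.restrict_mono_ae ?_
  exact (ae_restrict_iff' (measurableSet_hull _)).1 (T.ae_mem hΩ K)

variable {T}

lemma integrableOn_entry (hΩ : IsOpen Ω) (h𝔸 : IsDiffusion Ω α β 𝔸) (hα : 0 < α) (K : T.elements)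
    (i k : Fin (n + 1)) : IntegrableOn (fun x => 𝔸 x i k) (hull K.1) := by
  have : IsFiniteMeasure (volume.restrict (hull K.1)) :=
    isFiniteMeasure_restrict.2 (volume_hull_ne_top _)
  refine Integrable.of_bound
    ((h𝔸.measurable i k).mono_measure (T.restrict_le hΩ K)).aestronglyMeasurable β ?_
  filter_upwards [T.ae_mem hΩ K] with x hx using h𝔸.abs_le hα hx i k

lemma continuous_vval (q : VecPoly n) : Continuous (vval q) :=
  continuous_pi fun i => (continuous_eval (q i)).comp (PiLp.continuous_ofLp 2 _)

lemma integrableOn_diffusion (hΩ : IsOpen Ω) (h𝔸 : IsDiffusion Ω α β 𝔸) (hα : 0 < α)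
    (K : T.elements) (p q : VecPoly n) :
    IntegrableOn (fun x => (𝔸 x *ᵥ vval p x) ⬝ᵥ vval q x) (hull K.1) := by
  simp only [Matrix.mulVec, dotProduct, Finset.sum_mul]
  refine integrable_finsetSum _ fun i _ => integrable_finsetSum _ fun k _ => ?_
  have h1 := (integrableOn_entry hΩ h𝔸 hα K i k).mul_continuousOn
    (g' := fun x => vval p x k * vval q x i) (Continuous.continuousOn
    (((continuous_apply k).comp (continuous_vval p)).mul
      ((continuous_apply i).comp (continuous_vval q)))) (isCompact_hull _)
  simp only [mul_assoc]
  exact h1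

lemma vval_add (p q : VecPoly n) (x : E (n + 1)) : vval (p + q) x = vval p x + vval q x := by
  ext i
  simp [vval, pval]

lemma vval_smul (c : ℝ) (p : VecPoly n) (x : E (n + 1)) : vval (c • p) x = c • vval p x := by
  ext i
  simp [vval, pval, smul_eval]

/-- The form `∫_K (𝔸 p) · q` on polynomial vector fields. -/
def diffForm (hΩ : IsOpen Ω) (h𝔸 : IsDiffusion Ω α β 𝔸) (hα : 0 < α) (K : T.elements) :
    LinearMap.BilinForm ℝ (VecPoly n) :=
  LinearMap.mk₂ ℝ (fun p q => ∫ x in hull K.1, (𝔸 x *ᵥ vval p x) ⬝ᵥ vval q x)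
    (fun p p' q => by
      simp only [vval_add, Matrix.mulVec_add, add_dotProduct]
      exact integral_add (integrableOn_diffusion hΩ h𝔸 hα K p q)
        (integrableOn_diffusion hΩ h𝔸 hα K p' q))
    (fun c p q => by
      simp only [vval_smul, Matrix.mulVec_smul, smul_dotProduct]
      exact integral_smul _ _)
    (fun p q q' => by
      simp only [vval_add, dotProduct_add]
      exact integral_add (integrableOn_diffusion hΩ h𝔸 hα K p q)
        (integrableOn_diffusion hΩ h𝔸 hα K p q'))
    (fun c p q => by
      simp only [vval_smul, dotProduct_smul]
      exact integral_smul _ _)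

variable {hΩ : IsOpen Ω} {h𝔸 : IsDiffusion Ω α β 𝔸} {hα : 0 < α} {K : T.elements}

lemma diffForm_apply (p q : VecPoly n) :
    diffForm hΩ h𝔸 hα K p q = ∫ x in hull K.1, (𝔸 x *ᵥ vval p x) ⬝ᵥ vval q x := rfl

lemma integrableOn_vval (K : T.elements) (q : VecPoly n) :
    IntegrableOn (fun x => vval q x ⬝ᵥ vval q x) (hull K.1) :=
  (Continuous.continuousOn ((continuous_vval q).dotProduct
    (continuous_vval q))).integrableOn_compact (isCompact_hull _)

lemma le_diffForm (q : VecPoly n) :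
    α * ∫ x in hull K.1, vval q x ⬝ᵥ vval q x ≤ diffForm hΩ h𝔸 hα K q q := by
  rw [diffForm_apply, ← integral_const_mul]
  refine integral_mono_ae ((integrableOn_vval K q).const_mul α)
    (integrableOn_diffusion hΩ h𝔸 hα K q q) ?_
  filter_upwards [T.ae_mem hΩ K] with x hx
  rw [dotProduct_comm (𝔸 x *ᵥ _)]
  exact h𝔸.lower x hx _

lemma diffForm_le (q : VecPoly n) :
    diffForm hΩ h𝔸 hα K q q ≤ β * ∫ x in hull K.1, vval q x ⬝ᵥ vval q x := by
  rw [diffForm_apply, ← integral_const_mul]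
  refine integral_mono_ae (integrableOn_diffusion hΩ h𝔸 hα K q q)
    ((integrableOn_vval K q).const_mul β) ?_
  filter_upwards [T.ae_mem hΩ K] with x hx
  rw [dotProduct_comm (𝔸 x *ᵥ _)]
  exact h𝔸.upper x hx _

lemma diffForm_symm (p q : VecPoly n) :
    diffForm hΩ h𝔸 hα K p q = diffForm hΩ h𝔸 hα K q p := by
  rw [diffForm_apply, diffForm_apply]
  refine integral_congr_ae ?_
  filter_upwards [T.ae_mem hΩ K] with x hx
  have h1 : (𝔸 x)ᵀ = 𝔸 x := h𝔸.symm x hx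
  conv_lhs => rw [← h1, Matrix.mulVec_transpose, ← Matrix.dotProduct_mulVec]
  exact dotProduct_comm _ _

lemma integral_vval_nonneg (K : T.elements) (q : VecPoly n) :
    0 ≤ ∫ x in hull K.1, vval q x ⬝ᵥ vval q x :=
  integral_nonneg fun _ => Finset.sum_nonneg fun _ _ => mul_self_nonneg _

lemma diffForm_isSemiInner (hΩ : IsOpen Ω) (h𝔸 : IsDiffusion Ω α β 𝔸) (hα : 0 < α)
    (K : T.elements) : IsSemiInner (diffForm hΩ h𝔸 hα K) :=
  ⟨diffForm_symm, fun q => (mul_nonneg hα.le (integral_vval_nonneg K q)).trans (le_diffForm q)⟩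

/-- Constant vector fields. -/
def constField (n : ℕ) : E (n + 1) →ₗ[ℝ] VecPoly n where
  toFun a k := C (a k)
  map_add' a b := by
    ext1 k
    simp
  map_smul' c a := by
    ext1 k
    simp [smul_eq_C_mul]

lemma vval_constField (a x : E (n + 1)) : vval (constField n a) x = a.ofLp := by
  ext k
  simp [vval, pval, constField]

lemma setIntegral_constField (K : T.elements) (a : E (n + 1)) :
    ∫ x in hull K.1, vval (constField n a) x ⬝ᵥ vval (constField n a) x =
      volume.real (hull K.1) * ‖a‖ ^ 2 := by
  simp only [vval_constField, setIntegral_const, smul_eq_mul, norm_sq_eq_sum, dotProduct, ← sq]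

/-! ### Piecewise linear functions -/

lemma exists_affine_of_mem_Pol {p : MvPolynomial (Fin (n + 1)) ℝ} (hp : p ∈ Pol (n + 1) 1) :
    ∃ (c : ℝ) (a : E (n + 1)), ∀ x, pval p x = c + inner ℝ a x := by
  obtain ⟨c, q, hq, rfl⟩ := exists_eq_C_add_sum_X_mul (k := 0) hp
  have h1 : ∀ i, ∃ b, q i = C b := fun i => by
    have h2 := hq i
    rw [mem_Pol, Nat.le_zero] at h2
    exact ⟨_, totalDegree_eq_zero_iff_eq_C.1 h2⟩
  choose b hb using h1
  refine ⟨c, WithLp.toLp 2 b, fun x => ?_⟩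
  simp [pval, hb, PiLp.inner_apply, mul_comm]

/-- The polynomial `c + a · x`. -/
def affPoly (c : ℝ) (a : E (n + 1)) : MvPolynomial (Fin (n + 1)) ℝ := C c + ∑ i, C (a i) * X i

lemma affPoly_mem (c : ℝ) (a : E (n + 1)) : affPoly c a ∈ Pol (n + 1) 1 := by
  refine Submodule.add_mem _ (C_mem_Pol _) (Submodule.sum_mem _ fun i _ => ?_)
  refine C_mul_mem_Pol ?_ _
  rw [mem_Pol, totalDegree_X]

lemma pval_affPoly (c : ℝ) (a x : E (n + 1)) : pval (affPoly c a) x = c + inner ℝ a x := by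
  simp [affPoly, pval, PiLp.inner_apply, mul_comm]

lemma exists_affine_interp (K : T.elements) (f : E (n + 1) → ℝ) :
    ∃ (c : ℝ) (a : E (n + 1)), ∀ x ∈ K.1, c + inner ℝ a x = f x := by
  have hy := T.vert_affineIndependent K
  set y := T.vert K
  let a : E (n + 1) := WithLp.toLp 2 fun k => ∑ l, (f (y l.succ) - f (y 0)) * chartInv y l k
  have h1 : ∀ m : Fin (n + 1), inner ℝ a (y m.succ - y 0) = f (y m.succ) - f (y 0) := fun m => by
    have h2 : inner ℝ a (y m.succ - y 0) =
        ∑ l, (f (y l.succ) - f (y 0)) * (chartInv y * chartMat y) l m := by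
      simp only [a, PiLp.inner_apply, Matrix.mul_apply, Finset.mul_sum]
      rw [Finset.sum_comm]
      refine Finset.sum_congr rfl fun k _ => ?_
      simp only [RCLike.inner_apply, conj_trivial, Finset.mul_sum, chartMat]
      exact Finset.sum_congr rfl fun l _ => by ring
    rw [h2, chartInv_mul hy]
    simp [Matrix.one_apply]
  refine ⟨f (y 0) - inner ℝ a (y 0), a, fun x hx => ?_⟩
  obtain ⟨i, rfl⟩ : x ∈ Set.range y := by
    rw [T.range_vert K]
    exact hx
  refine Fin.cases ?_ (fun m => ?_) i
  · ring
  · have h2 := h1 m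
    rw [inner_sub_right] at h2
    linarith

/-- Affine inequalities extend from the vertices to a simplex. -/
lemma affine_le_of_vertices {s : Finset (E (n + 1))} {c b : ℝ} {a : E (n + 1)}
    (h : ∀ x ∈ s, c + inner ℝ a x ≤ b) {x : E (n + 1)} (hx : x ∈ hull s) : c + inner ℝ a x ≤ b := by
  have hconv : Convex ℝ {x : E (n + 1) | c + inner ℝ a x ≤ b} := by
    have := convex_halfSpace_le (𝕜 := ℝ) (f := fun x : E (n + 1) => inner ℝ a x)
      (innerSL ℝ a).toLinearMap.isLinear (b - c)
    convert! this using 2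
    ext x
    constructor <;> intro h <;> linarith
  exact convexHull_min (fun x hx => h x hx) hconv hx

lemma abs_affine_le_of_vertices {s : Finset (E (n + 1))} {c b : ℝ} {a : E (n + 1)}
    (h : ∀ x ∈ s, |c + inner ℝ a x| ≤ b) {x : E (n + 1)} (hx : x ∈ hull s) :
    |c + inner ℝ a x| ≤ b := by
  refine abs_le.2 ⟨?_, affine_le_of_vertices (fun y hy => (abs_le.1 (h y hy)).2) hx⟩
  have := affine_le_of_vertices (s := s) (c := -c) (a := -a) (b := b) (fun y hy => by
    have := (abs_le.1 (h y hy)).1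
    rw [inner_neg_left]
    linarith) hx
  rw [inner_neg_left] at this
  linarith

lemma affine_eq_of_vertices {s : Finset (E (n + 1))} {c c' : ℝ} {a a' : E (n + 1)}
    (h : ∀ x ∈ s, c + inner ℝ a x = c' + inner ℝ a' x) {x : E (n + 1)} (hx : x ∈ hull s) :
    c + inner ℝ a x = c' + inner ℝ a' x := by
  have := abs_affine_le_of_vertices (s := s) (c := c - c') (a := a - a') (b := 0) (fun y hy => by
    rw [inner_sub_left, show c - c' + (inner ℝ a y - inner ℝ a' y) =
      c + inner ℝ a y - (c' + inner ℝ a' y) by ring, h y hy, sub_self, abs_zero]) hx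
  rw [inner_sub_left] at this
  have := abs_nonpos_iff.1 this
  linarith

/-- In the direction of `a` the affine function varies by nearly `2 κ h ‖a‖` across the inscribed
ball, and by at most `2 b` on the simplex. The ball is open, so the bound is reached as a limit of
radii. -/
lemma IsSized.norm_le {κ h : ℝ} (hK : IsSized K κ h) {c b : ℝ} {a : E (n + 1)}
    (hb : ∀ x ∈ K.1, |c + inner ℝ a x| ≤ b) : κ * h * ‖a‖ ≤ b := by
  rcases eq_or_ne a 0 with rfl | ha
  · obtain ⟨x, hx⟩ := T.nonempty_of_mem_faces (T.element_mem K)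
    rw [norm_zero, mul_zero]
    exact (abs_nonneg _).trans (hb x hx)
  obtain ⟨x, hx⟩ := hK.ball
  have hna : 0 < ‖a‖ := norm_pos_iff.2 ha
  have h1 : ∀ r ∈ Set.Ioo 0 (κ * h), r * ‖a‖ ≤ b := fun r hr => by
    have hin : inner ℝ a ((r / ‖a‖) • a) = r * ‖a‖ := by
      rw [real_inner_smul_right, real_inner_self_eq_norm_sq]
      field_simp
    have hn : ‖(r / ‖a‖) • a‖ < κ * h := by
      rw [norm_smul, Real.norm_of_nonneg (div_nonneg hr.1.le hna.le), div_mul_cancel₀ _ hna.ne']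
      exact hr.2
    have e1 := abs_affine_le_of_vertices hb (hx (show x + (r / ‖a‖) • a ∈ _ by simpa using hn))
    have e2 := abs_affine_le_of_vertices hb (hx (show x - (r / ‖a‖) • a ∈ _ by simpa using hn))
    rw [inner_add_right, hin] at e1
    rw [inner_sub_right, hin] at e2
    linarith [(abs_le.1 e1).2, (abs_le.1 e2).1]
  have h2 : ∀ r ∈ Set.Ioo 0 (κ * h), r ≤ b / ‖a‖ := fun r hr => (le_div_iff₀ hna).2 (h1 r hr)
  rw [← le_div_iff₀ hna]
  have hpos := mul_pos hK.kpos hK.hpos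
  by_contra hlt
  push Not at hlt
  obtain ⟨r, hr1, hr2⟩ := exists_between (max_lt hlt hpos)
  have := h2 r ⟨(le_max_right _ _).trans_lt hr1, hr2⟩
  exact (((le_max_left _ _).trans_lt hr1).trans_le this).false

lemma isCompact_closure (T : Mesh (n + 1) Ω) : IsCompact (closure Ω) := by
  rw [← T.iUnion_hull]
  exact isCompact_iUnion fun K => isCompact_hull _

/-- The piecewise linear function with given vertex values. -/
lemma exists_P1 (hΩ : IsOpen Ω) {f : E (n + 1) → ℝ} (hf : ∀ x ∈ frontier Ω, f x = 0) :
    ∃ w : T.P1, ∀ K : T.elements, ∀ x ∈ K.1, w.1 x = f x := by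
  classical
  choose c a hca using fun K : T.elements => exists_affine_interp K f
  let w : E (n + 1) → ℝ := fun x => if hx : ∃ K : T.elements, x ∈ hull K.1 then
    c hx.choose + inner ℝ (a hx.choose) x else 0
  have hw : ∀ K : T.elements, ∀ x ∈ hull K.1, w x = c K + inner ℝ (a K) x := fun K x hx => by
    have hex : ∃ K : T.elements, x ∈ hull K.1 := ⟨K, hx⟩
    simp only [w, dif_pos hex]
    -- Two elements through `x` meet in the hull of their common vertices, where both interpolants
    -- have the values of `f`; the choice of the element is thus immaterial.
    have hm := T.mem_hull_inter (T.element_mem _) (T.element_mem K) hex.choose_spec hx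
    refine affine_eq_of_vertices (fun y hy => ?_) hm
    rw [hca _ y (Finset.mem_inter.1 hy).1, hca _ y (Finset.mem_inter.1 hy).2]
  have hw0 : ∀ x, x ∉ Ω → w x = 0 := fun x hx => by
    by_cases hex : ∃ K : T.elements, x ∈ hull K.1
    · obtain ⟨K, hK⟩ := hex
      have hxf : x ∈ frontier Ω := by
        rw [frontier, hΩ.interior_eq]
        exact ⟨T.hull_subset_closure K hK, hx⟩
      obtain ⟨e, he, hxe⟩ := T.exists_side_of_mem_frontier hxf
      have hm := T.mem_hull_inter (T.element_mem K) (T.side_mem e) hK hxe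
      rw [hw K x hK]
      have := affine_eq_of_vertices (c' := 0) (a' := 0) (fun y hy => by
        rw [hca K y (Finset.mem_inter.1 hy).1,
          hf y (he (mem_hull_of_mem (Finset.mem_inter.1 hy).2))]
        simp) hm
      simpa using this
    · simp only [w, dif_neg hex]
  have hcont : Continuous w := by
    -- Continuity is checked on a finite closed cover, the elements and the complement of `Ω`.
    let S : Option T.elements → Set (E (n + 1)) := fun o => o.elim Ωᶜ fun K => hull K.1
    refine LocallyFinite.continuous (f := S) (locallyFinite_of_finite S) ?_ ?_ ?_
    · refine Set.eq_univ_of_forall fun x => ?_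
      by_cases hx : x ∈ Ω
      · obtain ⟨K, hK⟩ := T.exists_mem_hull (subset_closure hx)
        exact Set.mem_iUnion.2 ⟨some K, hK⟩
      · exact Set.mem_iUnion.2 ⟨none, hx⟩
    · rintro (_ | K)
      · exact hΩ.isClosed_compl
      · exact (isCompact_hull _).isClosed
    · rintro (_ | K)
      · exact continuousOn_const.congr (f := fun _ => (0 : ℝ)) hw0
      · refine ContinuousOn.congr (f := fun x => c K + inner ℝ (a K) x) ?_ (hw K)
        fun_prop
  refine ⟨⟨w, hcont, fun K hK => ⟨affPoly (c ⟨K, hK⟩) (a ⟨K, hK⟩), affPoly_mem _ _, fun x hx => ?_⟩,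
    hw0⟩, fun K x hx => ?_⟩
  · rw [hw ⟨K, hK⟩ x hx, pval_affPoly]
  · change w x = f x
    rw [hw K x (mem_hull_of_mem hx), hca K x hx]

lemma exists_affine_of_P1 (w : T.P1) (K : T.elements) :
    ∃ a : E (n + 1), ∃ c : ℝ, ∀ x ∈ hull K.1, w.1 x = c + inner ℝ a x := by
  obtain ⟨p, hp, h⟩ := w.2.2.1 K.1 K.2
  obtain ⟨c, a, hca⟩ := exists_affine_of_mem_Pol hp
  exact ⟨a, c, fun x hx => by rw [h x hx, hca]⟩

/-- The gradient of a piecewise linear function on an element. -/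
def elemGrad (w : T.P1) (K : T.elements) : E (n + 1) := (exists_affine_of_P1 w K).choose

lemma elemGrad_spec (w : T.P1) (K : T.elements) :
    ∃ c : ℝ, ∀ x ∈ hull K.1, w.1 x = c + inner ℝ (elemGrad w K) x :=
  (exists_affine_of_P1 w K).choose_spec

lemma gradient_eq (w : T.P1) {K : T.elements} {x : E (n + 1)} (hx : x ∈ interior (hull K.1)) :
    gradient w.1 x = elemGrad w K := by
  obtain ⟨c, hc⟩ := elemGrad_spec w K
  refine HasGradientAt.gradient ?_
  rw [hasGradientAt_iff_hasFDerivAt]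
  have h1 : HasFDerivAt (fun x : E (n + 1) => c + inner ℝ (elemGrad w K) x)
      (InnerProductSpace.toDual ℝ (E (n + 1)) (elemGrad w K)) x :=
    ((InnerProductSpace.toDual ℝ (E (n + 1)) (elemGrad w K)).hasFDerivAt).const_add c
  refine h1.congr_of_eventuallyEq ?_
  filter_upwards [isOpen_interior.mem_nhds hx] with y hy using hc y (interior_subset hy)

end Mesh

end

/-! ### The conforming space: gradient, energy and inner products -/

section

namespace Mesh

variable {n : ℕ} {Ω : Set (E (n + 1))} {T : Mesh (n + 1) Ω} {α β : ℝ}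
  {𝔸 : E (n + 1) → Matrix (Fin (n + 1)) (Fin (n + 1)) ℝ}

lemma slope_unique {K : T.elements} {c c' : ℝ} {a a' : E (n + 1)}
    (h : ∀ x ∈ hull K.1, c + inner ℝ a x = c' + inner ℝ a' x) : a = a' := by
  obtain ⟨x, hx⟩ := nonempty_interior_hull K
  have h1 : ∀ᶠ t : ℝ in nhds 0, x + t • (a - a') ∈ interior (hull K.1) := by
    have hc : Continuous fun t : ℝ => x + t • (a - a') := by fun_prop
    exact hc.continuousAt.eventually_mem (by simpa using isOpen_interior.mem_nhds hx)
  have h2 : ∀ᶠ t : ℝ in nhdsWithin 0 (Set.Ioi 0), x + t • (a - a') ∈ interior (hull K.1) :=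
    nhdsWithin_le_nhds h1
  obtain ⟨t, ht, ht0⟩ := (h2.and self_mem_nhdsWithin).exists
  have e1 := h _ (interior_subset hx)
  have e2 := h _ (interior_subset ht)
  have e3 : t * inner ℝ (a - a') (a - a') = 0 := by
    rw [← real_inner_smul_right, inner_sub_left]
    simp only [inner_add_right] at e2
    linarith
  rw [← sub_eq_zero]
  exact inner_self_eq_zero.1 ((mul_eq_zero.1 e3).resolve_left (ne_of_gt ht0))

/-- The gradient on an element as a linear map. -/
def elemGradL (K : T.elements) : T.P1 →ₗ[ℝ] E (n + 1) where
  toFun w := elemGrad w K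
  map_add' w z := by
    obtain ⟨c, hc⟩ := elemGrad_spec w K
    obtain ⟨c', hc'⟩ := elemGrad_spec z K
    obtain ⟨c'', hc''⟩ := elemGrad_spec (w + z) K
    refine slope_unique (K := K) (c := c'') (c' := c + c') fun x hx => ?_
    rw [← hc'' x hx, inner_add_left]
    change w.1 x + z.1 x = _
    rw [hc x hx, hc' x hx]
    ring
  map_smul' b w := by
    obtain ⟨c, hc⟩ := elemGrad_spec w K
    obtain ⟨c'', hc''⟩ := elemGrad_spec (b • w) K
    refine slope_unique (K := K) (c := c'') (c' := b * c) fun x hx => ?_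
    rw [← hc'' x hx, RingHom.id_apply, real_inner_smul_left]
    change b * w.1 x = _
    rw [hc x hx]
    ring

/-- The form `(𝔸 ∇w, ∇z)` as a bilinear form. -/
def acForm (hΩ : IsOpen Ω) (h𝔸 : IsDiffusion Ω α β 𝔸) (hα : 0 < α) :
    LinearMap.BilinForm ℝ T.P1 :=
  ∑ K, (diffForm hΩ h𝔸 hα K).compl₁₂ (constField n ∘ₗ elemGradL K) (constField n ∘ₗ elemGradL K)

variable {hΩ : IsOpen Ω} {h𝔸 : IsDiffusion Ω α β 𝔸} {hα : 0 < α}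

lemma acForm_apply (w z : T.P1) : acForm hΩ h𝔸 hα w z =
    ∑ K, diffForm hΩ h𝔸 hα K (constField n (elemGrad w K)) (constField n (elemGrad z K)) := by
  simp [acForm, elemGradL]

lemma ae_eq_iUnion (T : Mesh (n + 1) Ω) : Ω =ᵐ[volume] ⋃ K : T.elements, hull K.1 := by
  rw [T.iUnion_hull]
  refine (ae_eq_set.2 ⟨?_, ?_⟩)
  · rw [Set.sdiff_eq_empty.2 subset_closure, measure_empty]
  · refine measure_mono_null (fun x hx => ?_) T.volume_frontier
    exact ⟨hx.1, fun h => hx.2 (interior_subset h)⟩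

/-- The pointwise gradient is the constant `elemGrad` only in the interior of an element, but
frontiers of convex sets are null and the elements cover `Ω` up to a null set. -/
lemma ac_eq (hΩ : IsOpen Ω) (h𝔸 : IsDiffusion Ω α β 𝔸) (hα : 0 < α) (w z : T.P1) :
    T.ac 𝔸 w z = acForm hΩ h𝔸 hα w z := by
  set F : E (n + 1) → ℝ := fun x => (𝔸 x *ᵥ (gradient w.1 x).ofLp) ⬝ᵥ (gradient z.1 x).ofLp
  have hae : ∀ K : T.elements, (fun x => (𝔸 x *ᵥ vval (constField n (elemGrad w K)) x) ⬝ᵥ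
      vval (constField n (elemGrad z K)) x) =ᵐ[volume.restrict (hull K.1)] F := fun K => by
    have h1 : ∀ᵐ x ∂(volume.restrict (hull K.1)), x ∉ frontier (hull K.1) :=
      ae_restrict_of_ae (measure_eq_zero_iff_ae_notMem.1
        ((convex_convexHull ℝ _).addHaar_frontier volume))
    filter_upwards [h1, ae_restrict_mem (measurableSet_hull _)] with x hx hxK
    have hxi : x ∈ interior (hull K.1) := by
      by_contra hni
      exact hx ⟨subset_closure hxK, hni⟩
    simp only [F, gradient_eq w hxi, gradient_eq z hxi, vval_constField]
  have hint : ∀ K : T.elements, IntegrableOn F (hull K.1) := fun K =>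
    (integrableOn_diffusion hΩ h𝔸 hα K _ _).congr (hae K)
  rw [acForm_apply]
  change ∫ x in Ω, F x = _
  rw [setIntegral_congr_set T.ae_eq_iUnion, integral_iUnion_ae
    (fun K => (measurableSet_hull _).nullMeasurableSet) T.pairwise_aedisjoint
    (integrableOn_finite_iUnion.2 hint), tsum_fintype]
  refine Finset.sum_congr rfl fun K _ => ?_
  rw [diffForm_apply]
  exact (integral_congr_ae (hae K)).symm

/-- The squared `L²` norm of the gradient of a piecewise linear function. -/
def gradEnergy (w : T.P1) : ℝ := ∑ K : T.elements, volume.real (hull K.1) * ‖elemGrad w K‖ ^ 2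

lemma le_acForm (w : T.P1) : α * gradEnergy w ≤ acForm hΩ h𝔸 hα w w := by
  rw [acForm_apply, gradEnergy, Finset.mul_sum]
  refine Finset.sum_le_sum fun K _ => ?_
  rw [← setIntegral_constField]
  exact le_diffForm _

lemma acForm_le (w : T.P1) : acForm hΩ h𝔸 hα w w ≤ β * gradEnergy w := by
  rw [acForm_apply, gradEnergy, Finset.mul_sum]
  refine Finset.sum_le_sum fun K _ => ?_
  rw [← setIntegral_constField]
  exact diffForm_le _

/-- A continuous function with finitely many values on the connected space `E (n + 1)` is constant,
and it vanishes outside the bounded set `Ω`. -/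
lemma eq_zero_of_elemGrad_eq_zero {w : T.P1} (h : ∀ K, elemGrad w K = 0) : w = 0 := by
  have hfin : (Set.range w.1).Finite := by
    choose c hc using fun K : T.elements => elemGrad_spec w K
    refine ((Set.finite_range c).union (Set.finite_singleton 0)).subset ?_
    rintro _ ⟨x, rfl⟩
    by_cases hx : x ∈ Ω
    · obtain ⟨K, hK⟩ := T.exists_mem_hull (subset_closure hx)
      refine Or.inl ⟨K, ?_⟩
      rw [hc K x hK, h K, inner_zero_left, add_zero]
    · exact Or.inr (w.2.2.2 x hx)
  have hsub : (Set.range w.1).Subsingleton :=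
    hfin.countable.isTotallyDisconnected _ subset_rfl (isPreconnected_range w.2.1)
  obtain ⟨z, hz⟩ : ∃ z, z ∉ Ω := by
    by_contra! hall
    have h1 : Ω = Set.univ := Set.eq_univ_of_forall hall
    have h2 := T.isCompact_closure
    rw [h1, closure_univ] at h2
    exact noncompact_univ (E (n + 1)) h2
  refine Subtype.ext (funext fun x => ?_)
  have := hsub ⟨x, rfl⟩ ⟨z, rfl⟩
  rw [w.2.2.2 z hz] at this
  exact this

lemma volume_hull_pos (K : T.elements) : 0 < volume.real (hull K.1) := by
  rw [volume_element]
  exact mul_pos (T.jacE_pos K) (refVol_pos _)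

lemma acForm_isInner : IsInner (acForm (T := T) hΩ h𝔸 hα) := by
  refine ⟨fun w z => ?_, fun w hw => ?_⟩
  · rw [acForm_apply, acForm_apply]
    exact Finset.sum_congr rfl fun K _ => diffForm_symm _ _
  · refine lt_of_lt_of_le (mul_pos hα ?_) (le_acForm w)
    have hnn : ∀ K ∈ (Finset.univ : Finset T.elements),
        0 ≤ volume.real (hull K.1) * ‖elemGrad w K‖ ^ 2 := fun K _ =>
      mul_nonneg (volume_hull_pos K).le (sq_nonneg _)
    refine lt_of_le_of_ne (Finset.sum_nonneg hnn) fun h0 => hw ?_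
    refine eq_zero_of_elemGrad_eq_zero fun K => ?_
    have := (Finset.sum_eq_zero_iff_of_nonneg hnn).1 h0.symm K (Finset.mem_univ K)
    have h2 := (mul_eq_zero.1 this).resolve_left (volume_hull_pos K).ne'
    exact norm_eq_zero.1 ((pow_eq_zero_iff two_ne_zero).1 h2)

instance finiteDimensional_P1 : FiniteDimensional ℝ T.P1 := by
  let f : T.P1 →ₗ[ℝ] T.elements → Fin (n + 2) → ℝ :=
    LinearMap.pi fun K => LinearMap.pi fun i =>
      (LinearMap.proj (T.vert K i) : (E (n + 1) → ℝ) →ₗ[ℝ] ℝ) ∘ₗ T.P1.subtype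
  refine FiniteDimensional.of_injective f ?_
  rw [injective_iff_map_eq_zero]
  intro w hw
  refine Subtype.ext (funext fun x => ?_)
  by_cases hx : x ∈ Ω
  · obtain ⟨K, hK⟩ := T.exists_mem_hull (subset_closure hx)
    obtain ⟨c, hc⟩ := elemGrad_spec w K
    rw [hc x hK]
    have := affine_eq_of_vertices (c := c) (a := elemGrad w K) (c' := 0) (a' := 0) (fun y hy => by
      obtain ⟨i, rfl⟩ : y ∈ Set.range (T.vert K) := by
        rw [T.range_vert K]
        exact hy
      rw [← hc _ (mem_hull_of_mem hy)]
      have h1 := congrFun (congrFun hw K) i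
      simpa [f] using h1) hK
    simpa using this
  · exact w.2.2.2 x hx

lemma P1_mul_integrableOn (w z : T.P1) : IntegrableOn (fun x => w.1 x * z.1 x) Ω :=
  ((w.2.1.mul z.2.1).continuousOn.integrableOn_compact T.isCompact_closure).mono_set subset_closure

/-- The `L²` inner product on the conforming space as a bilinear form. -/
def ipcForm (T : Mesh (n + 1) Ω) : LinearMap.BilinForm ℝ T.P1 :=
  LinearMap.mk₂ ℝ T.ipc
    (fun w w' z => by
      rw [ipc, ipc, ipc, ← integral_add (P1_mul_integrableOn w z) (P1_mul_integrableOn w' z)]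
      congr 1
      ext x
      exact add_mul _ _ _)
    (fun c w z => by
      rw [ipc, ipc, ← integral_smul]
      congr 1
      ext x
      exact mul_assoc _ _ _)
    (fun w z z' => by
      rw [ipc, ipc, ipc, ← integral_add (P1_mul_integrableOn w z) (P1_mul_integrableOn w z')]
      congr 1
      ext x
      exact mul_add _ _ _)
    (fun c w z => by
      rw [ipc, ipc, ← integral_smul]
      congr 1
      ext x
      exact mul_left_comm _ _ _)

lemma ipcForm_apply (w z : T.P1) : T.ipcForm w z = T.ipc w z := rfl

lemma ipcForm_isInner (T : Mesh (n + 1) Ω) : IsInner T.ipcForm := by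
  refine ⟨fun w z => ?_, fun w hw => ?_⟩
  · simp only [ipcForm_apply, ipc, mul_comm]
  · rw [ipcForm_apply, ipc]
    have h0 : ∀ x, x ∉ Ω → w.1 x * w.1 x = 0 := fun x hx => by rw [w.2.2.2 x hx, mul_zero]
    rw [setIntegral_eq_integral_of_forall_compl_eq_zero h0]
    obtain ⟨x, hx⟩ : ∃ x, w.1 x ≠ 0 := by
      by_contra! hall
      exact hw (Subtype.ext (funext hall))
    refine (w.2.1.mul w.2.1).integral_pos_of_hasCompactSupport_nonneg_nonzero (x := x) ?_
      (fun x => mul_self_nonneg _) (mul_self_ne_zero.2 hx)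
    refine HasCompactSupport.intro T.isCompact_closure fun x hx => ?_
    exact h0 x fun h => hx (subset_closure h)

end Mesh

end

section

namespace Mesh

variable {n : ℕ} {Ω : Set (E (n + 1))} {T : Mesh (n + 1) Ω} {P : Pair} {j : ℕ} {α β κ : ℝ}
  {𝔸 : E (n + 1) → Matrix (Fin (n + 1)) (Fin (n + 1)) ℝ}

/-! ### The forms on the weak Galerkin space -/

lemma localIp_symm (h : ℝ) (u v : T.Weak) (K : T.elements) :
    localIp h u v K = localIp h v u K := by
  simp only [localIp, mul_comm]

lemma localIp_add {h : ℝ} {u u' v : T.Weak} (hu : u ∈ T.Vh P j) (hu' : u' ∈ T.Vh P j)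
    (hv : v ∈ T.Vh P j) (K : T.elements) :
    localIp h (u + u') v K = localIp h u v K + localIp h u' v K := by
  obtain ⟨p, hp⟩ := exists_localRep hu K
  obtain ⟨p', hp'⟩ := exists_localRep hu' K
  obtain ⟨q, hq⟩ := exists_localRep hv K
  rw [(hp.add hp').localIp_eq hq, hp.localIp_eq hq, hp'.localIp_eq hq]
  have h1 : ∀ i, ((p + p').1 - (p + p').2 i) * (q.1 - q.2 i) =
      (p.1 - p.2 i) * (q.1 - q.2 i) + (p'.1 - p'.2 i) * (q.1 - q.2 i) := fun i => by
    simp only [Prod.fst_add, Prod.snd_add, Pi.add_apply]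
    ring
  simp only [h1]
  simp only [Prod.fst_add, add_mul _ _ q.1, map_add, mul_add, Finset.sum_add_distrib]
  ring

lemma localIp_smul {h : ℝ} (c : ℝ) {u v : T.Weak} (hu : u ∈ T.Vh P j) (hv : v ∈ T.Vh P j)
    (K : T.elements) : localIp h (c • u) v K = c * localIp h u v K := by
  obtain ⟨p, hp⟩ := exists_localRep hu K
  obtain ⟨q, hq⟩ := exists_localRep hv K
  rw [(hp.smul c).localIp_eq hq, hp.localIp_eq hq]
  have h1 : ∀ i, ((c • p).1 - (c • p).2 i) * (q.1 - q.2 i) =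
      c • ((p.1 - p.2 i) * (q.1 - q.2 i)) := fun i => by
    simp only [Prod.smul_fst, Prod.smul_snd, Pi.smul_apply, ← smul_sub, smul_mul_assoc]
  simp only [h1]
  simp only [Prod.smul_fst, smul_mul_assoc, map_smul, smul_eq_mul, mul_left_comm _ c,
    ← Finset.mul_sum]
  ring

lemma ip_eq (u v : T.Weak) : T.ip u v = ∑ K, localIp T.meshSize u v K := rfl

/-- The discrete `L²` inner product as a bilinear form. -/
def ipForm (T : Mesh (n + 1) Ω) (P : Pair) (j : ℕ) : LinearMap.BilinForm ℝ (T.Vh P j) :=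
  LinearMap.mk₂ ℝ (fun u v => T.ip u v)
    (fun u u' v => by
      simp only [ip_eq, ← Finset.sum_add_distrib]
      exact Finset.sum_congr rfl fun K _ => localIp_add u.2 u'.2 v.2 K)
    (fun c u v => by
      simp only [ip_eq, smul_eq_mul, Finset.mul_sum]
      exact Finset.sum_congr rfl fun K _ => localIp_smul c u.2 v.2 K)
    (fun u v v' => by
      simp only [ip_eq, ← Finset.sum_add_distrib, localIp_symm _ u.1]
      exact Finset.sum_congr rfl fun K _ => localIp_add v.2 v'.2 u.2 K)
    (fun c u v => by
      simp only [ip_eq, smul_eq_mul, Finset.mul_sum, localIp_symm _ u.1]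
      exact Finset.sum_congr rfl fun K _ => localIp_smul c v.2 u.2 K)

lemma ipForm_apply (u v : T.Vh P j) : T.ipForm P j u v = T.ip u v := rfl

lemma localIp_self_nonneg {h : ℝ} (hh : 0 ≤ h) (v : T.Weak) (K : T.elements) :
    0 ≤ localIp h v v K := by
  refine add_nonneg (integral_nonneg fun _ => mul_self_nonneg _) (mul_nonneg hh ?_)
  exact Finset.sum_nonneg fun e _ => integral_nonneg fun _ => mul_self_nonneg _

lemma eq_zero_of_localIp {h : ℝ} (hh : 0 < h) {v : T.Weak} (hv : v ∈ T.Vh P j) {K : T.elements}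
    (h0 : localIp h v v K = 0) : v.1 K = 0 ∧ ∀ i, v.2 (T.side K i) = 0 := by
  obtain ⟨p, hp⟩ := exists_localRep hv K
  rw [hp.localIp_eq hp] at h0
  have hJ := T.jacE_pos K
  have h1 : 0 ≤ T.jacE K * refInt (n + 1) (p.1 * p.1) :=
    mul_nonneg hJ.le (refInt_mul_self_nonneg _)
  have h2 : ∀ i ∈ Finset.univ,
      0 ≤ T.jacF K i * faceInt i ((p.1 - p.2 i) * (p.1 - p.2 i)) := fun i _ =>
    mul_nonneg (T.jacF_pos K i).le (faceInt_mul_self_nonneg _ _)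
  have h3 := mul_nonneg hh.le (Finset.sum_nonneg h2)
  have h4 : T.jacE K * refInt (n + 1) (p.1 * p.1) = 0 := by linarith
  have h5 : ∑ i, T.jacF K i * faceInt i ((p.1 - p.2 i) * (p.1 - p.2 i)) = 0 :=
    (mul_eq_zero.1 (by linarith)).resolve_left hh.ne'
  have hp1 : p.1 = 0 := by
    by_contra hne
    exact ((refForm_isInner (n + 1)).pos _ hne).ne' ((mul_eq_zero.1 h4).resolve_left hJ.ne')
  refine ⟨?_, fun i => ?_⟩
  · obtain ⟨q, -, hq⟩ := hv.1 K
    funext x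
    by_cases hx : x ∈ hull K.1
    · obtain ⟨s, hs, rfl⟩ := T.exists_chart_eq hx
      rw [hp.interior_eq s hs, hp1, map_zero]
      rfl
    · rw [hq, Set.indicator_of_notMem hx]
      rfl
  · obtain ⟨q, -, hq⟩ := hv.2.1 (T.side K i)
    funext x
    by_cases hx : x ∈ hull (T.side K i).1
    · obtain ⟨s, hs, rfl⟩ := T.exists_chart_facePt_eq hx
      have h6 := (Finset.sum_eq_zero_iff_of_nonneg h2).1 h5 i (Finset.mem_univ i)
      have h7 := (mul_eq_zero.1 h6).resolve_left (T.jacF_pos K i).ne'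
      have h8 := eval_facePt_eq_zero h7 s hs
      rw [hp.face_eq i s hs]
      simpa [hp1] using h8
    · rw [hq, Set.indicator_of_notMem hx]
      rfl

lemma exists_side_eq' (e : T.sides) : ∃ K i, T.side K i = e := by
  obtain ⟨K, hK⟩ := T.exists_element (T.side_mem e)
  obtain ⟨i, hi⟩ := T.exists_side_eq hK
  exact ⟨K, i, hi⟩

lemma ipForm_isInner (hT : ∀ K : T.elements, IsSized K κ T.meshSize) :
    IsInner (T.ipForm P j) := by
  have hnn : ∀ (v : T.Weak), ∀ K ∈ (Finset.univ : Finset T.elements),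
      0 ≤ localIp T.meshSize v v K := fun v K _ => localIp_self_nonneg (hT K).hpos.le v K
  refine ⟨fun u v => ?_, fun v hv => ?_⟩
  · simp only [ipForm_apply, ip_eq, localIp_symm _ u.1]
  · rw [ipForm_apply, ip_eq]
    refine lt_of_le_of_ne (Finset.sum_nonneg (hnn v)) fun h0 => hv ?_
    have h1 := fun K => eq_zero_of_localIp (hT K).hpos v.2
      ((Finset.sum_eq_zero_iff_of_nonneg (hnn v)).1 h0.symm K (Finset.mem_univ K))
    refine Subtype.ext (Prod.ext (funext fun K => (h1 K).1) (funext fun e => ?_))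
    obtain ⟨K, i, rfl⟩ := exists_side_eq' e
    exact (h1 K).2 i

/-- The weak gradient as a linear map. -/
def weakGradL (T : Mesh (n + 1) Ω) (P : Pair) (j : ℕ) (K : T.elements) :
    T.Vh P j →ₗ[ℝ] VecPoly n where
  toFun v := T.weakGrad P j v K
  map_add' u v := weakGrad_add u.2 v.2 K
  map_smul' c u := weakGrad_smul c u.2 K

/-- The form `a_h` as a bilinear form. -/
def ahForm (T : Mesh (n + 1) Ω) (P : Pair) (j : ℕ) (hΩ : IsOpen Ω) (h𝔸 : IsDiffusion Ω α β 𝔸)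
    (hα : 0 < α) : LinearMap.BilinForm ℝ (T.Vh P j) :=
  ∑ K, (diffForm hΩ h𝔸 hα K).compl₁₂ (weakGradL T P j K) (weakGradL T P j K)

variable {hΩ : IsOpen Ω} {h𝔸 : IsDiffusion Ω α β 𝔸} {hα : 0 < α}

lemma ahForm_apply (u v : T.Vh P j) : ahForm T P j hΩ h𝔸 hα u v = T.ah P j 𝔸 u v := by
  simp [ahForm, ah, weakGradL, diffForm_apply]

lemma ahForm_isSemiInner (T : Mesh (n + 1) Ω) (P : Pair) (j : ℕ) (hΩ : IsOpen Ω)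
    (h𝔸 : IsDiffusion Ω α β 𝔸) (hα : 0 < α) : IsSemiInner (ahForm T P j hΩ h𝔸 hα) :=
  IsSemiInner.sum fun K => (diffForm_isSemiInner hΩ h𝔸 hα K).comp _

/-- The energy of the weak gradient. -/
def energy (P : Pair) (j : ℕ) (v : T.Weak) : ℝ := ∑ K, gradSq P j v K

lemma energy_nonneg (v : T.Weak) : 0 ≤ energy P j v := Finset.sum_nonneg fun K _ => gradSq_nonneg v K

lemma le_ahForm (hΩ : IsOpen Ω) (h𝔸 : IsDiffusion Ω α β 𝔸) (hα : 0 < α) (v : T.Vh P j) :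
    α * energy P j v.1 ≤ ahForm T P j hΩ h𝔸 hα v v := by
  simp only [ahForm, LinearMap.sum_apply, energy, Finset.mul_sum, LinearMap.compl₁₂_apply]
  exact Finset.sum_le_sum fun K _ => le_diffForm _

lemma ahForm_le (hΩ : IsOpen Ω) (h𝔸 : IsDiffusion Ω α β 𝔸) (hα : 0 < α) (v : T.Vh P j) :
    ahForm T P j hΩ h𝔸 hα v v ≤ β * energy P j v.1 := by
  simp only [ahForm, LinearMap.sum_apply, energy, Finset.mul_sum, LinearMap.compl₁₂_apply]
  exact Finset.sum_le_sum fun K _ => diffForm_le _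

lemma gradSq_add_le {u v : T.Weak} (hu : u ∈ T.Vh P j) (hv : v ∈ T.Vh P j) (K : T.elements) :
    gradSq P j (u + v) K ≤ 2 * gradSq P j u K + 2 * gradSq P j v K := by
  simp only [gradSq, setIntegral_vval, weakGrad_add hu hv]
  have h1 := (elemForm_isInner (T.vert_affineIndependent K)).semi.add_le
    (T.weakGrad P j u K) (T.weakGrad P j v K)
  nlinarith [T.jacE_pos K, mul_le_mul_of_nonneg_left h1 (T.jacE_pos K).le]

lemma gradSq_neg {u : T.Weak} (hu : u ∈ T.Vh P j) (K : T.elements) :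
    gradSq P j (-u) K = gradSq P j u K := by
  rw [← neg_one_smul ℝ u]
  simp only [gradSq, weakGrad_smul (-1) hu, vval_smul]
  simp

lemma energy_sub_le {u v : T.Weak} (hu : u ∈ T.Vh P j) (hv : v ∈ T.Vh P j) :
    energy P j (u - v) ≤ 2 * energy P j u + 2 * energy P j v := by
  simp only [energy, Finset.mul_sum, ← Finset.sum_add_distrib]
  refine Finset.sum_le_sum fun K _ => ?_
  rw [sub_eq_add_neg, ← gradSq_neg hv]
  exact gradSq_add_le hu (Submodule.neg_mem _ hv) K

/-! ### Finite dimensionality -/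

/-- Restriction of polynomials as a linear map onto `P_k(S)`. -/
def restrictL (S : Set (E (n + 1))) (k : ℕ) : Pol (n + 1) k →ₗ[ℝ] polyOn S k where
  toFun p := ⟨S.indicator (pval p.1), p.1, p.2, rfl⟩
  map_add' p q := by
    ext x
    by_cases hx : x ∈ S <;> simp [pval, hx]
  map_smul' c p := by
    ext x
    by_cases hx : x ∈ S <;> simp [pval, hx, smul_eval]

instance finiteDimensional_polyOn (S : Set (E (n + 1))) (k : ℕ) :
    FiniteDimensional ℝ (polyOn S k) := by
  refine Module.Finite.of_surjective (restrictL S k) ?_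
  rintro ⟨_, p, hp, rfl⟩
  exact ⟨⟨p, hp⟩, rfl⟩

instance finiteDimensional_Vh : FiniteDimensional ℝ (T.Vh P j) := by
  let f : T.Vh P j →ₗ[ℝ] ((K : T.elements) → polyOn (hull K.1) j) ×
      ((e : T.sides) → polyOn (hull e.1) (P.faceDegree j)) :=
    LinearMap.prod
      (LinearMap.pi fun K => LinearMap.codRestrict _
        (LinearMap.proj K ∘ₗ LinearMap.fst ℝ _ _ ∘ₗ (T.Vh P j).subtype) fun v => v.2.1 K)
      (LinearMap.pi fun e => LinearMap.codRestrict _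
        (LinearMap.proj e ∘ₗ LinearMap.snd ℝ _ _ ∘ₗ (T.Vh P j).subtype) fun v => v.2.2.1 e)
  refine FiniteDimensional.of_injective f ?_
  intro u v huv
  refine Subtype.ext (Prod.ext (funext fun K => ?_) (funext fun e => ?_))
  · exact congrArg Subtype.val (congrFun (congrArg Prod.fst huv) K)
  · exact congrArg Subtype.val (congrFun (congrArg Prod.snd huv) e)

lemma V0_le : T.V0 P j ≤ T.Vh P j := inf_le_left

lemma Vb_le : T.Vb P j ≤ T.Vh P j := inf_le_left

instance finiteDimensional_V0 : FiniteDimensional ℝ (T.V0 P j) :=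
  Submodule.finiteDimensional_of_le V0_le

instance finiteDimensional_Vb : FiniteDimensional ℝ (T.Vb P j) :=
  Submodule.finiteDimensional_of_le Vb_le

instance finiteDimensional_Vr : FiniteDimensional ℝ (T.Vr P j 𝔸) :=
  inferInstanceAs (FiniteDimensional ℝ (LinearMap.range (T.graphMap P j 𝔸)))

lemma Vr_le : T.Vr P j 𝔸 ≤ T.Vh P j := by
  rintro _ ⟨v, rfl⟩
  exact Submodule.sub_mem _ (Vb_le v.2) (V0_le (T.P0 P j 𝔸 v).2)

/-! ### The projection onto interior functions -/

/-- A global Friedrichs inequality for weak functions without boundary part. -/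
lemma exists_ip_le_energy (P : Pair) (j n : ℕ) (κ : ℝ) : ∃ C : ℝ, 0 < C ∧
    ∀ (Ω : Set (E (n + 1))) (T : Mesh (n + 1) Ω), (∀ K : T.elements, IsSized K κ T.meshSize) →
    ∀ v ∈ T.V0 P j, T.ip v v ≤ C * T.meshSize ^ 2 * energy P j v := by
  obtain ⟨C, hC, h⟩ := exists_localIp_le n P j κ
  refine ⟨C, hC, fun Ω T hT v hv => ?_⟩
  rw [ip_eq, energy, Finset.mul_sum]
  refine Finset.sum_le_sum fun K _ => h Ω T K _ (hT K) v (V0_le hv) fun i => ?_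
  exact congrFun (LinearMap.mem_ker.1 hv.2) _

/-- Zero energy makes the discrete norm vanish by the Friedrichs inequality. Definiteness on `V0` is
what makes the projector `P0` exist. -/
lemma ahForm_V0_isInner (hT : ∀ K : T.elements, IsSized K κ T.meshSize) (hΩ : IsOpen Ω)
    (h𝔸 : IsDiffusion Ω α β 𝔸) (hα : 0 < α) :
    IsInner ((ahForm T P j hΩ h𝔸 hα).compl₁₂ (Submodule.inclusion V0_le)
      (Submodule.inclusion V0_le)) := by
  have hs := (ahForm_isSemiInner T P j hΩ h𝔸 hα).comp (Submodule.inclusion V0_le)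
  refine ⟨hs.symm, fun v hv => lt_of_le_of_ne (hs.nonneg v) fun h0 => hv ?_⟩
  obtain ⟨C, hC, h⟩ := exists_ip_le_energy P j n κ
  have h1 := le_ahForm hΩ h𝔸 hα (Submodule.inclusion V0_le v)
  rw [LinearMap.compl₁₂_apply] at h0
  rw [← h0] at h1
  have h2 : energy P j v.1 ≤ 0 := nonpos_of_mul_nonpos_right h1 hα
  have h3 := h Ω T hT v.1 v.2
  have h4 : energy P j v.1 = 0 := le_antisymm h2 (energy_nonneg _)
  rw [h4, mul_zero] at h3
  by_contra hne
  have hne' : Submodule.inclusion V0_le v ≠ 0 := fun h => hne (by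
    rw [← Submodule.coe_eq_zero] at h ⊢
    exact h)
  have := (ipForm_isInner hT).pos _ hne'
  rw [ipForm_apply] at this
  exact this.not_ge h3

lemma ah_P0 (hT : ∀ K : T.elements, IsSized K κ T.meshSize) (hΩ : IsOpen Ω)
    (h𝔸 : IsDiffusion Ω α β 𝔸) (hα : 0 < α) (v : T.Vb P j) (ζ : T.V0 P j) :
    T.ah P j 𝔸 (T.P0 P j 𝔸 v) ζ = T.ah P j 𝔸 v ζ :=
  formOperator_spec (m' := fun u ζ : T.V0 P j => T.ah P j 𝔸 u ζ)
    (a' := fun (v : T.Vb P j) (ζ : T.V0 P j) => T.ah P j 𝔸 v ζ)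
    (ahForm_V0_isInner hT hΩ h𝔸 hα)
    ((ahForm T P j hΩ h𝔸 hα).compl₁₂ (Submodule.inclusion Vb_le) (Submodule.inclusion V0_le))
    (fun u ζ => (ahForm_apply (hΩ := hΩ) (h𝔸 := h𝔸) (hα := hα) (Submodule.inclusion V0_le u)
      (Submodule.inclusion V0_le ζ)).symm)
    (fun u ζ => (ahForm_apply (hΩ := hΩ) (h𝔸 := h𝔸) (hα := hα) (Submodule.inclusion Vb_le u)
      (Submodule.inclusion V0_le ζ)).symm) v ζ

/-- Elements of `V_r` minimize the energy among functions with the same boundary part. -/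
lemma ah_Vr_le (hT : ∀ K : T.elements, IsSized K κ T.meshSize) (hΩ : IsOpen Ω)
    (h𝔸 : IsDiffusion Ω α β 𝔸) (hα : 0 < α) {z u : T.Weak} (hz : z ∈ T.Vr P j 𝔸)
    (hu : u ∈ T.Vh P j) (h : u.2 = z.2) : T.ah P j 𝔸 z z ≤ T.ah P j 𝔸 u u := by
  have hzh : z ∈ T.Vh P j := Vr_le hz
  have hd : u - z ∈ T.V0 P j := ⟨Submodule.sub_mem _ hu hzh, by
    rw [SetLike.mem_coe, LinearMap.mem_ker, LinearMap.snd_apply, Prod.snd_sub, h, sub_self]⟩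
  obtain ⟨v, rfl⟩ := hz
  set z := T.graphMap P j 𝔸 v
  set a := ahForm T P j hΩ h𝔸 hα
  let Z : T.Vh P j := ⟨z, hzh⟩
  let U : T.Vh P j := ⟨u, hu⟩
  let D : T.Vh P j := ⟨u - z, V0_le hd⟩
  -- By the definition of `P0`, `z` is orthogonal in the energy to `V0`, which contains `u - z`. The
  -- minimum property is then Pythagoras.
  have horth : a Z D = 0 := by
    have h1 := ah_P0 hT hΩ h𝔸 hα v ⟨u - z, hd⟩
    have hZ : Z = Submodule.inclusion Vb_le v - Submodule.inclusion V0_le (T.P0 P j 𝔸 v) :=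
      Subtype.ext rfl
    rw [hZ, LinearMap.map_sub₂, ahForm_apply, ahForm_apply, sub_eq_zero]
    exact h1.symm
  have hU : U = Z + D := Subtype.ext (add_sub_cancel _ _).symm
  have hs := ahForm_isSemiInner T P j hΩ h𝔸 hα
  have key : a Z Z ≤ a U U := by
    rw [hU]
    simp only [map_add, LinearMap.add_apply]
    have := hs.nonneg D
    linarith [hs.symm D Z, horth]
  simpa only [a, ahForm_apply] using key

end Mesh

end

section

/-- Functions that are continuous on `S`. -/
def contOn {d : ℕ} (S : Set (E d)) : Submodule ℝ (E d → ℝ) where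
  carrier := {f | ContinuousOn f S}
  add_mem' := fun hf hg => ContinuousOn.add hf hg
  zero_mem' := continuousOn_const
  smul_mem' := fun c _ hf => ContinuousOn.const_smul hf c

/-- Functions in `polyOn` are cut off to zero outside `S` and so are continuous on `S` only.
`contOn` is a common home for them and for traces of conforming functions. -/
lemma polyOn_le_contOn {d : ℕ} (S : Set (E d)) (k : ℕ) : polyOn S k ≤ contOn S := by
  rintro _ ⟨p, -, rfl⟩
  have h : Continuous (pval p) := (continuous_eval p).comp (PiLp.continuous_ofLp 2 _)
  exact h.continuousOn.congr fun x hx => Set.indicator_of_mem hx _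

lemma measure_hull_lt_top {n d : ℕ} (y : Fin (n + 1) → E d) :
    μHE[n] (convexHull ℝ (Set.range y)) < ⊤ := by
  rw [convexHull_range_eq, measure_chart_image]
  exact ENNReal.mul_lt_top ENNReal.ofReal_lt_top (volume_refSimplex_lt_top n)

namespace Mesh

variable {n : ℕ} {Ω : Set (E (n + 1))} {T : Mesh (n + 1) Ω} {P : Pair} {j : ℕ} {α β κ : ℝ}
  {𝔸 : E (n + 1) → Matrix (Fin (n + 1)) (Fin (n + 1)) ℝ}

/-! ### The `L²` inner product on an edge/face -/

lemma integrableOn_side (e : T.sides) {f : E (n + 1) → ℝ} (hf : f ∈ contOn (hull e.1)) :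
    IntegrableOn f (hull e.1) μHE[n + 1 - 1] := by
  obtain ⟨K, i, rfl⟩ := exists_side_eq' e
  have hc := isCompact_hull (T.side K i).1
  obtain ⟨b, hb⟩ := hc.exists_bound_of_continuousOn hf
  have hfin : μHE[n + 1 - 1] (hull (T.side K i).1) < ⊤ := by
    rw [hull_side_eq]
    exact measure_hull_lt_top _
  refine IntegrableOn.of_bound hfin (ContinuousOn.aestronglyMeasurable hf hc.measurableSet) b ?_
  filter_upwards [ae_restrict_mem hc.measurableSet] with x hx using hb x hx

lemma mul_mem_contOn {S : Set (E (n + 1))} {f g : E (n + 1) → ℝ} (hf : f ∈ contOn S)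
    (hg : g ∈ contOn S) : (fun x => f x * g x) ∈ contOn S :=
  ContinuousOn.mul hf hg

/-- The `L²` inner product on an edge/face. -/
def sideForm (e : T.sides) : LinearMap.BilinForm ℝ (contOn (hull e.1)) :=
  LinearMap.mk₂ ℝ (fun f g => ∫ x in hull e.1, f.1 x * g.1 x ∂μHE[n + 1 - 1])
    (fun f f' g => by
      rw [← integral_add (integrableOn_side e (mul_mem_contOn f.2 g.2))
        (integrableOn_side e (mul_mem_contOn f'.2 g.2))]
      congr 1
      ext x
      exact add_mul _ _ _)
    (fun c f g => by
      rw [← integral_smul]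
      congr 1
      ext x
      exact mul_assoc _ _ _)
    (fun f g g' => by
      rw [← integral_add (integrableOn_side e (mul_mem_contOn f.2 g.2))
        (integrableOn_side e (mul_mem_contOn f.2 g'.2))]
      congr 1
      ext x
      exact mul_add _ _ _)
    (fun c f g => by
      rw [← integral_smul]
      congr 1
      ext x
      exact mul_left_comm _ _ _)

lemma sideForm_apply (e : T.sides) (f g : contOn (hull e.1)) :
    sideForm e f g = ∫ x in hull e.1, f.1 x * g.1 x ∂μHE[n + 1 - 1] := rfl

lemma sideForm_isSemiInner (e : T.sides) : IsSemiInner (sideForm e) :=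
  ⟨fun f g => by simp only [sideForm_apply, mul_comm],
    fun f => integral_nonneg fun _ => mul_self_nonneg _⟩

lemma sideForm_poly_isInner (e : T.sides) (k : ℕ) :
    IsInner ((sideForm e).compl₁₂ (Submodule.inclusion (polyOn_le_contOn (hull e.1) k))
      (Submodule.inclusion (polyOn_le_contOn (hull e.1) k))) := by
  have hs := (sideForm_isSemiInner e).comp (Submodule.inclusion (polyOn_le_contOn (hull e.1) k))
  refine ⟨hs.symm, fun p hp => lt_of_le_of_ne (hs.nonneg p) fun h0 => hp ?_⟩
  obtain ⟨K, i, rfl⟩ := exists_side_eq' e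
  obtain ⟨_, q, hq, rfl⟩ := p
  have h1 : ∀ s ∈ refSimplex n, (hull (T.side K i).1).indicator (pval q)
      (chart (T.vert K) (facePt i s)) = eval (facePt i s) (pull (T.vert K) q) := fun s hs => by
    rw [Set.indicator_of_mem (T.chart_mem_hull_side K i hs), eval_pull]
  have h2 := integral_side_eq h1 h1
  rw [LinearMap.compl₁₂_apply, sideForm_apply] at h0
  have h3 := h0.trans h2
  have h4 := (mul_eq_zero.1 h3.symm).resolve_left (T.jacF_pos K i).ne'
  refine Subtype.ext (funext fun x => ?_)
  by_cases hx : x ∈ hull (T.side K i).1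
  · obtain ⟨s, hs, rfl⟩ := T.exists_chart_facePt_eq hx
    exact (h1 s hs).trans (eval_facePt_eq_zero h4 s hs)
  · exact Set.indicator_of_notMem hx _

lemma sideSq_congr {e : Finset (E (n + 1))} {f g : E (n + 1) → ℝ} (h : ∀ x ∈ hull e, f x = g x) :
    sideSq f e = sideSq g e :=
  setIntegral_congr_fun (measurableSet_hull e) fun x hx => by simp only [h x hx]

lemma sideSq_add_le (e : T.sides) {f g : E (n + 1) → ℝ} (hf : f ∈ contOn (hull e.1))
    (hg : g ∈ contOn (hull e.1)) :
    sideSq (fun x => f x + g x) e.1 ≤ 2 * sideSq f e.1 + 2 * sideSq g e.1 :=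
  (sideForm_isSemiInner e).add_le ⟨f, hf⟩ ⟨g, hg⟩

lemma sideSq_neg (e : Finset (E (n + 1))) (f : E (n + 1) → ℝ) :
    sideSq (fun x => -f x) e = sideSq f e := by
  simp [sideSq]

lemma sideSq_sub_comm (e : Finset (E (n + 1))) (f g : E (n + 1) → ℝ) :
    sideSq (fun x => f x - g x) e = sideSq (fun x => g x - f x) e := by
  rw [← sideSq_neg]
  simp

lemma sideSq_sub_le (e : T.sides) {f g u : E (n + 1) → ℝ} (hf : f ∈ contOn (hull e.1))
    (hg : g ∈ contOn (hull e.1)) (hu : u ∈ contOn (hull e.1)) :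
    sideSq (fun x => f x - g x) e.1 ≤
      2 * sideSq (fun x => f x - u x) e.1 + 2 * sideSq (fun x => u x - g x) e.1 := by
  have h : sideSq (fun x => f x - u x + (u x - g x)) e.1 ≤
      2 * sideSq (fun x => f x - u x) e.1 + 2 * sideSq (fun x => u x - g x) e.1 :=
    sideSq_add_le e (Submodule.sub_mem _ hf hu) (Submodule.sub_mem _ hu hg)
  simpa only [sub_add_sub_cancel] using h

lemma sideSq_le_of_abs_le (K : T.elements) (i : Fin (n + 2)) {f : E (n + 1) → ℝ} {b : ℝ}
    (hf : f ∈ contOn (hull (T.side K i).1)) (hb : ∀ x ∈ hull (T.side K i).1, |f x| ≤ b) :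
    sideSq f (T.side K i).1 ≤ T.jacF K i * refVol n * b ^ 2 := by
  rw [← sideSq_const]
  refine setIntegral_mono_on (integrableOn_side _ (mul_mem_contOn hf hf))
    (integrableOn_side (f := fun _ => b * b) _ continuousOn_const)
    (measurableSet_hull _) fun x hx => ?_
  rw [← sq, ← sq, ← sq_abs]
  exact pow_le_pow_left₀ (abs_nonneg _) (hb x hx) 2

/-! ### The facewise projection -/

lemma P1_mem_contOn (w : T.P1) (S : Set (E (n + 1))) : w.1 ∈ contOn S := w.2.1.continuousOn

lemma Vh_snd_mem {v : T.Weak} (hv : v ∈ T.Vh P j) (e : T.sides) :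
    v.2 e ∈ contOn (hull e.1) := polyOn_le_contOn _ _ (hv.2.1 e)

/-- Restriction of conforming functions to an edge/face. -/
def traceL (e : T.sides) : T.P1 →ₗ[ℝ] contOn (hull e.1) :=
  LinearMap.codRestrict _ T.P1.subtype fun w => P1_mem_contOn w _

lemma exists_Qb (hΩ : IsOpen Ω) (T : Mesh (n + 1) Ω) (P : Pair) (j : ℕ) :
    ∃ Q : T.P1 →ₗ[ℝ] T.Vb P j, ∀ (w : T.P1) (e : T.sides),
    ∀ p ∈ polyOn (hull e.1) (P.faceDegree j),
      ∫ x in hull e.1, (Q w).1.2 e x * p x ∂μHE[n + 1 - 1] =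
        ∫ x in hull e.1, w.1 x * p x ∂μHE[n + 1 - 1] := by
  have h1 := fun e : T.sides => (sideForm_poly_isInner e (P.faceDegree j)).exists_operator
    ((sideForm e).compl₁₂ (traceL e)
      (Submodule.inclusion (polyOn_le_contOn (hull e.1) (P.faceDegree j))))
  choose Q hQ using h1
  let Q' : T.P1 →ₗ[ℝ] T.Weak := LinearMap.prod 0
    (LinearMap.pi fun e => (polyOn (hull e.1) (P.faceDegree j)).subtype ∘ₗ Q e)
  have hmem : ∀ w, Q' w ∈ T.Vb P j := fun w => by
    refine ⟨⟨fun K => Submodule.zero_mem _, fun e => (Q e w).2, fun e he => ?_⟩, rfl⟩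
    change (Q e w).1 = 0
    -- On a boundary edge/face `w` vanishes, hence so does its projection; this keeps the image in
    -- `Vb`.
    have h2 : (Q e w) = 0 := by
      by_contra hne
      refine ((sideForm_poly_isInner e (P.faceDegree j)).pos _ hne).ne' ?_
      rw [hQ, LinearMap.compl₁₂_apply, sideForm_apply]
      have h3 : ∀ x ∈ hull e.1, w.1 x = 0 := fun x hx => w.2.2.2 x fun hxΩ => by
        have h4 := (he hx).2
        rw [hΩ.interior_eq] at h4
        exact h4 hxΩ
      rw [setIntegral_congr_fun (g := fun _ => 0) (measurableSet_hull e.1) fun x hx => ?_]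
      · simp
      · change w.1 x * _ = 0
        rw [h3 x hx, zero_mul]
    rw [h2]
    rfl
  exact ⟨LinearMap.codRestrict _ Q' hmem, fun w e p hp => hQ e w ⟨p, hp⟩⟩

lemma Qb_spec (hΩ : IsOpen Ω) (w : T.P1) (e : T.sides) {p : E (n + 1) → ℝ}
    (hp : p ∈ polyOn (hull e.1) (P.faceDegree j)) :
    ∫ x in hull e.1, (T.Qb P j w).1.2 e x * p x ∂μHE[n + 1 - 1] =
      ∫ x in hull e.1, w.1 x * p x ∂μHE[n + 1 - 1] :=
  Classical.epsilon_spec (exists_Qb hΩ T P j) w e p hp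

/-- The projection is a best approximation. -/
lemma sideSq_sub_Qb_le (hΩ : IsOpen Ω) (w : T.P1) (e : T.sides) {p : E (n + 1) → ℝ}
    (hp : p ∈ polyOn (hull e.1) (P.faceDegree j)) :
    sideSq (fun x => p x - (T.Qb P j w).1.2 e x) e.1 ≤ sideSq (fun x => p x - w.1 x) e.1 := by
  have hq : (T.Qb P j w).1.2 e ∈ polyOn (hull e.1) (P.faceDegree j) := (T.Qb P j w).2.1.2.1 e
  let p' : contOn (hull e.1) := ⟨p, polyOn_le_contOn _ _ hp⟩
  let q' : contOn (hull e.1) := ⟨_, polyOn_le_contOn _ _ hq⟩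
  let w' : contOn (hull e.1) := ⟨w.1, P1_mem_contOn w _⟩
  have hs := sideForm_isSemiInner e
  have h1 : sideForm e q' (p' - q') = sideForm e w' (p' - q') :=
    Qb_spec hΩ w e (Submodule.sub_mem _ hp hq)
  have h2 := hs.nonneg (q' - w')
  have h3 : sideForm e (p' - q') (p' - q') ≤ sideForm e (p' - w') (p' - w') := by
    simp only [map_sub, LinearMap.sub_apply] at h1 h2 ⊢
    linarith [hs.symm p' q', hs.symm p' w', hs.symm q' w']
  exact h3

lemma const_mem_polyOn (S : Set (E (n + 1))) (k : ℕ) (c : ℝ) :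
    S.indicator (fun _ => c) ∈ polyOn S k :=
  ⟨C c, C_mem_Pol c, by
    congr 1
    ext x
    simp [pval]⟩

lemma sideSq_Qb_sub_const_le (hΩ : IsOpen Ω) (w : T.P1) (e : T.sides) (c : ℝ) :
    sideSq (fun x => (T.Qb P j w).1.2 e x - c) e.1 ≤ sideSq (fun x => w.1 x - c) e.1 := by
  have h := sideSq_sub_Qb_le (P := P) (j := j) hΩ w e
    (const_mem_polyOn (hull e.1) (P.faceDegree j) c)
  rw [sideSq_sub_comm, sideSq_sub_comm _ w.1]
  convert! h using 1
  · exact sideSq_congr fun x hx => by rw [Set.indicator_of_mem hx]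
  · exact sideSq_congr fun x hx => by rw [Set.indicator_of_mem hx]

/-! ### The boundary seminorm -/

/-- The sum of the squared `L²` norms of the boundary parts. -/
def bdSq (v : T.Weak) : ℝ := ∑ K, ∑ i, sideSq (v.2 (T.side K i)) (T.side K i).1

lemma boundary_part_mem {v : T.Weak} (hv : v ∈ T.Vh P j) : ((0, v.2) : T.Weak) ∈ T.Vh P j :=
  ⟨fun _ => Submodule.zero_mem _, hv.2.1, hv.2.2⟩

lemma ip_boundary_part (v : T.Weak) :
    T.ip ((0, v.2) : T.Weak) (0, v.2) = T.meshSize * bdSq v := by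
  rw [ip_eq, bdSq, Finset.mul_sum]
  refine Finset.sum_congr rfl fun K _ => ?_
  simp [localIp, T.sum_sidesOf, sideSq]

lemma ip_le_two (hT : ∀ K : T.elements, IsSized K κ T.meshSize) {u v : T.Weak}
    (hu : u ∈ T.Vh P j) (hv : v ∈ T.Vh P j) :
    T.ip (u + v) (u + v) ≤ 2 * T.ip u u + 2 * T.ip v v :=
  (ipForm_isInner (P := P) (j := j) hT).semi.add_le ⟨u, hu⟩ ⟨v, hv⟩

variable (n P j κ α β)

/-- On `V_r` the discrete `L²` norm is controlled by the boundary part. -/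
lemma exists_ip_le_bdSq (hα : 0 < α) : ∃ C : ℝ, 0 < C ∧ ∀ (Ω : Set (E (n + 1)))
    (T : Mesh (n + 1) Ω), IsOpen Ω → (∀ K : T.elements, IsSized K κ T.meshSize) →
    ∀ 𝔸, IsDiffusion Ω α β 𝔸 → ∀ z ∈ T.Vr P j 𝔸, T.ip z z ≤ C * T.meshSize * bdSq z := by
  obtain ⟨C₃, hC₃, h3⟩ := exists_gradSq_le_sideSq n P j κ
  obtain ⟨C₅, hC₅, h5⟩ := exists_ip_le_energy P j n κ
  refine ⟨2 * C₅ * (2 * (|β| / α) + 2) * C₃ + 2, by positivity, fun Ω T hΩ hT 𝔸 h𝔸 z hz => ?_⟩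
  have hzh := Vr_le hz
  -- `z` is compared with the function `b` that has the same boundary part and no interior part. The
  -- difference lies in `V0`, where the Friedrichs inequality applies. Its energy is controlled by
  -- that of `b`, since `z` has the smaller diffusion energy, and the energy of `b` by the boundary
  -- part.
  set b : T.Weak := (0, z.2)
  have hb : b ∈ T.Vh P j := boundary_part_mem hzh
  have hd : z - b ∈ T.V0 P j := ⟨Submodule.sub_mem _ hzh hb, by
    rw [SetLike.mem_coe, LinearMap.mem_ker, LinearMap.snd_apply, Prod.snd_sub, sub_self]⟩
  set h := T.meshSize
  have e1 : h * energy P j b ≤ C₃ * bdSq z := by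
    rw [energy, bdSq, Finset.mul_sum, Finset.mul_sum]
    refine Finset.sum_le_sum fun K _ => ?_
    simpa [b] using h3 Ω T K h (hT K) b hb 0 fun x _ => rfl
  have e2 : energy P j z ≤ |β| / α * energy P j b := by
    rw [div_mul_eq_mul_div, le_div_iff₀' hα]
    have f1 := le_ahForm hΩ h𝔸 hα ⟨z, hzh⟩
    have f2 := ahForm_le hΩ h𝔸 hα ⟨b, hb⟩
    rw [ahForm_apply] at f1 f2
    have f3 := ah_Vr_le hT hΩ h𝔸 hα hz hb rfl
    calc _ ≤ _ := f1
      _ ≤ _ := f3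
      _ ≤ _ := f2
      _ ≤ _ := mul_le_mul_of_nonneg_right (le_abs_self β) (energy_nonneg _)
  have e3 := energy_sub_le hzh hb
  have e4 := h5 Ω T hT _ hd
  have e5 := ip_le_two hT (V0_le hd) hb
  rw [sub_add_cancel, ip_boundary_part z] at e5
  have hh : 0 ≤ h ∧ 0 ≤ h ^ 2 := ⟨by
    by_cases hne : Nonempty T.elements
    · exact (hT hne.some).hpos.le
    · exact Real.iSup_nonneg fun K => (hne ⟨K⟩).elim, sq_nonneg _⟩
  calc T.ip z z ≤ 2 * T.ip (z - b) (z - b) + 2 * (h * bdSq z) := e5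
    _ ≤ 2 * (C₅ * h ^ 2 * ((2 * (|β| / α) + 2) * energy P j b)) + 2 * (h * bdSq z) := by
      have : energy P j (z - b) ≤ (2 * (|β| / α) + 2) * energy P j b := by linarith
      have hc : 0 ≤ C₅ * h ^ 2 := mul_nonneg hC₅.le hh.2
      linarith [mul_le_mul_of_nonneg_left this hc]
    _ = 2 * C₅ * (2 * (|β| / α) + 2) * h * (h * energy P j b) + 2 * (h * bdSq z) := by ring
    _ ≤ 2 * C₅ * (2 * (|β| / α) + 2) * h * (C₃ * bdSq z) + 2 * (h * bdSq z) := by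
      have hc : 0 ≤ 2 * C₅ * (2 * (|β| / α) + 2) * h := mul_nonneg (by positivity) hh.1
      linarith [mul_le_mul_of_nonneg_left e1 hc]
    _ = _ := by ring

/-- Stability of the prolongation. -/
lemma exists_ah_Pir_le (hα : 0 < α) : ∃ C : ℝ, 0 < C ∧ ∀ (Ω : Set (E (n + 1)))
    (T : Mesh (n + 1) Ω), IsOpen Ω → (∀ K : T.elements, IsSized K κ T.meshSize) →
    ∀ 𝔸, IsDiffusion Ω α β 𝔸 → ∀ w : T.P1,
    T.ah P j 𝔸 (T.Pir P j 𝔸 w) (T.Pir P j 𝔸 w) ≤ C * gradEnergy w := by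
  obtain ⟨C₃, hC₃, h3⟩ := exists_gradSq_le_sideSq n P j κ
  -- Absolute values and the added `1` make the constant positive without any knowledge of the signs
  -- of `β` and `κ`.
  refine ⟨|β| * (C₃ * ((n + 2) * (|κ|⁻¹ * (refVol n / refVol (n + 1))))) + 1,
    by have := refVol_pos n; have := refVol_pos (n + 1); positivity,
    fun Ω T hΩ hT 𝔸 h𝔸 w => ?_⟩
  have hr := refVol_pos n
  have hr' := refVol_pos (n + 1)
  let c : T.elements → ℝ := fun K => w.1 (T.vert K 0)
  -- A competitor for the minimum property: the boundary part is that of `Π_r w`, and on each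
  -- element the interior part is the value of `w` at one vertex. Its energy is bounded by the
  -- oscillation of `w` on the element, which is at most `h` times the gradient.
  let u : T.Weak := (fun K => (hull K.1).indicator fun _ => c K, (T.Qb P j w).1.2)
  have hQ := (T.Qb P j w).2.1
  have hu : u ∈ T.Vh P j := ⟨fun K => const_mem_polyOn _ _ _, hQ.2.1, hQ.2.2⟩
  have hP0 := LinearMap.mem_ker.1 (T.P0 P j 𝔸 (T.Qb P j w)).2.2
  have hsnd : u.2 = (T.Pir P j 𝔸 w).1.2 := by
    change _ = ((T.Qb P j w).1 - (T.P0 P j 𝔸 (T.Qb P j w)).1).2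
    rw [Prod.snd_sub]
    rw [LinearMap.snd_apply] at hP0
    rw [hP0, sub_zero]
  have hloc : ∀ K, gradSq P j u K ≤ C₃ * ((n + 2) * (|κ|⁻¹ * (refVol n / refVol (n + 1)))) *
      (volume.real (hull K.1) * ‖elemGrad w K‖ ^ 2) := fun K => by
    have hK := hT K
    have hh := hK.hpos
    have hκ := hK.kpos
    set h := T.meshSize
    have e1 := h3 Ω T K h hK u hu (c K) fun x hx =>
      Set.indicator_of_mem hx fun _ => c K
    obtain ⟨b, hb⟩ := elemGrad_spec w K
    have hosc : ∀ x ∈ hull K.1, |w.1 x - c K| ≤ h * ‖elemGrad w K‖ := fun x hx => by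
      have hv := mem_hull_of_mem (T.vert_mem K 0)
      simp only [c]
      rw [hb x hx, hb _ hv, add_sub_add_left_eq_sub, ← inner_sub_right, mul_comm]
      refine (abs_real_inner_le_norm _ _).trans (mul_le_mul_of_nonneg_left ?_ (norm_nonneg _))
      rw [← dist_eq_norm]
      exact (Metric.dist_le_diam_of_mem (isCompact_hull _).isBounded hx hv).trans hK.diam
    have e2 : ∀ i, h * sideSq (fun x => u.2 (T.side K i) x - c K) (T.side K i).1 ≤
        κ⁻¹ * (refVol n / refVol (n + 1)) * volume.real (hull K.1) * (h * ‖elemGrad w K‖) ^ 2 :=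
      fun i => by
      have f1 := sideSq_Qb_sub_const_le (P := P) (j := j) hΩ w (T.side K i) (c K)
      have f2 := sideSq_le_of_abs_le K i (f := fun x => w.1 x - c K)
        ((P1_mem_contOn w _).sub continuousOn_const)
        fun x hx => hosc x (hull_mono (T.side_subset K i) hx)
      have f3 := hK.jacF_le i
      rw [volume_element]
      calc _ ≤ h * (T.jacF K i * refVol n * (h * ‖elemGrad w K‖) ^ 2) := by
            have := f1.trans f2
            gcongr
        _ = h * T.jacF K i * (refVol n * (h * ‖elemGrad w K‖) ^ 2) := by ring
        _ ≤ κ⁻¹ * T.jacE K * (refVol n * (h * ‖elemGrad w K‖) ^ 2) := by gcongr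
        _ = _ := by
          field_simp
    have e3 : h ^ 2 * gradSq P j u K ≤ h ^ 2 * (C₃ * ((n + 2) * (κ⁻¹ *
        (refVol n / refVol (n + 1)))) * (volume.real (hull K.1) * ‖elemGrad w K‖ ^ 2)) := by
      calc h ^ 2 * gradSq P j u K = h * (h * gradSq P j u K) := by ring
        _ ≤ h * (C₃ * ∑ i, sideSq (fun x => u.2 (T.side K i) x - c K) (T.side K i).1) := by gcongr
        _ = C₃ * ∑ i, h * sideSq (fun x => u.2 (T.side K i) x - c K) (T.side K i).1 := by
          rw [← Finset.mul_sum]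
          ring
        _ ≤ C₃ * ∑ _i : Fin (n + 2), κ⁻¹ * (refVol n / refVol (n + 1)) *
            volume.real (hull K.1) * (h * ‖elemGrad w K‖) ^ 2 := by
          exact mul_le_mul_of_nonneg_left (Finset.sum_le_sum fun i _ => e2 i) hC₃.le
        _ = _ := by
          simp only [Finset.sum_const, Finset.card_univ, Fintype.card_fin, nsmul_eq_mul]
          push_cast
          ring
    rw [abs_of_pos hκ]
    exact le_of_mul_le_mul_left e3 (by positivity)
  have f2 := ahForm_le hΩ h𝔸 hα ⟨u, hu⟩
  rw [ahForm_apply] at f2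
  have f3 := ah_Vr_le hT hΩ h𝔸 hα (T.Pir P j 𝔸 w).2 hu hsnd
  have f4 : energy P j u ≤ C₃ * ((n + 2) * (|κ|⁻¹ * (refVol n / refVol (n + 1)))) *
      gradEnergy w := by
    rw [energy, gradEnergy, Finset.mul_sum]
    exact Finset.sum_le_sum fun K _ => hloc K
  have hg : 0 ≤ gradEnergy w := Finset.sum_nonneg fun K _ =>
    mul_nonneg (volume_hull_pos K).le (sq_nonneg _)
  calc _ ≤ _ := f3
    _ ≤ _ := f2
    _ ≤ |β| * energy P j u := mul_le_mul_of_nonneg_right (le_abs_self β) (energy_nonneg _)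
    _ ≤ |β| * _ := mul_le_mul_of_nonneg_left f4 (abs_nonneg _)
    _ ≤ _ := by linarith

end Mesh

end

/-! ### Approximation of weak functions by conforming ones -/

section

namespace Mesh

variable {n : ℕ} {Ω : Set (E (n + 1))} {T : Mesh (n + 1) Ω} {P : Pair} {j : ℕ} {α β κ : ℝ}
  {𝔸 : E (n + 1) → Matrix (Fin (n + 1)) (Fin (n + 1)) ℝ}

open Classical in
/-- The elements that share a vertex. -/
def star (T : Mesh (n + 1) Ω) (x : E (n + 1)) : Finset T.elements :=
  Finset.univ.filter fun K : T.elements => x ∈ K.1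

lemma mem_star {x : E (n + 1)} {K : T.elements} : K ∈ star T x ↔ x ∈ K.1 := by
  simp [star]

open Classical in
lemma sum_vertices (F : E (n + 1) → T.elements → ℝ) :
    ∑ K : T.elements, ∑ x ∈ K.1, F x K =
      ∑ x ∈ Finset.univ.biUnion (fun K : T.elements => K.1), ∑ K ∈ star T x, F x K := by
  refine Finset.sum_comm' fun K x => ?_
  simp only [Finset.mem_univ, true_and, mem_star, Finset.mem_biUnion]
  exact ⟨fun h => ⟨h, K, h⟩, fun h => h.1⟩

lemma card_vertices (K : T.elements) : (K.1.card : ℝ) = n + 2 := by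
  rw [(T.mem_elements.1 K.2).2]
  push_cast
  ring

/-- Sums over stars of all vertices of all elements have bounded overlap. -/
lemma sum_star_le {M : ℝ} (hM : ∀ x, ((star T x).card : ℝ) ≤ M) {G : T.elements → ℝ}
    (hG : ∀ K, 0 ≤ G K) :
    ∑ K : T.elements, ∑ x ∈ K.1, ∑ K' ∈ star T x, G K' ≤ M * (n + 2) * ∑ K, G K := by
  classical
  rw [sum_vertices fun x _ => ∑ K' ∈ star T x, G K']
  calc _ ≤ ∑ x ∈ Finset.univ.biUnion (fun K : T.elements => K.1), M * ∑ K' ∈ star T x, G K' := by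
        refine Finset.sum_le_sum fun x _ => ?_
        rw [Finset.sum_const, nsmul_eq_mul]
        exact mul_le_mul_of_nonneg_right (hM x) (Finset.sum_nonneg fun K _ => hG K)
    _ = M * ∑ K : T.elements, ∑ x ∈ K.1, G K := by
        rw [← Finset.mul_sum, sum_vertices fun _ K => G K]
    _ = _ := by
        simp only [Finset.sum_const, nsmul_eq_mul, card_vertices, ← Finset.mul_sum]
        ring

lemma gradEnergy_nonneg (w : T.P1) : 0 ≤ gradEnergy w := Finset.sum_nonneg fun K _ =>
  mul_nonneg (volume_hull_pos K).le (sq_nonneg _)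

/-- A conforming function with prescribed element values up to local differences. -/
lemma exists_P1_close (hΩ : IsOpen Ω) {M : ℝ} (hM : ∀ x, ((star T x).card : ℝ) ≤ M)
    {c G : T.elements → ℝ} (hG : ∀ K, 0 ≤ G K)
    (hc : ∀ x (K K' : T.elements), Adjacent x K K' → (c K - c K') ^ 2 ≤ G K + G K')
    (hb : ∀ x (K : T.elements), OnBoundary x K → c K ^ 2 ≤ G K) :
    ∃ (w : T.P1) (b : T.elements → ℝ), (∀ K, ∀ x ∈ hull K.1, |w.1 x - c K| ≤ b K) ∧
      ∑ K, b K ^ 2 ≤ (3 * M * (n + 2)) ^ 2 * ∑ K, G K := by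
  classical
  have hM0 : 0 ≤ M := (Nat.cast_nonneg _).trans (hM 0)
  -- The hypotheses are quadratic, but differences add up linearly along chains, so square roots are
  -- taken here and Cauchy–Schwarz returns to squares at the end.
  let g : T.elements → ℝ := fun K => √(G K)
  have hg : ∀ K, 0 ≤ g K := fun K => Real.sqrt_nonneg _
  have hg2 : ∀ K, g K ^ 2 = G K := fun K => Real.sq_sqrt (hG K)
  obtain ⟨f, hf, hfc⟩ := exists_nodal hΩ hg (c := c)
    (fun x K K' h => abs_le_of_sq_le_sq ((hc x K K' h).trans (by
      rw [← hg2 K, ← hg2 K']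
      nlinarith [mul_nonneg (hg K) (hg K')])) (add_nonneg (hg K) (hg K')))
    (fun x K h => abs_le_of_sq_le_sq ((hb x K h).trans (hg2 K).ge) (hg K))
  obtain ⟨w, hw⟩ := exists_P1 hΩ hf
  have hs : ∀ x, 0 ≤ 3 * ∑ K₁ ∈ star T x, g K₁ := fun x =>
    mul_nonneg (by norm_num) (Finset.sum_nonneg fun K _ => hg K)
  refine ⟨w, fun K => ∑ x ∈ K.1, 3 * ∑ K₁ ∈ star T x, g K₁, fun K x hx => ?_, ?_⟩
  · obtain ⟨b, hb⟩ := elemGrad_spec w K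
    have h1 := abs_affine_le_of_vertices (s := K.1) (c := b - c K) (a := elemGrad w K)
      (b := ∑ x ∈ K.1, 3 * ∑ K₁ ∈ star T x, g K₁) (fun y hy => by
        rw [show b - c K + inner ℝ (elemGrad w K) y = w.1 y - c K by
          rw [hb y (mem_hull_of_mem hy)]; ring, hw K y hy]
        refine (hfc K y hy).trans ?_
        exact Finset.single_le_sum (f := fun x => 3 * ∑ K₁ ∈ star T x, g K₁)
          (fun x _ => hs x) hy) hx
    rw [hb x hx]
    convert! h1 using 2
    ring
  · have hK : ∀ K : T.elements, (∑ x ∈ K.1, 3 * ∑ K₁ ∈ star T x, g K₁) ^ 2 ≤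
        9 * (n + 2) * M * ∑ x ∈ K.1, ∑ K₁ ∈ star T x, G K₁ := fun K => by
      calc _ ≤ (K.1.card : ℝ) * ∑ x ∈ K.1, (3 * ∑ K₁ ∈ star T x, g K₁) ^ 2 :=
            sq_sum_le_card_mul_sum_sq
        _ ≤ (n + 2) * ∑ x ∈ K.1, 9 * (M * ∑ K₁ ∈ star T x, G K₁) := by
            rw [card_vertices]
            refine mul_le_mul_of_nonneg_left (Finset.sum_le_sum fun x _ => ?_) (by positivity)
            rw [mul_pow]
            norm_num only
            refine mul_le_mul_of_nonneg_left ?_ (by norm_num)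
            refine sq_sum_le_card_mul_sum_sq.trans ?_
            simp only [hg2]
            exact mul_le_mul_of_nonneg_right (hM x) (Finset.sum_nonneg fun K _ => hG K)
        _ = _ := by
            rw [← Finset.mul_sum, ← Finset.mul_sum]
            ring
    calc _ ≤ ∑ K : T.elements, 9 * (n + 2) * M * ∑ x ∈ K.1, ∑ K₁ ∈ star T x, G K₁ :=
          Finset.sum_le_sum fun K _ => hK K
      _ ≤ 9 * (n + 2) * M * (M * (n + 2) * ∑ K, G K) := by
          rw [← Finset.mul_sum]
          exact mul_le_mul_of_nonneg_left (sum_star_le hM hG) (by positivity)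
      _ = _ := by ring

variable (n P j κ)

/-- Approximation of weak functions by conforming ones. -/
lemma exists_P1_approx : ∃ C : ℝ, 0 < C ∧ ∀ (Ω : Set (E (n + 1)))
    (T : Mesh (n + 1) Ω), IsOpen Ω → (∀ K : T.elements, IsSized K κ T.meshSize) →
    Nonempty T.elements → ∀ v ∈ T.Vh P j, ∃ w : T.P1,
    bdSq (v - (T.Qb P j w).1) ≤ C * T.meshSize * energy P j v ∧
      gradEnergy w ≤ C * energy P j v := by
  by_cases hκ : 0 < κ
  swap
  · exact ⟨1, one_pos, fun Ω T _ hT hne => (hκ (hT hne.some).kpos).elim⟩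
  obtain ⟨C₄, hC₄, h4⟩ := exists_sideSq_sub_le n P j κ
  have hr := refVol_pos n
  have hr' := refVol_pos (n + 1)
  have hB := ballVol_pos n
  set M : ℝ := κ⁻¹ ^ (n + 1)
  have hM0 : 0 < M := by positivity
  set a₀ : ℝ := κ ^ (n + 1) * (ballVol n / refVol (n + 1))
  set a₁ : ℝ := κ⁻¹ * (ballVol n / refVol (n + 1))
  have ha₀ : 0 < a₀ := by positivity
  have ha₁ : 0 < a₁ := by positivity
  -- A constant `b` on a face has squared norm at least `a₀ h ^ n refVol n * b ^ 2`. With `2 * C₄ *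
  -- h * S` as an upper bound for this norm one obtains `b ^ 2 ≤ D * (h / h ^ n) * S`.
  set D : ℝ := 2 * C₄ / (a₀ * refVol n)
  have hD : 0 < D := by positivity
  set B : ℝ := (3 * M * (n + 2)) ^ 2 * D
  have hB0 : 0 < B := by positivity
  refine ⟨max ((n + 2) * (2 * C₄ + 2 * (a₁ * refVol n * B))) (ballVol n * B / κ ^ 2),
    lt_max_of_lt_right (by positivity), fun Ω T hΩ hT hne v hv => ?_⟩
  set h := T.meshSize
  have hh : 0 < h := (hT hne.some).hpos
  -- This is `h ^ (1 - n)`, written as a quotient because the exponent may be negative.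
  set t := h / h ^ n
  have ht : 0 < t := by positivity
  have hth : h ^ n * t = h := by
    simp only [t]
    field_simp
  choose c hc using fun K => h4 Ω T K h (hT K) v hv
  set N : T.elements → ℝ := fun K => gradSq P j v K
  have hN : ∀ K, 0 ≤ N K := fun K => gradSq_nonneg v K
  set G : T.elements → ℝ := fun K => D * t * N K
  have hG : ∀ K, 0 ≤ G K := fun K => mul_nonneg (by positivity) (hN K)
  have hcs : ∀ (K : T.elements) (e : T.sides), e.1 ⊆ K.1 →
      sideSq (fun x => v.2 e x - c K) e.1 ≤ C₄ * h * N K := fun K e he => by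
    obtain ⟨i, rfl⟩ := T.exists_side_eq he
    exact hc K i
  have hconst : ∀ (K : T.elements) (e : T.sides), e.1 ⊆ K.1 → ∀ b : ℝ, ∀ S : ℝ,
      sideSq (fun _ => b) e.1 ≤ 2 * C₄ * h * S → b ^ 2 ≤ D * t * S := fun K e he b S hb => by
    obtain ⟨i, rfl⟩ := T.exists_side_eq he
    rw [sideSq_const] at hb
    have f1 := (hT K).le_jacF i
    have f2 : a₀ * h ^ n * refVol n * b ^ 2 ≤ 2 * C₄ * h * S := by
      refine le_trans ?_ hb
      gcongr
    have f3 : a₀ * h ^ n * refVol n * b ^ 2 ≤ a₀ * h ^ n * refVol n * (D * t * S) := by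
      refine f2.trans (le_of_eq ?_)
      simp only [D]
      rw [show a₀ * h ^ n * refVol n * (2 * C₄ / (a₀ * refVol n) * t * S) =
        2 * C₄ * (h ^ n * t) * S by field_simp, hth]
    exact le_of_mul_le_mul_left f3 (by positivity)
  obtain ⟨w, b, hwb, hbsum⟩ := exists_P1_close hΩ (M := M)
    (fun x => by
      by_cases hx : ∃ K : T.elements, x ∈ K.1
      · exact card_star_le (K₀ := hx.choose) hT x
      · have : star T x = ∅ := Finset.eq_empty_of_forall_notMem fun K hK => hx ⟨K, mem_star.1 hK⟩
        rw [this]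
        simpa using hM0.le) (c := c) hG
    (fun x K K' hadj => by
      obtain ⟨e, -, he, he'⟩ := hadj
      rw [← mul_add]
      refine hconst K e he _ _ ?_
      -- On the common face both element constants are close to the same single-valued function `v.2
      -- e`, so they are close to each other.
      have f1 := sideSq_sub_le e (f := fun _ => c K) (g := fun _ => c K') (u := v.2 e)
        continuousOn_const continuousOn_const (Vh_snd_mem hv e)
      rw [sideSq_sub_comm e.1 (fun _ => c K) (v.2 e)] at f1
      have f2 := hcs K e he
      have f3 := hcs K' e he'
      linarith)
    (fun x K hbd => by
      obtain ⟨e, -, he, hef⟩ := hbd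
      refine hconst K e he _ _ ?_
      -- On a boundary face `v.2 e` is zero, and closeness to it bounds `c K` itself.
      have f2 := hcs K e he
      rw [hv.2.2 e hef, sideSq_sub_comm] at f2
      simp only [Pi.zero_apply, sub_zero] at f2
      have := mul_nonneg (mul_nonneg hC₄.le hh.le) (hN K)
      linarith)
  have hbs : ∑ K, b K ^ 2 ≤ B * t * energy P j v := by
    refine hbsum.trans (le_of_eq ?_)
    simp only [G, ← Finset.mul_sum, energy, N, B]
    ring
  have hE := energy_nonneg (P := P) (j := j) v
  refine ⟨w, ?_, ?_⟩
  -- As `v.2` is a polynomial of the right degree on the face, replacing `Q_b w` by `w` can only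
  -- increase the error (`sideSq_sub_Qb_le`). The constant `c K` is then inserted between `v.2` and
  -- `w`.
  · have hside : ∀ K i, sideSq ((v - (T.Qb P j w).1).2 (T.side K i)) (T.side K i).1 ≤
        2 * (C₄ * h * N K) + 2 * (a₁ * h ^ n * refVol n * b K ^ 2) := fun K i => by
      have f1 := sideSq_sub_Qb_le (P := P) (j := j) hΩ w (T.side K i) (hv.2.1 _)
      have f2 := sideSq_sub_le (T.side K i) (f := v.2 (T.side K i)) (g := w.1)
        (u := fun _ => c K) (Vh_snd_mem hv _) (P1_mem_contOn w _) continuousOn_const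
      have f3 := sideSq_le_of_abs_le K i (f := fun x => c K - w.1 x) (b := b K)
        (continuousOn_const.sub (P1_mem_contOn w _)) fun x hx => by
          rw [abs_sub_comm]
          exact hwb K x (hull_mono (T.side_subset K i) hx)
      have f4 := (hT K).jacF_le_pow i
      have f5 : T.jacF K i * refVol n * b K ^ 2 ≤ a₁ * h ^ n * refVol n * b K ^ 2 := by gcongr
      have f6 := hc K i
      refine f1.trans (f2.trans ?_)
      linarith
    have hsum : bdSq (v - (T.Qb P j w).1) ≤
        (n + 2) * (2 * C₄ + 2 * (a₁ * refVol n * B)) * h * energy P j v := by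
      calc _ ≤ ∑ K : T.elements, ∑ _i : Fin (n + 2),
            (2 * (C₄ * h * N K) + 2 * (a₁ * h ^ n * refVol n * b K ^ 2)) :=
            Finset.sum_le_sum fun K _ => Finset.sum_le_sum fun i _ => hside K i
        _ = (n + 2) * (2 * (C₄ * h * energy P j v) +
            2 * (a₁ * h ^ n * refVol n * ∑ K, b K ^ 2)) := by
            simp only [Finset.sum_const, Finset.card_univ, Fintype.card_fin, nsmul_eq_mul,
              ← Finset.mul_sum, Finset.sum_add_distrib, energy, N]
            push_cast
            ring
        _ ≤ (n + 2) * (2 * (C₄ * h * energy P j v) +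
            2 * (a₁ * h ^ n * refVol n * (B * t * energy P j v))) := by gcongr
        _ = (n + 2) * (2 * (C₄ * h * energy P j v) +
            2 * (a₁ * (h ^ n * t) * refVol n * B * energy P j v)) := by ring
        _ = _ := by
            rw [hth]
            ring
    refine hsum.trans ?_
    gcongr
    exact le_max_left _ _
  · have hgr : ∀ K : T.elements, volume.real (hull K.1) * ‖elemGrad w K‖ ^ 2 ≤
        h ^ (n + 1) * ballVol n * (b K ^ 2 / (κ * h) ^ 2) := fun K => by
      obtain ⟨d, hd⟩ := elemGrad_spec w K
      -- On `K` the function `w - c K` is affine and bounded by `b K`, which bounds its gradient by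
      -- `b K / (κ h)`.
      have f1 := (hT K).norm_le (c := d - c K) (a := elemGrad w K) (b := b K) fun x hx => by
        have := hwb K x (mem_hull_of_mem hx)
        rw [hd x (mem_hull_of_mem hx)] at this
        convert! this using 2
        ring
      have f2 : ‖elemGrad w K‖ ^ 2 ≤ b K ^ 2 / (κ * h) ^ 2 := by
        rw [le_div_iff₀ (by positivity), ← mul_pow, mul_comm]
        exact pow_le_pow_left₀ (by positivity) f1 2
      exact mul_le_mul (hT K).volume_le f2 (sq_nonneg _) (by positivity)
    have hsum : gradEnergy w ≤ ballVol n * B / κ ^ 2 * energy P j v := by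
      calc _ ≤ ∑ K : T.elements, h ^ (n + 1) * ballVol n * (b K ^ 2 / (κ * h) ^ 2) :=
            Finset.sum_le_sum fun K _ => hgr K
        _ = h ^ (n + 1) * ballVol n / (κ * h) ^ 2 * ∑ K, b K ^ 2 := by
            rw [Finset.mul_sum]
            exact Finset.sum_congr rfl fun K _ => by ring
        _ ≤ h ^ (n + 1) * ballVol n / (κ * h) ^ 2 * (B * t * energy P j v) := by gcongr
        _ = (h * ballVol n / (κ * h) ^ 2) * (h ^ n * t) * B * energy P j v := by ring
        _ = _ := by
            rw [hth]
            field_simp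
    refine hsum.trans ?_
    gcongr
    exact le_max_right _ _

end Mesh

end

section

namespace Mesh

variable {n : ℕ} {Ω : Set (E (n + 1))} {T : Mesh (n + 1) Ω} {P : Pair} {j : ℕ} {α β κ : ℝ}
  {𝔸 : E (n + 1) → Matrix (Fin (n + 1)) (Fin (n + 1)) ℝ}

/-! ### The auxiliary space -/

lemma nonempty_elements (T : Mesh (n + 1) Ω) (hne : Ω.Nonempty) : Nonempty T.elements := by
  obtain ⟨x, hx⟩ := hne
  exact ⟨(T.exists_mem_hull (subset_closure hx)).choose⟩

/-- The discrete `L²` inner product on `V_r`. -/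
def iprForm (T : Mesh (n + 1) Ω) (P : Pair) (j : ℕ)
    (𝔸 : E (n + 1) → Matrix (Fin (n + 1)) (Fin (n + 1)) ℝ) :
    LinearMap.BilinForm ℝ (T.Vr P j 𝔸) :=
  (ipForm T P j).compl₁₂ (Submodule.inclusion Vr_le) (Submodule.inclusion Vr_le)

/-- The form `a_h` on `V_r`. -/
def arForm (T : Mesh (n + 1) Ω) (P : Pair) (j : ℕ) (hΩ : IsOpen Ω) (h𝔸 : IsDiffusion Ω α β 𝔸)
    (hα : 0 < α) : LinearMap.BilinForm ℝ (T.Vr P j 𝔸) :=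
  (ahForm T P j hΩ h𝔸 hα).compl₁₂ (Submodule.inclusion Vr_le) (Submodule.inclusion Vr_le)

lemma iprForm_apply (u v : T.Vr P j 𝔸) : iprForm T P j 𝔸 u v = T.ipr P j 𝔸 u v := rfl

lemma arForm_apply {hΩ : IsOpen Ω} {h𝔸 : IsDiffusion Ω α β 𝔸} {hα : 0 < α} (u v : T.Vr P j 𝔸) :
    arForm T P j hΩ h𝔸 hα u v = T.ah P j 𝔸 u v := ahForm_apply _ _

lemma iprForm_isInner (hT : ∀ K : T.elements, IsSized K κ T.meshSize) :
    IsInner (iprForm T P j 𝔸) :=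
  ⟨fun _ _ => (ipForm_isInner hT).symm _ _, fun _ hv => (ipForm_isInner hT).pos _ fun h =>
    hv (Submodule.inclusion_injective Vr_le (h.trans (map_zero _).symm))⟩

lemma sub_Pir_mem (v : T.Vr P j 𝔸) (w : T.P1) :
    (v - T.Pir P j 𝔸 w).1.2 = (v.1 - (T.Qb P j w).1).2 := by
  have hP0 := LinearMap.mem_ker.1 (T.P0 P j 𝔸 (T.Qb P j w)).2.2
  rw [LinearMap.snd_apply] at hP0
  change v.1.2 - ((T.Qb P j w).1 - (T.P0 P j 𝔸 (T.Qb P j w)).1).2 = _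
  rw [Prod.snd_sub, Prod.snd_sub, hP0, sub_zero]

lemma bdSq_congr {u v : T.Weak} (h : u.2 = v.2) : bdSq u = bdSq v := by
  rw [bdSq, bdSq, h]

variable (n P j κ α β)

/-- The uniform constants of the auxiliary space method. -/
lemma exists_auxSpace (hα : 0 < α) : ∃ K₁ K₂ : ℝ, ∀ (Ω : Set (E (n + 1))) (T : Mesh (n + 1) Ω)
    (hΩ : IsOpen Ω), Ω.Nonempty → (∀ K : T.elements, IsSized K κ T.meshSize) →
    ∀ (𝔸 : E (n + 1) → Matrix (Fin (n + 1)) (Fin (n + 1)) ℝ) (h𝔸 : IsDiffusion Ω α β 𝔸)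
    (c₁ c₂ c₃ c₄ : ℝ), 0 < c₁ → 0 < c₃ →
    ∀ R : T.Vr P j 𝔸 →ₗ[ℝ] T.Vr P j 𝔸, T.IsSmoother P j 𝔸 c₁ c₂ R →
    ∀ S : T.P1 →ₗ[ℝ] T.P1, T.IsCoarseSolver 𝔸 c₃ c₄ S →
    AuxSpace (iprForm T P j 𝔸) (arForm T P j hΩ h𝔸 hα) T.ipcForm (acForm hΩ h𝔸 hα)
      (T.Ar P j 𝔸) R (T.Ac 𝔸) S (T.Pir P j 𝔸) (T.PirT P j 𝔸) (lambdaMax (T.Ar P j 𝔸))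
      c₁ c₂ c₃ c₄ K₁ K₂ := by
  obtain ⟨C₁, hC₁, h1⟩ := exists_gradSq_le_localIp n P j κ
  obtain ⟨C₂, hC₂, h2⟩ := exists_ip_le_bdSq n P j α β κ hα
  obtain ⟨C₃, hC₃, h3⟩ := exists_ah_Pir_le n P j α β κ hα
  obtain ⟨C₄, hC₄, h4⟩ := exists_P1_approx n P j κ
  refine ⟨C₃ / α, (|β| + 1) * C₁ * (C₂ * C₄) / α + (|β| * C₄ + 1) / α,
    fun Ω T hΩ hne hT 𝔸 h𝔸 c₁ c₂ c₃ c₄ hc₁ hc₃ R hR S hS => ?_⟩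
  have hnE := T.nonempty_elements hne
  have hh : 0 < T.meshSize := (hT hnE.some).hpos
  have hM := iprForm_isInner (P := P) (j := j) (𝔸 := 𝔸) hT
  have hasemi : IsSemiInner (arForm T P j hΩ h𝔸 hα) :=
    (ahForm_isSemiInner T P j hΩ h𝔸 hα).comp _
  set h := T.meshSize
  have hEa : ∀ v : T.Vr P j 𝔸, energy P j v.1 ≤ arForm T P j hΩ h𝔸 hα v v / α := fun v => by
    rw [le_div_iff₀' hα]
    exact le_ahForm hΩ h𝔸 hα (Submodule.inclusion Vr_le v)
  -- The error `v - Π_r w` lies in `V_r`, so its norm is controlled by its boundary part, which is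
  -- that of `v - Q_b w`. One factor `h` comes from this step and one from the approximation.
  have hdec : ∀ v : T.Vr P j 𝔸, ∃ w : T.P1,
      iprForm T P j 𝔸 (v - T.Pir P j 𝔸 w) (v - T.Pir P j 𝔸 w) ≤
        C₂ * C₄ / α * h ^ 2 * arForm T P j hΩ h𝔸 hα v v ∧
      acForm hΩ h𝔸 hα w w ≤ |β| * C₄ / α * arForm T P j hΩ h𝔸 hα v v := fun v => by
    obtain ⟨w, hw1, hw2⟩ := h4 Ω T hΩ hT hnE v.1 (Vr_le v.2)
    refine ⟨w, ?_, ?_⟩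
    · have f1 := h2 Ω T hΩ hT 𝔸 h𝔸 _ (v - T.Pir P j 𝔸 w).2
      rw [bdSq_congr (sub_Pir_mem v w)] at f1
      calc _ ≤ _ := f1
        _ ≤ C₂ * h * (C₄ * h * energy P j v.1) := by gcongr
        _ ≤ C₂ * h * (C₄ * h * (arForm T P j hΩ h𝔸 hα v v / α)) := by
            have := hEa v
            gcongr
        _ = _ := by ring
    · calc _ ≤ _ := acForm_le w
        _ ≤ |β| * gradEnergy w := mul_le_mul_of_nonneg_right (le_abs_self β) (gradEnergy_nonneg w)
        _ ≤ |β| * (C₄ * energy P j v.1) := by gcongr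
        _ ≤ |β| * (C₄ * (arForm T P j hΩ h𝔸 hα v v / α)) := by
            have := hEa v
            gcongr
        _ = _ := by ring
  have hAr : ∀ u v, iprForm T P j 𝔸 (T.Ar P j 𝔸 u) v = arForm T P j hΩ h𝔸 hα u v := fun u v => by
    rw [arForm_apply]
    exact formOperator_spec hM (arForm T P j hΩ h𝔸 hα) (fun _ _ => rfl)
      (a' := fun u v : T.Vr P j 𝔸 => T.ah P j 𝔸 u v) (fun u v => (arForm_apply u v).symm) u v
  have hAc : ∀ w z, T.ipcForm (T.Ac 𝔸 w) z = acForm hΩ h𝔸 hα w z := fun w z => by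
    rw [← ac_eq]
    exact formOperator_spec (ipcForm_isInner T) (acForm hΩ h𝔸 hα) (fun _ _ => rfl)
      (a' := T.ac 𝔸) (fun u v => ac_eq hΩ h𝔸 hα u v) w z
  -- The inverse inequality gives `ρ ≤ C h⁻²`, which cancels the `h ^ 2` of `hdec`.
  have hrho : lambdaMax (T.Ar P j 𝔸) ≤ (|β| + 1) * C₁ / h ^ 2 := by
    refine lambdaMax_le hM hAr (by positivity) fun v => ?_
    have f1 : h ^ 2 * energy P j v.1 ≤ C₁ * iprForm T P j 𝔸 v v := by
      rw [iprForm_apply, ipr, ip_eq, energy, Finset.mul_sum, Finset.mul_sum]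
      exact Finset.sum_le_sum fun K _ => h1 Ω T K h (hT K) v.1 (Vr_le v.2)
    have f2 := ahForm_le hΩ h𝔸 hα (Submodule.inclusion Vr_le v)
    have hE := energy_nonneg (P := P) (j := j) v.1
    calc _ ≤ β * energy P j v.1 := f2
      _ ≤ (|β| + 1) * energy P j v.1 := by
          gcongr
          linarith [le_abs_self β]
      _ = (|β| + 1) / h ^ 2 * (h ^ 2 * energy P j v.1) := by field_simp
      _ ≤ (|β| + 1) / h ^ 2 * (C₁ * iprForm T P j 𝔸 v v) := by gcongr
      _ = _ := by ring
  exact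
  { innerM := hM
    innerA := by
      -- Definiteness of the energy on `V_r` follows from the decomposition: without energy, `w` has
      -- none either and vanishes, and then `v = v - Π_r w` has norm zero.
      refine ⟨hasemi.symm, fun v hv => lt_of_le_of_ne (hasemi.nonneg v) fun h0 => ?_⟩
      obtain ⟨w, hw1, hw2⟩ := hdec v
      rw [← h0, mul_zero] at hw1 hw2
      have hw : w = 0 := by
        by_contra hne
        exact ((acForm_isInner (hΩ := hΩ) (h𝔸 := h𝔸) (hα := hα)).pos w hne).not_ge hw2
      rw [hw, map_zero, sub_zero] at hw1
      exact (hM.pos v hv).not_ge hw1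
    innerN := ipcForm_isInner T
    innerB := acForm_isInner
    hA := hAr
    hAc := hAc
    hPt := fun v w => formOperator_spec (ipcForm_isInner T)
      ((iprForm T P j 𝔸).compl₁₂ LinearMap.id (T.Pir P j 𝔸)) (fun _ _ => rfl)
      (a' := fun v w => T.ipr P j 𝔸 v (T.Pir P j 𝔸 w)) (fun _ _ => rfl) v w
    symmR := hR.1
    symmS := hS.1
    rho := le_lambdaMax hM hasemi hAr
    lowR := fun v => (hR.2 v).1
    upR := fun v => (hR.2 v).2
    lowS := fun w => by
      rw [← hAc]
      exact (hS.2 w).1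
    upS := fun w => by
      rw [← hAc]
      exact (hS.2 w).2
    stable := fun w => by
      rw [arForm_apply, div_mul_eq_mul_div, le_div_iff₀ hα]
      have f1 := h3 Ω T hΩ hT 𝔸 h𝔸 w
      have f2 := le_acForm (hΩ := hΩ) (h𝔸 := h𝔸) (hα := hα) w
      calc _ ≤ C₃ * gradEnergy w * α := by gcongr
        _ = C₃ * (α * gradEnergy w) := by ring
        _ ≤ _ := by gcongr
    decomp := fun v => by
      obtain ⟨w, hw1, hw2⟩ := hdec v
      have ha := hasemi.nonneg v
      have hm := hM.semi.nonneg (v - T.Pir P j 𝔸 w)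
      refine ⟨w, ?_, hw2.trans ?_⟩
      · calc _ ≤ (|β| + 1) * C₁ / h ^ 2 * (C₂ * C₄ / α * h ^ 2 * arForm T P j hΩ h𝔸 hα v v) :=
              mul_le_mul hrho hw1 hm (by positivity)
          _ = (|β| + 1) * C₁ * (C₂ * C₄) / α * arForm T P j hΩ h𝔸 hα v v := by
              field_simp
          _ ≤ _ := by
              gcongr
              have : 0 ≤ (|β| * C₄ + 1) / α := by positivity
              linarith
      · gcongr
        have f1 : 0 ≤ (|β| + 1) * C₁ * (C₂ * C₄) / α := by positivity
        have f2 : |β| * C₄ / α ≤ (|β| * C₄ + 1) / α := by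
          gcongr
          linarith
        linarith
    c₁_pos := hc₁
    c₃_pos := hc₃
    K₁_pos := by positivity
    K₂_pos := by positivity }

end Mesh

end

end WG

end

theorem mainTheorem2 (d : ℕ) (hd : d = 2 ∨ d = 3)
    (Ω : Set (WG.E d)) (hΩ : IsOpen Ω) (hconn : IsConnected Ω)
    (P : WG.Pair) (j : ℕ) (α β σ τ c₁ c₂ c₃ c₄ ω : ℝ)
    (hα : 0 < α) (hc₁ : 0 < c₁) (hc₃ : 0 < c₃) (hω : ω < 2) :
    ∃ C : ℝ, ∀ T : WG.Mesh d Ω, T.IsShapeRegular σ → T.IsQuasiUniform τ →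
      ∀ 𝔸 : WG.E d → Matrix (Fin d) (Fin d) ℝ, WG.IsDiffusion Ω α β 𝔸 →
      ∀ R : T.Vr P j 𝔸 →ₗ[ℝ] T.Vr P j 𝔸, T.IsSmoother P j 𝔸 c₁ c₂ R →
      ∀ 𝓑 : T.P1 →ₗ[ℝ] T.P1, T.IsCoarseSolver 𝔸 c₃ c₄ 𝓑 →
        (WG.IsSPD (T.ipr P j 𝔸) (T.additive P j 𝔸 R 𝓑) ∧
          WG.condNumber (T.additive P j 𝔸 R 𝓑 ∘ₗ T.Ar P j 𝔸) ≤ C) ∧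
        ((∀ v, T.ipr P j 𝔸 (R (T.Ar P j 𝔸 v)) (T.Ar P j 𝔸 v) ≤
            ω * T.ipr P j 𝔸 (T.Ar P j 𝔸 v) v) →
          (∃! B, T.IsMultiplicative P j 𝔸 R 𝓑 B) ∧
          ∀ B, T.IsMultiplicative P j 𝔸 R 𝓑 B →
            WG.IsSPD (T.ipr P j 𝔸) B ∧ WG.condNumber (B ∘ₗ T.Ar P j 𝔸) ≤ C) := by
  obtain ⟨n, rfl⟩ : ∃ n, d = n + 1 := ⟨d - 1, by omega⟩
  obtain ⟨K₁, K₂, h⟩ := WG.Mesh.exists_auxSpace n P j α β (1 / (σ * τ)) hα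
  -- The constants `K₁` and `K₂` precede the mesh and the coefficient, so this bound does not depend
  -- on them; the two entries are the bounds for the additive and the multiplicative method.
  refine ⟨max ((|c₂| + |c₄| * K₁) / (2 * K₂ * (1 / c₁ + 1 / c₃))⁻¹)
    ((1 + |c₄| * K₁) / (2 * K₂ * (1 / c₁ + 1 / c₃) *
      ((1 + 2 * (|c₄| * K₁) * |ω|) / (2 - ω) + 2))⁻¹),
    fun T hs hq 𝔸 h𝔸 R hR 𝓑 h𝓑 => ?_⟩
  have aux := h Ω T hΩ hconn.nonempty (T.isSized hs hq) 𝔸 h𝔸 c₁ c₂ c₃ c₄ hc₁ hc₃ R hR 𝓑 h𝓑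
  refine ⟨⟨aux.additive_isSPD, aux.additive_condNumber.trans (le_max_left _ _)⟩, fun hRω => ?_⟩
  exact ⟨aux.mult_existsUnique, fun B hB => ⟨aux.mult_isSPD hω hRω hB,
    (aux.mult_condNumber hω hRω hB).trans (le_max_right _ _)⟩⟩
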